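/- Let $\tau$ be a finite signature with relation and function symbols (constants are nullary function symbols) and let $k\in\mathbb N$; both are fixed. $\mathsf{FO}(k)$ is first-order logic over $\tau$ (no built-in equality) with the variables $x_1,\dots,x_k$: $$\varphi ::= R(\bar t)\mid \varphi\vee\varphi\mid\varphi\wedge\varphi\mid\neg\varphi\mid\exists x.\varphi\mid\forall x.\varphi,\qquad t ::= x\mid f(\bar t)\mid \mathsf{ite}(\varphi,t,t'),$$ where $\mathsf{ite}(\varphi,t,t')$ has the value of $t$ if $\varphi$ is true and the value of $t'$ otherwise. Formulas are identified with their syntax trees over the ranked alphabet that consists of the symbols of $\tau$, $\mathsf{ite}$ (arity 3), $\wedge,\vee$ (arity 2), $\neg,\forall x_i,\exists x_i$ (arity 1), and $x_i$ (arity 0). For a regular tree grammar $G$ over this alphabet (finitely many rules $B\to t$, where $B$ is a nonterminal and $t$ a tree that may have nonterminals as leaves), $L(G)$ is the set of trees without nonterminals derivable from the axiom of $G$. An input consists of a number $r\le k$, a finite list of pairs $\langle A_1,\mathit{Ans}_1\rangle,\dots,\langle A_m,\mathit{Ans}_m\rangle$ of finite nonempty $\tau$-structures $A_i$ and sets $\mathit{Ans}_i\subseteq\mathsf{dom}(A_i)^r$,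 and a regular tree grammar $G$ over the alphabet of $\mathsf{FO}(k)$. A solution is a formula $\varphi(x_1,\dots,x_r)\in L(G)$ whose free variables are exactly $x_1,\dots,x_r$ and which satisfies $$\{\bar a\in\mathsf{dom}(A_i)^r\mid A_i\models\varphi(\bar a)\}=\mathit{Ans}_i\qquad\text{for all } i\in\{1,\dots,m\}.$$ Inputs are written as words over a finite alphabet: domains are $\{0,\dots,n-1\}$ with $n$ in unary, relations, functions and answer sets are given by their tables, and the grammar is given by its nonterminals, axiom and rules. Theorem. For every fixed finite signature $\tau$ and every fixed $k$, query synthesis for $\mathsf{FO}(k)$ is decidable in $\mathsf{EXPTIME}$: 1. the set of (encodings of) inputs that have a solution is in $\mathsf{EXPTIME}$; 2. there are a (multi-stack) Turing machine and a polynomial $p$ such that, on every input with encoding of length $N$, the machine halts after at most $2^{p(N)}$ steps and outputs the syntax tree of a solution if there is one, and "No" otherwise. The tree is output in shared form, as a list of nodes, each with a symbol and references to its children, together with a reference to the root, so that equal subtrees may be written only once. -/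

import Mathlib

namespace QuerySynth

/-! ### Formulas of first-order logic with `k` variables and if-then-else terms -/

/-- The two syntactic categories: formulas and terms. -/
inductive Srt : Type
  | form
  | term

/-- Formulas and terms of `FO(k)` over the signature `τ`; the variables are `x₀, …, x_{k-1}`.
Constants are nullary function symbols, and there is no built-in equality symbol. -/
inductive Expr (τ : FirstOrder.Language.{0, 0}) (k : ℕ) : Srt → Type
  | rel {l : ℕ} (R : τ.Relations l) (ts : Fin l → Expr τ k .term) : Expr τ k .form
  | or (φ ψ : Expr τ k .form) : Expr τ k .form
  | and (φ ψ : Expr τ k .form) : Expr τ k .form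
  | not (φ : Expr τ k .form) : Expr τ k .form
  | ex (x : Fin k) (φ : Expr τ k .form) : Expr τ k .form
  | all (x : Fin k) (φ : Expr τ k .form) : Expr τ k .form
  | var (x : Fin k) : Expr τ k .term
  | fn {l : ℕ} (f : τ.Functions l) (ts : Fin l → Expr τ k .term) : Expr τ k .term
  | ite (φ : Expr τ k .form) (t t' : Expr τ k .term) : Expr τ k .term

abbrev Formula (τ : FirstOrder.Language.{0, 0}) (k : ℕ) : Type := Expr τ k .form

/-- A formula denotes a proposition, a term denotes an element of the domain `M`. -/
abbrev Srt.Val (M : Type) : Srt → Type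
  | .form => Prop
  | .term => M

open Classical in
/-- The value of a formula or term in the structure `A` under the assignment `γ`. -/
noncomputable def Expr.eval {τ : FirstOrder.Language.{0, 0}} {k : ℕ} {M : Type}
    (A : τ.Structure M) : {s : Srt} → Expr τ k s → (Fin k → M) → s.Val M
  | _, .rel R ts, γ => A.RelMap R (fun i => (ts i).eval A γ)
  | _, .or φ ψ, γ => φ.eval A γ ∨ ψ.eval A γ
  | _, .and φ ψ, γ => φ.eval A γ ∧ ψ.eval A γ
  | _, .not φ, γ => ¬ φ.eval A γ
  | _, .ex x φ, γ => ∃ a : M, φ.eval A (Function.update γ x a)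
  | _, .all x φ, γ => ∀ a : M, φ.eval A (Function.update γ x a)
  | _, .var x, γ => γ x
  | _, .fn f ts, γ => A.funMap f (fun i => (ts i).eval A γ)
  | _, .ite φ t t', γ => if φ.eval A γ then t.eval A γ else t'.eval A γ

/-- The free variables of a formula or term. -/
def Expr.freeVars {τ : FirstOrder.Language.{0, 0}} {k : ℕ} : {s : Srt} → Expr τ k s → Set (Fin k)
  | _, .rel _ ts => ⋃ i, (ts i).freeVars
  | _, .or φ ψ => φ.freeVars ∪ ψ.freeVars
  | _, .and φ ψ => φ.freeVars ∪ ψ.freeVars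
  | _, .not φ => φ.freeVars
  | _, .ex x φ => φ.freeVars \ {x}
  | _, .all x φ => φ.freeVars \ {x}
  | _, .var x => {x}
  | _, .fn _ ts => ⋃ i, (ts i).freeVars
  | _, .ite φ t t' => φ.freeVars ∪ t.freeVars ∪ t'.freeVars

/-- `φ` is an `r`-ary query: its free variables are exactly the first `r` variables. -/
def IsQuery {τ : FirstOrder.Language.{0, 0}} {k r : ℕ} (hr : r ≤ k) (φ : Formula τ k) : Prop :=
  φ.freeVars = Set.range (Fin.castLE hr)

/-- The answer set of `φ` in `A`: the tuples `a` such that `A ⊨ φ(a)`, where the `i`-th variable is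
assigned `a i` for `i < r`. (For an `r`-ary query the other values of `γ` are irrelevant.) -/
def answerSet {τ : FirstOrder.Language.{0, 0}} {k r : ℕ} (hr : r ≤ k) {M : Type} (A : τ.Structure M)
    (φ : Formula τ k) : Set (Fin r → M) :=
  {a | ∀ γ : Fin k → M, (∀ i, γ (Fin.castLE hr i) = a i) → φ.eval A γ}

/-! ### Trees over the ranked alphabet of `FO(k)` and regular tree grammars -/

/-- The ranked alphabet of `FO(k)` over `τ`. -/
inductive Sym (τ : FirstOrder.Language.{0, 0}) (k : ℕ) : Type
  | rel {l : ℕ} (R : τ.Relations l)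
  | fn {l : ℕ} (f : τ.Functions l)
  | ite
  | and
  | or
  | not
  | all (x : Fin k)
  | ex (x : Fin k)
  | var (x : Fin k)

def Sym.arity {τ : FirstOrder.Language.{0, 0}} {k : ℕ} : Sym τ k → ℕ
  | @Sym.rel _ _ l _ => l
  | @Sym.fn _ _ l _ => l
  | .ite => 3
  | .and => 2
  | .or => 2
  | .not => 1
  | .all _ => 1
  | .ex _ => 1
  | .var _ => 0

/-- `Tree τ k N` is the set of ranked trees over the alphabet `Sym τ k`, augmented with the
elements of `N` as nullary symbols. Trees without such leaves form `Tree τ k Empty`. -/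
inductive Tree (τ : FirstOrder.Language.{0, 0}) (k : ℕ) (N : Type) : Type
  | leaf (B : N) : Tree τ k N
  | node (a : Sym τ k) (ts : Fin a.arity → Tree τ k N) : Tree τ k N

/-- Trees without nonterminals, seen as trees which may contain nonterminals. -/
def Tree.embed {τ : FirstOrder.Language.{0, 0}} {k : ℕ} {N : Type} : Tree τ k Empty → Tree τ k N
  | .node a ts => .node a (fun i => (ts i).embed)

/-- The syntax tree of a formula or term. -/
def Expr.toTree {τ : FirstOrder.Language.{0, 0}} {k : ℕ} : {s : Srt} → Expr τ k s → Tree τ k Empty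
  | _, .rel R ts => .node (.rel R) (fun i => (ts i).toTree)
  | _, .or φ ψ => .node .or ![φ.toTree, ψ.toTree]
  | _, .and φ ψ => .node .and ![φ.toTree, ψ.toTree]
  | _, .not φ => .node .not ![φ.toTree]
  | _, .ex x φ => .node (.ex x) ![φ.toTree]
  | _, .all x φ => .node (.all x) ![φ.toTree]
  | _, .var x => .node (.var x) ![]
  | _, .fn f ts => .node (.fn f) (fun i => (ts i).toTree)
  | _, .ite φ t t' => .node .ite ![φ.toTree, t.toTree, t'.toTree]

/-- A regular tree grammar over `FO(k)`, with nonterminals `0, …, numNT - 1`, an axiom, and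
finitely many rules `B → t`. -/
structure Grammar (τ : FirstOrder.Language.{0, 0}) (k : ℕ) : Type where
  numNT : ℕ
  start : Fin numNT
  rules : List (Fin numNT × Tree τ k (Fin numNT))

/-- One rewrite step `C[B] ⇒ C[t]` with `B → t` a rule and `C` a context. -/
inductive Grammar.Step {τ : FirstOrder.Language.{0, 0}} {k : ℕ} (G : Grammar τ k) :
    Tree τ k (Fin G.numNT) → Tree τ k (Fin G.numNT) → Prop
  | rule {B : Fin G.numNT} {t : Tree τ k (Fin G.numNT)} (h : (B, t) ∈ G.rules) :
      Grammar.Step G (.leaf B) t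
  | child {a : Sym τ k} (ts : Fin a.arity → Tree τ k (Fin G.numNT)) (i : Fin a.arity)
      {t : Tree τ k (Fin G.numNT)} (h : Grammar.Step G (ts i) t) :
      Grammar.Step G (.node a ts) (.node a (Function.update ts i t))

/-- The language `L(G)`. -/
def Grammar.language {τ : FirstOrder.Language.{0, 0}} {k : ℕ} (G : Grammar τ k) : Set (Tree τ k Empty) :=
  {t | Relation.ReflTransGen G.Step (.leaf G.start) t.embed}

/-! ### The query synthesis problem -/

/-- A finite structure with domain `{0, …, size - 1}`, paired with a set of `r`-tuples. -/
structure Example (τ : FirstOrder.Language.{0, 0}) (r : ℕ) : Type where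
  size : ℕ
  size_pos : 0 < size
  str : τ.Structure (Fin size)
  ans : Set (Fin r → Fin size)

/-- An input of the query synthesis problem for `FO(k)` over `τ`. -/
structure Input (τ : FirstOrder.Language.{0, 0}) (k : ℕ) : Type where
  r : ℕ
  r_le : r ≤ k
  examples : List (Example τ r)
  grammar : Grammar τ k

/-- `φ` is an `r`-ary query in `L(G)` with the given answer set in each given structure. -/
def Input.IsSolution {τ : FirstOrder.Language.{0, 0}} {k : ℕ} (I : Input τ k) (φ : Formula τ k) : Prop :=
  φ.toTree ∈ I.grammar.language ∧ IsQuery I.r_le φ ∧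
    ∀ E ∈ I.examples, answerSet I.r_le E.str φ = E.ans

/-- Trees presented with sharing: a list of nodes, each carrying a symbol and the positions in the
list of its children, together with the position of the root. -/
structure SharedTree (τ : FirstOrder.Language.{0, 0}) (k : ℕ) : Type where
  nodes : List (Σ a : Sym τ k, Fin a.arity → ℕ)
  root : ℕ

/-- `D.UnfoldsAt i t`: the tree `t` is the unfolding of `D` from the node at position `i`. -/
inductive SharedTree.UnfoldsAt {τ : FirstOrder.Language.{0, 0}} {k : ℕ} (D : SharedTree τ k) :
    ℕ → Tree τ k Empty → Prop
  | node {i : ℕ} {a : Sym τ k} {c : Fin a.arity → ℕ} {ts : Fin a.arity → Tree τ k Empty}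
      (hi : D.nodes[i]? = some ⟨a, c⟩) (h : ∀ j, SharedTree.UnfoldsAt D (c j) (ts j)) :
      SharedTree.UnfoldsAt D i (.node a ts)

/-- `D` presents the tree `t`. -/
def SharedTree.Presents {τ : FirstOrder.Language.{0, 0}} {k : ℕ} (D : SharedTree τ k)
    (t : Tree τ k Empty) : Prop :=
  D.UnfoldsAt D.root t

/-! ### Encodings by words over a finite alphabet -/

/-- The letters: the symbols of the ranked alphabet, bits, and two letters `tick` and `mark`. -/
inductive Letter (τ : FirstOrder.Language.{0, 0}) (k : ℕ) : Type
  | sym (a : Sym τ k)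
  | bit (b : Bool)
  | tick
  | mark

/-- A natural number in unary. -/
def encNat {τ : FirstOrder.Language.{0, 0}} {k : ℕ} (n : ℕ) : List (Letter τ k) :=
  List.replicate n .tick ++ [.mark]

/-- A list: `tick` before each entry, `mark` at the end. -/
def encList {τ : FirstOrder.Language.{0, 0}} {k : ℕ} {α : Type} (e : α → List (Letter τ k)) (xs : List α) :
    List (Letter τ k) :=
  xs.flatMap (fun x => .tick :: e x) ++ [.mark]

/-- The table of a function on `{0, …, n-1}^l`: its values are listed in the order in which the
arguments `(a₀, …, a_{l-1})` are enumerated by the number `∑ i, a i * n ^ i`. -/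
def encTable {τ : FirstOrder.Language.{0, 0}} {k n l : ℕ} {α : Type} (e : α → List (Letter τ k))
    (F : (Fin l → Fin n) → α) : List (Letter τ k) :=
  (List.finRange (n ^ l)).flatMap (fun j => e (F (finFunctionFinEquiv.symm j)))

open Classical in
noncomputable def encProp {τ : FirstOrder.Language.{0, 0}} {k : ℕ} (P : Prop) : List (Letter τ k) :=
  [.bit (decide P)]

/-- A tree in prefix notation; the leaf `B` is written as a number. -/
def encTree {τ : FirstOrder.Language.{0, 0}} {k q : ℕ} : Tree τ k (Fin q) → List (Letter τ k)
  | .leaf B => encNat B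
  | .node a ts => .sym a :: (List.finRange a.arity).flatMap (fun i => encTree (ts i))

/-- The table of the interpretation of a symbol of `τ` in the structure `A`. -/
noncomputable def encInterp {τ : FirstOrder.Language.{0, 0}} {k n : ℕ}
    (A : τ.Structure (Fin n)) : τ.Symbols → List (Letter τ k)
  | .inl ⟨_, f⟩ => encTable (fun b : Fin n => encNat b) (A.funMap f)
  | .inr ⟨_, R⟩ => encTable encProp (A.RelMap R)

/-- The size of the domain in unary, the tables of all symbols of `τ` (in an order which depends
only on `τ`), and the table of the answer set. -/
noncomputable def encExample {τ : FirstOrder.Language.{0, 0}} [Fintype τ.Symbols] {k r : ℕ}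
    (E : Example τ r) : List (Letter τ k) :=
  encNat E.size ++ (Finset.univ : Finset τ.Symbols).toList.flatMap (encInterp E.str) ++
    encTable encProp (fun a => a ∈ E.ans)

def encGrammar {τ : FirstOrder.Language.{0, 0}} {k : ℕ} (G : Grammar τ k) : List (Letter τ k) :=
  encNat G.numNT ++ encNat G.start ++ encList (fun p => encNat p.1 ++ encTree p.2) G.rules

noncomputable def encInput {τ : FirstOrder.Language.{0, 0}} [Fintype τ.Symbols] {k : ℕ}
    (I : Input τ k) : List (Letter τ k) :=
  encNat I.r ++ encList encExample I.examples ++ encGrammar I.grammar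

/-- An output: the answer "No" or a tree presented with sharing. -/
def encOutput {τ : FirstOrder.Language.{0, 0}} {k : ℕ} : Option (SharedTree τ k) → List (Letter τ k)
  | none => [.bit false]
  | some D => .bit true :: encList (fun v => .sym v.1 ::
      (List.finRange v.1.arity).flatMap (fun i => encNat (v.2 i))) D.nodes ++ encNat D.root

/-! ### Exponential time -/

/-- `f` is computed by a Turing machine in time `2 ^ p(n)` for a polynomial `p`, where `n` is the
length of the encoded argument. -/
def ComputableInExpTime {α β αΓ βΓ : Type} (ea : α → List αΓ) (eb : β → List βΓ) (f : α → β) :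
    Prop :=
  ∃ (M : Turing.TM2ComputableInTime ea eb f) (p : Polynomial ℕ), ∀ n, M.time n ≤ 2 ^ p.eval n

open Classical in
/-- The complexity class EXPTIME, as a property of formal languages. -/
def InEXPTIME {Γ : Type} (L : Language Γ) : Prop :=
  ComputableInExpTime (id : List Γ → List Γ) Computability.encodeBool (fun w => decide (w ∈ L))

/-- The encodings of the inputs which have a solution. -/
def realizable (τ : FirstOrder.Language.{0, 0}) [Fintype τ.Symbols] (k : ℕ) :
    Language (Letter τ k) :=
  {w | ∃ I : Input τ k, encInput I = w ∧ ∃ φ : Formula τ k, I.IsSolution φ}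

/-- `f` solves the query synthesis problem: it returns (a presentation with sharing of) the syntax
tree of a solution whenever there is a solution, and "No" otherwise. -/
def IsSynthesizer {τ : FirstOrder.Language.{0, 0}} {k : ℕ} (f : Input τ k → Option (SharedTree τ k)) :
    Prop :=
  ∀ I : Input τ k,
    (∀ D, f I = some D → ∃ φ : Formula τ k, I.IsSolution φ ∧ D.Presents φ.toTree) ∧
    (f I = none → ¬ ∃ φ : Formula τ k, I.IsSolution φ)

end QuerySynth

/-!
# Query synthesis for `FO(k)` in exponential time

Fix an input with examples `(A₁, Ans₁), …, (Aₘ, Ansₘ)`, answer arity `r` and grammar `G`. The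
*behaviour* of an expression (`Beh`) consists of its sort, its set of free variables, and its value
at every *point*, that is, for every assignment of the `k` variables in every structure `Aᵢ`. The
behaviour of an expression is a function `opBeh` of its root symbol and the behaviours of its
immediate subexpressions (`opBeh_rep`, `exists_expr_of_opBeh`), because a quantifier or a connective
evaluated at a point only looks at values of its arguments at points of the same structure. Whether
a formula has the right free variables and the right answer sets can be read off from its behaviour
(`isSolution_iff`). As `k` is fixed, there are polynomially many points, and hence at most
exponentially many behaviours.

The algorithm collects *facts* (`Fact`) "some expression with behaviour `b` is derivable from the
tree `t`", where `t` is the axiom or a subtree of a right-hand side of a rule. In the algorithm, `t`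
is represented by the suffix of the input word at which its encoding starts. A fact about a tree
with root symbol `a` is inferred from facts about the children, and a fact about a nonterminal from
a fact about a right-hand side (`infer`). The facts found so far are kept in a list, and in every
round one fact with a new pair of state and behaviour is added, until there is none (`newFact`,
`saturate`). Every fact is sound (`infer_sound`), and at the end there is a fact for every derivable
expression (`exists_fact`), so that the input has a solution if and only if one of the facts
describes one. Since a fact remembers its root symbol and the positions of the facts for its
immediate subexpressions, the list of facts is itself a shared form of trees which contains a
solution, and is the output (`isSynthesizer_synth`).

Every round adds a fact with a new pair of state and behaviour, so the number of rounds and the size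
of the list are exponentially bounded (`exists_facts_bound`). A single round takes polynomial time
in the size of the list, because the arities of the symbols are bounded and there are only
polynomially many tuples of facts to try. Hence the whole computation takes exponential time
(`exists_saturation_program`).

The running time is that of a Turing machine with several stacks. Structured programs (`Cmd`) are
compiled to such machines, and one machine step is made per unit of time of the program
(`Exec.simulates`). All data are encoded by binary trees (`D`, `Enc`), which a program finds on top
of one of the stacks in prefix notation. `PT f` says that a program computes `f` in polynomial time;
the predicate is closed under composition, pairing, case distinctions, folds and iterations with
polynomially bounded intermediate values, so that the remaining functions need no programming. The
input is decoded by the polynomial-time function `parse`, which accepts exactly the encodings of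
inputs (`parse_encInput`, `parse_sound`).
-/

namespace QuerySynth

/-! ### Structured programs for stack machines -/

section StructuredPrograms

variable {K : Type} {Γ : K → Type} {σ : Type}

/-- Structured programs over stacks indexed by `K`, where `k` carries the alphabet `Γ k`, and a
register with values in `σ`. A popped symbol is merged into the register. -/
inductive Cmd (Γ : K → Type) (σ : Type) : Type
  | push (k : K) (g : σ → Γ k)
  | pop (k : K) (g : σ → Option (Γ k) → σ)
  | load (g : σ → σ)
  | seq (c d : Cmd Γ σ)
  | ite (p : σ → Bool) (c d : Cmd Γ σ)
  | loop (p : σ → Bool) (c : Cmd Γ σ)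

/-- `Exec c v S v' S' t`: started with register `v` and stacks `S`, the program `c` ends with
register `v'` and stacks `S'` after `t` machine steps. -/
inductive Exec [DecidableEq K] : Cmd Γ σ → σ → (∀ k, List (Γ k)) → σ → (∀ k, List (Γ k)) → ℕ → Prop
  | push {k g v S} : Exec (.push k g) v S v (Function.update S k (g v :: S k)) 1
  | pop {k g v S} : Exec (.pop k g) v S (g v (S k).head?) (Function.update S k (S k).tail) 1
  | load {g v S} : Exec (.load g) v S (g v) S 1
  | seq {c d v S v' S' v'' S'' t t'} (h : Exec c v S v' S' t) (h' : Exec d v' S' v'' S'' t') :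
      Exec (.seq c d) v S v'' S'' (t' + t)
  | iteT {p c d v S v' S' t} (hp : p v = true) (h : Exec c v S v' S' t) :
      Exec (.ite p c d) v S v' S' (t + 1)
  | iteF {p c d v S v' S' t} (hp : p v = false) (h : Exec d v S v' S' t) :
      Exec (.ite p c d) v S v' S' (t + 1)
  | loopF {p c v S} (hp : p v = false) : Exec (.loop p c) v S v S 1
  | loopT {p c v S v' S' v'' S'' t t'} (hp : p v = true) (h : Exec c v S v' S' t)
      (h' : Exec (.loop p c) v' S' v'' S'' t') : Exec (.loop p c) v S v'' S'' (t' + t + 1)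

/-- The labels of the machine which runs `c`: one for each position in `c` at which a machine step
starts. -/
def Cmd.Lab : Cmd Γ σ → Type
  | .push _ _ => Unit
  | .pop _ _ => Unit
  | .load _ => Unit
  | .seq c d => c.Lab ⊕ d.Lab
  | .ite _ c d => Option (c.Lab ⊕ d.Lab)
  | .loop _ c => Option c.Lab

/-- The label at which the execution of `c` starts. -/
def Cmd.entry : (c : Cmd Γ σ) → c.Lab
  | .push _ _ => ()
  | .pop _ _ => ()
  | .load _ => ()
  | .seq c _ => Sum.inl c.entry
  | .ite _ _ _ => none
  | .loop _ _ => none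

theorem Cmd.finite_lab (c : Cmd Γ σ) : Finite c.Lab := by
  induction c with
  | push | pop | load => exact inferInstanceAs (Finite Unit)
  | seq c d hc hd => exact inferInstanceAs (Finite (c.Lab ⊕ d.Lab))
  | ite p c d hc hd => exact inferInstanceAs (Finite (Option (c.Lab ⊕ d.Lab)))
  | loop p c hc => exact inferInstanceAs (Finite (Option c.Lab))

/-- The machine code of `c`, where `emb` embeds the labels of `c` into those of the whole machine,
and `next` is the statement with which the last machine step of `c` is completed. -/
def Cmd.code {Λ : Type} : (c : Cmd Γ σ) → (c.Lab → Λ) → Turing.TM2.Stmt Γ Λ σ → c.Lab →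
    Turing.TM2.Stmt Γ Λ σ
  | .push k g, _, next, _ => .push k g next
  | .pop k g, _, next, _ => .pop k g next
  | .load g, _, next, _ => .load g next
  | .seq c d, emb, _, .inl l =>
      c.code (emb ∘ Sum.inl) (.goto fun _ => emb (Sum.inr d.entry)) l
  | .seq _ d, emb, next, .inr l => d.code (emb ∘ Sum.inr) next l
  | .ite p c d, emb, _, none =>
      .branch p (.goto fun _ => emb (some (Sum.inl c.entry)))
        (.goto fun _ => emb (some (Sum.inr d.entry)))
  | .ite _ c _, emb, next, some (.inl l) => c.code (emb ∘ some ∘ Sum.inl) next l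
  | .ite _ _ d, emb, next, some (.inr l) => d.code (emb ∘ some ∘ Sum.inr) next l
  | .loop p c, emb, next, none => .branch p (.goto fun _ => emb (some c.entry)) next
  | .loop _ c, emb, _, some l => c.code (emb ∘ some) (.goto fun _ => emb none) l

theorem iterate_bind_trans {α : Type} {f : α → Option α} {a b : α} {o : Option α} {m n : ℕ}
    (h : (flip bind f)^[m] (some a) = some b) (h' : (flip bind f)^[n] (some b) = o) :
    (flip bind f)^[n + m] (some a) = o := by
  rw [Function.iterate_add_apply, h, h']

/-- The compiled program simulates the structured program step by step. -/
theorem Exec.simulates [DecidableEq K] {c : Cmd Γ σ} {v v' : σ} {S S' : ∀ k, List (Γ k)} {t : ℕ}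
    (h : Exec c v S v' S' t) {Λ : Type} (m : Λ → Turing.TM2.Stmt Γ Λ σ) (emb : c.Lab → Λ)
    (next : Turing.TM2.Stmt Γ Λ σ) (hm : ∀ l, m (emb l) = c.code emb next l) :
    (flip bind (Turing.TM2.step m))^[t] (some ⟨some (emb c.entry), v, S⟩) =
      some (Turing.TM2.stepAux next v' S') := by
  induction h generalizing next with
  | push | pop | load => simp [flip, hm, Cmd.code]
  | @seq c d v S v' S' v'' S'' t t' h h' ih ih' =>
    exact iterate_bind_trans
      (ih (emb ∘ Sum.inl) (.goto fun _ => emb (Sum.inr d.entry)) fun l => hm (.inl l))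
      (ih' (emb ∘ Sum.inr) next fun l => hm (.inr l))
  | @iteT p c d v S v' S' t hp h ih =>
    refine iterate_bind_trans (m := 1) ?_
      (ih (emb ∘ some ∘ Sum.inl) next fun l => hm (some (.inl l)))
    have e := hm none
    simp only [Cmd.code] at e
    simp [flip, Cmd.entry, e, hp]
    rfl
  | @iteF p c d v S v' S' t hp h ih =>
    refine iterate_bind_trans (m := 1) ?_
      (ih (emb ∘ some ∘ Sum.inr) next fun l => hm (some (.inr l)))
    have e := hm none
    simp only [Cmd.code] at e
    simp [flip, Cmd.entry, e, hp]
    rfl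
  | loopF hp =>
    have e := hm none
    simp only [Cmd.code] at e
    simp [flip, Cmd.entry, e, hp]
  | @loopT p c v S v' S' v'' S'' t t' hp h h' ih ih' =>
    refine iterate_bind_trans (m := 1) (b := ⟨some (emb (some c.entry)), v, S⟩) ?_
      (iterate_bind_trans
        (ih (emb ∘ some) (.goto fun _ => emb none) fun l => hm (some l))
        (ih' emb next hm))
    have e := hm none
    simp only [Cmd.code] at e
    simp [flip, Cmd.entry, e, hp]

/-- `Runs c s T Q`: started in the state `s` (register and stacks), the program `c` ends after at
most `T` steps in a state which satisfies `Q`. -/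
def Runs [DecidableEq K] (c : Cmd Γ σ) (s : σ × ∀ k, List (Γ k)) (T : ℕ)
    (Q : σ × (∀ k, List (Γ k)) → Prop) : Prop :=
  ∃ t s', t ≤ T ∧ Exec c s.1 s.2 s'.1 s'.2 t ∧ Q s'

variable [DecidableEq K] {c d : Cmd Γ σ} {p : σ → Bool} {s : σ × ∀ k, List (Γ k)} {T T' : ℕ}
  {Q Q' : σ × (∀ k, List (Γ k)) → Prop}

theorem Runs.mono (h : Runs c s T Q) (hT : T ≤ T') (hQ : ∀ s, Q s → Q' s) : Runs c s T' Q' := by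
  obtain ⟨t, s', ht, he, hq⟩ := h
  exact ⟨t, s', ht.trans hT, he, hQ _ hq⟩

theorem Runs.push {k : K} {g : σ → Γ k}
    (h : Q (s.1, Function.update s.2 k (g s.1 :: s.2 k))) : Runs (.push k g) s 1 Q :=
  ⟨1, _, le_rfl, Exec.push, h⟩

theorem Runs.pop {k : K} {g : σ → Option (Γ k) → σ}
    (h : Q (g s.1 (s.2 k).head?, Function.update s.2 k (s.2 k).tail)) : Runs (.pop k g) s 1 Q :=
  ⟨1, _, le_rfl, Exec.pop, h⟩

theorem Runs.load {g : σ → σ} (h : Q (g s.1, s.2)) : Runs (.load g) s 1 Q :=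
  ⟨1, _, le_rfl, Exec.load, h⟩

theorem Runs.seq (h : Runs c s T fun s' => Runs d s' T' Q) : Runs (.seq c d) s (T + T') Q := by
  obtain ⟨t, s', ht, he, t', s'', ht', he', hq⟩ := h
  exact ⟨_, _, by omega, Exec.seq he he', hq⟩

theorem Runs.ite (h : p s.1 = true → Runs c s T Q) (h' : p s.1 = false → Runs d s T' Q) :
    Runs (.ite p c d) s (T + T' + 1) Q := by
  cases hp : p s.1 with
  | true =>
    obtain ⟨t, s', ht, he, hq⟩ := h hp
    exact ⟨_, _, by omega, Exec.iteT hp he, hq⟩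
  | false =>
    obtain ⟨t, s', ht, he, hq⟩ := h' hp
    exact ⟨_, _, by omega, Exec.iteF hp he, hq⟩

theorem Runs.loop_false (hp : p s.1 = false) (h : Q s) : Runs (.loop p c) s 1 Q :=
  ⟨_, _, le_rfl, Exec.loopF hp, h⟩

theorem Runs.loop_true (hp : p s.1 = true) (h : Runs c s T fun s' => Runs (.loop p c) s' T' Q) :
    Runs (.loop p c) s (T + T' + 1) Q := by
  obtain ⟨t, s', ht, he, t', s'', ht', he', hq⟩ := h
  exact ⟨_, _, by omega, Exec.loopT hp he he', hq⟩

/-- Nested sequences are reassociated so that the first instruction comes to the front, where one of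
the lemmas `Runs.seq_push`, `Runs.seq_pop`, … applies. -/
theorem Runs.seq_assoc {e : Cmd Γ σ} (h : Runs (.seq c (.seq d e)) s T Q) :
    Runs (.seq (.seq c d) e) s T Q := by
  obtain ⟨t, s', ht, he, hq⟩ := h
  cases he with
  | seq h₁ h₂ =>
    cases h₂ with
    | seq h₂ h₃ => exact ⟨_, s', by omega, Exec.seq (Exec.seq h₁ h₂) h₃, hq⟩

theorem Runs.loop_seq (hp : p s.1 = true) (h : Runs (.seq c (.loop p c)) s T Q) :
    Runs (.loop p c) s (T + 1) Q := by
  obtain ⟨t, s', ht, he, hq⟩ := h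
  cases he with
  | seq h₁ h₂ => exact ⟨_, s', by omega, Exec.loopT hp h₁ h₂, hq⟩

theorem Runs.seq_ite_true {e : Cmd Γ σ} (hp : p s.1 = true) (h : Runs (.seq c e) s T Q) :
    Runs (.seq (.ite p c d) e) s (T + 1) Q := by
  obtain ⟨t, s', ht, he, hq⟩ := h
  cases he with
  | seq h₁ h₂ => exact ⟨_, s', by omega, Exec.seq (Exec.iteT hp h₁) h₂, hq⟩

theorem Runs.seq_ite_false {e : Cmd Γ σ} (hp : p s.1 = false) (h : Runs (.seq d e) s T Q) :
    Runs (.seq (.ite p c d) e) s (T + 1) Q := by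
  obtain ⟨t, s', ht, he, hq⟩ := h
  cases he with
  | seq h₁ h₂ => exact ⟨_, s', by omega, Exec.seq (Exec.iteF hp h₁) h₂, hq⟩

theorem Runs.seq_push {k : K} {g : σ → Γ k}
    (h : Runs d (s.1, Function.update s.2 k (g s.1 :: s.2 k)) T Q) :
    Runs (.seq (.push k g) d) s (T + 1) Q :=
  (Runs.seq (Runs.push h)).mono (by omega) fun _ h => h

theorem Runs.seq_pop {k : K} {g : σ → Option (Γ k) → σ}
    (h : Runs d (g s.1 (s.2 k).head?, Function.update s.2 k (s.2 k).tail) T Q) :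
    Runs (.seq (.pop k g) d) s (T + 1) Q :=
  (Runs.seq (Runs.pop h)).mono (by omega) fun _ h => h

theorem Runs.seq_load {g : σ → σ} (h : Runs d (g s.1, s.2) T Q) :
    Runs (.seq (.load g) d) s (T + 1) Q :=
  (Runs.seq (Runs.load h)).mono (by omega) fun _ h => h

end StructuredPrograms

/-! ### A stack machine which operates on binary trees -/

/-- Binary trees, the data on which all programs operate. -/
inductive D : Type
  | nil
  | cons (x y : D)

/-- The number of nodes of a binary tree. -/
def D.size : D → ℕ
  | .nil => 1
  | .cons x y => x.size + y.size + 1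

theorem D.size_pos (x : D) : 0 < x.size := by cases x <;> simp [D.size]

/-- The prefix notation of a binary tree. It is self-delimiting. The third letter `none` of the
alphabet is used as a separator on auxiliary stacks. -/
def D.ser : D → List (Option Bool)
  | .nil => [some false]
  | .cons x y => some true :: (x.ser ++ y.ser)

theorem D.length_ser (x : D) : x.ser.length = x.size := by
  induction x with
  | nil => rfl
  | cons x y hx hy => simp [D.ser, D.size, hx, hy]

theorem D.ser_ne_none (x : D) : ∀ s ∈ x.ser, s ≠ none := by
  induction x with
  | nil => simp [D.ser]
  | cons x y hx hy =>
    intro s hs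
    simp only [D.ser, List.mem_cons, List.mem_append] at hs
    rcases hs with rfl | h | h
    · simp
    · exact hx s h
    · exact hy s h

/-- The prefix notation of a tree determines where it ends. -/
theorem D.ser_append_inj (x y : D) (u v : List (Option Bool)) (h : x.ser ++ u = y.ser ++ v) :
    x = y ∧ u = v := by
  induction x generalizing y u v with
  | nil => cases y <;> simp_all [D.ser]
  | cons x₁ x₂ h₁ h₂ =>
    cases y with
    | nil => simp [D.ser] at h
    | cons y₁ y₂ =>
      simp only [D.ser, List.cons_append, List.append_assoc, List.cons.injEq, true_and] at h
      obtain ⟨rfl, h'⟩ := h₁ _ _ _ h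
      obtain ⟨rfl, h''⟩ := h₂ _ _ _ h'
      exact ⟨rfl, h''⟩

theorem D.ser_injective : Function.Injective D.ser := fun x y h =>
  (D.ser_append_inj x y [] [] (by simpa using h)).1

/-- The stacks: input, output, the main stack `m` with the data, and three auxiliary stacks. -/
inductive Stk : Type
  | inp
  | out
  | m
  | a
  | b
  | c
  deriving DecidableEq

instance : Finite Stk :=
  Finite.of_injective (β := Fin 6)
    (fun | .inp => 0 | .out => 1 | .m => 2 | .a => 3 | .b => 4 | .c => 5)
    (by rintro (_ | _) (_ | _) h <;> first | rfl | simp at h)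

/-- The stack alphabets, for `p + 1` input letters and `q + 1` output letters. -/
abbrev Alpha (p q : ℕ) : Stk → Type
  | .inp => Fin (p + 1)
  | .out => Fin (q + 1)
  | _ => Option Bool

/-- The register: two symbols of the auxiliary alphabet, a flag, and two bounded counters. -/
structure Reg (p q : ℕ) : Type where
  x : Option Bool
  y : Option Bool
  f : Bool
  i : Fin (p + 1)
  j : Fin (q + 1)

instance (p q : ℕ) : Finite (Reg p q) :=
  Finite.of_injective (β := Option Bool × Option Bool × Bool × Fin (p + 1) × Fin (q + 1))
    (fun v => (v.x, v.y, v.f, v.i, v.j)) (by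
      rintro ⟨_, _, _, _, _⟩ ⟨_, _, _, _, _⟩ h
      simpa using h)

/-- Programs which operate on binary trees. Only the input and the output stack depend on the
alphabets. -/
abbrev Prog (p q : ℕ) : Type := Cmd (Alpha p q) (Reg p q)

section BinaryTreePrograms

variable {p q : ℕ}

/-- The stack assignment with the given contents. -/
def stk (ip : List (Fin (p + 1))) (o : List (Fin (q + 1))) (m a b c : List (Option Bool)) :
    ∀ k, List (Alpha p q k)
  | .inp => ip
  | .out => o
  | .m => m
  | .a => a
  | .b => b
  | .c => c

section StackUpdates

variable (ip : List (Fin (p + 1))) (o : List (Fin (q + 1))) (m a b c m' : List (Option Bool))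

@[simp] theorem stk_inp : (stk ip o m a b c : ∀ k, List (Alpha p q k)) .inp = ip := rfl
@[simp] theorem stk_out : (stk ip o m a b c : ∀ k, List (Alpha p q k)) .out = o := rfl
@[simp] theorem stk_m : (stk ip o m a b c : ∀ k, List (Alpha p q k)) .m = m := rfl
@[simp] theorem stk_a : (stk ip o m a b c : ∀ k, List (Alpha p q k)) .a = a := rfl
@[simp] theorem stk_b : (stk ip o m a b c : ∀ k, List (Alpha p q k)) .b = b := rfl
@[simp] theorem stk_c : (stk ip o m a b c : ∀ k, List (Alpha p q k)) .c = c := rfl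

@[simp] theorem update_inp (ip' : List (Fin (p + 1))) :
    Function.update (stk ip o m a b c : ∀ k, List (Alpha p q k)) .inp ip' =
      stk ip' o m a b c := by
  funext k; cases k <;> simp

@[simp] theorem update_out (o' : List (Fin (q + 1))) :
    Function.update (stk ip o m a b c : ∀ k, List (Alpha p q k)) .out o' =
      stk ip o' m a b c := by
  funext k; cases k <;> simp

@[simp] theorem update_m :
    Function.update (stk ip o m a b c : ∀ k, List (Alpha p q k)) .m m' =
      stk ip o m' a b c := by
  funext k; cases k <;> simp

@[simp] theorem update_a :
    Function.update (stk ip o m a b c : ∀ k, List (Alpha p q k)) .a m' =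
      stk ip o m m' b c := by
  funext k; cases k <;> simp

@[simp] theorem update_b :
    Function.update (stk ip o m a b c : ∀ k, List (Alpha p q k)) .b m' =
      stk ip o m a m' c := by
  funext k; cases k <;> simp

@[simp] theorem update_c :
    Function.update (stk ip o m a b c : ∀ k, List (Alpha p q k)) .c m' =
      stk ip o m a b m' := by
  funext k; cases k <;> simp

end StackUpdates

namespace Prog

/-- Pop a symbol from `m` into the register `x`. -/
def popX : Prog p q := .pop .m fun v s => { v with x := s.getD none }

/-- Remove a tree from the main stack, and push the reverse of its prefix notation to the stacks `a`
(if `fa`) and `b` (if `fb`). The stack `c` counts the trees which remain to be read. -/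
def scanLoop (fa fb : Bool) : Prog p q :=
  .loop (fun v => v.y.isSome) <|
    .seq popX <|
    .seq (if fa then .push .a fun v => v.x else .load id) <|
    .seq (if fb then .push .b fun v => v.x else .load id) <|
    .seq (.ite (fun v => v.x == some true)
      (.seq (.push .c fun _ => some true) (.push .c fun _ => some true)) (.load id)) <|
    .pop .c fun v s => { v with y := s.getD none }

/-- One iteration reads a leaf, or an inner node, in which case its two subtrees are pushed to the
counter `c`. After the whole tree, one counted tree is popped from `c` into the register `y`. -/
theorem runs_scanLoop (fa fb : Bool) (x : D) {v : Reg p q} {ip o m a b c T Q} (hv : v.y.isSome)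
    (h : ∀ v' : Reg p q, v'.y = c.head?.getD none →
      Runs (scanLoop fa fb) (v', stk ip o m (if fa then x.ser.reverse ++ a else a)
        (if fb then x.ser.reverse ++ b else b) c.tail) T Q) :
    Runs (scanLoop fa fb) (v, stk ip o (x.ser ++ m) a b c) (T + 9 * x.size) Q := by
  induction x generalizing v m a b c T with
  | nil =>
    refine Runs.mono (T := T + 7) ?_ (by simp [D.size]) fun _ h => h
    refine Runs.loop_seq hv (Runs.seq_assoc (Runs.seq_pop (Runs.seq_assoc ?_)))
    cases fa <;> cases fb <;> simp [D.ser] at h ⊢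
    all_goals
      first | refine Runs.seq_load ?_ | refine Runs.seq_push ?_
      refine Runs.seq_assoc ?_
      first | refine Runs.seq_load ?_ | refine Runs.seq_push ?_
      refine Runs.seq_assoc (Runs.seq_ite_false rfl (Runs.seq_load (Runs.seq_pop ?_)))
      simp
      exact h _ rfl
  | cons x y hx hy =>
    refine Runs.mono (T := T + 9 * y.size + 9 * x.size + 8) ?_
      (by simp [D.size]; omega) fun _ h => h
    refine Runs.loop_seq hv (Runs.seq_assoc (Runs.seq_pop (Runs.seq_assoc ?_)))
    cases fa <;> cases fb <;> simp [D.ser] at h hx hy ⊢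
    all_goals
      first | refine Runs.seq_load ?_ | refine Runs.seq_push ?_
      refine Runs.seq_assoc ?_
      first | refine Runs.seq_load ?_ | refine Runs.seq_push ?_
      refine Runs.seq_assoc (Runs.seq_ite_true rfl
        (Runs.seq_assoc (Runs.seq_push (Runs.seq_push (Runs.seq_pop ?_)))))
      simp
      refine hx rfl fun v' hv' => ?_
      refine hy (by simpa using congrArg Option.isSome hv') fun v'' hv'' => ?_
      exact h _ hv''

/-- `scanLoop` for one tree. The separator pushed to the stack `c` stops the loop, so that `c` is
left as it was. -/
def scan (fa fb : Bool) : Prog p q :=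
  .seq (.push .c fun _ => none) <| .seq (.load fun v => { v with y := some true }) <|
    scanLoop fa fb

theorem runs_scan (fa fb : Bool) (x : D) {v : Reg p q} {ip o m a b c Q}
    (h : ∀ v' : Reg p q,
      Q (v', stk ip o m (if fa then x.ser.reverse ++ a else a)
        (if fb then x.ser.reverse ++ b else b) c)) :
    Runs (scan fa fb) (v, stk ip o (x.ser ++ m) a b c) (9 * x.size + 3) Q := by
  refine Runs.mono (T := (1 + 9 * x.size) + 1 + 1) ?_ (by omega) fun _ h => h
  refine Runs.seq_push (Runs.seq_load ?_)
  simp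
  refine runs_scanLoop fa fb x rfl fun v' hv' => ?_
  exact Runs.loop_false (by simp [hv']) (h v')

end Prog

/-! ### Programs which operate on the topmost tree -/

/-- `Impl c x y T`: the program `c` replaces the tree `x` on top of the main stack by the tree `y`
within `T` steps. Everything else except the register is left as it was. -/
def Impl (c : Prog p q) (x y : D) (T : ℕ) : Prop :=
  ∀ (v : Reg p q) (ip o m a b c' Q), (∀ v', Q (v', stk ip o (y.ser ++ m) a b c')) →
    Runs c (v, stk ip o (x.ser ++ m) a b c') T Q

theorem Impl.mono {c : Prog p q} {x y : D} {T T' : ℕ} (h : Impl c x y T) (hT : T ≤ T') :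
    Impl c x y T' := fun v ip o m a b c' Q hQ =>
  (h v ip o m a b c' Q hQ).mono hT fun _ h => h

theorem Impl.seq {c d : Prog p q} {x y z : D} {T T' : ℕ} (h : Impl c x y T) (h' : Impl d y z T') :
    Impl (.seq c d) x z (T + T') := fun v ip o m a b c' Q hQ =>
  Runs.seq (h v ip o m a b c' _ fun v' => h' v' ip o m a b c' Q hQ)

namespace Prog

/-- Move the symbols above the topmost separator of the stack `a` back to the main stack. -/
def restoreA : Prog p q :=
  .seq (.pop .a fun v s => { v with x := s.getD none }) <|
    .loop (fun v => v.x.isSome) <|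
      .seq (.push .m fun v => v.x) (.pop .a fun v s => { v with x := s.getD none })

/-- Move the symbols above the topmost separator of the stack `b` back to the main stack. -/
def restoreB : Prog p q :=
  .seq (.pop .b fun v s => { v with x := s.getD none }) <|
    .loop (fun v => v.x.isSome) <|
      .seq (.push .m fun v => v.x) (.pop .b fun v s => { v with x := s.getD none })

theorem runs_restoreA (l : List (Option Bool)) (hl : ∀ s ∈ l, s ≠ none) {v : Reg p q}
    {ip o m a b c Q} (h : ∀ v', Q (v', stk ip o (l.reverse ++ m) a b c)) :
    Runs restoreA (v, stk ip o m (l ++ none :: a) b c) (3 * l.length + 2) Q := by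
  refine Runs.seq_pop ?_
  induction l generalizing m v with
  | nil => exact Runs.loop_false (by simp) (by simpa using h _)
  | cons s l ih =>
    refine Runs.mono (T := (3 * l.length + 1) + 3) ?_ (by simp; omega) fun _ h => h
    obtain ⟨s, rfl⟩ := Option.ne_none_iff_exists'.1 (hl s (by simp))
    refine Runs.loop_seq rfl (Runs.seq_assoc (Runs.seq_push (Runs.seq_pop ?_)))
    have := @ih (fun s' hs' => hl s' (by simp [hs'])) { v with x := s } (some s :: m)
      (by simpa using h)
    simpa using this

theorem runs_restoreB (l : List (Option Bool)) (hl : ∀ s ∈ l, s ≠ none) {v : Reg p q}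
    {ip o m a b c Q} (h : ∀ v', Q (v', stk ip o (l.reverse ++ m) a b c)) :
    Runs restoreB (v, stk ip o m a (l ++ none :: b) c) (3 * l.length + 2) Q := by
  refine Runs.seq_pop ?_
  induction l generalizing m v with
  | nil => exact Runs.loop_false (by simp) (by simpa using h _)
  | cons s l ih =>
    refine Runs.mono (T := (3 * l.length + 1) + 3) ?_ (by simp; omega) fun _ h => h
    obtain ⟨s, rfl⟩ := Option.ne_none_iff_exists'.1 (hl s (by simp))
    refine Runs.loop_seq rfl (Runs.seq_assoc (Runs.seq_push (Runs.seq_pop ?_)))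
    have := @ih (fun s' hs' => hl s' (by simp [hs'])) { v with x := s } (some s :: m)
      (by simpa using h)
    simpa using this

/-- Move a tree from the main stack to the stack `a`. -/
def toA : Prog p q := .seq (.push .a fun _ => none) (scan true false)

/-- Move a tree from the main stack to the stack `b`. -/
def toB : Prog p q := .seq (.push .b fun _ => none) (scan false true)

theorem runs_toA (x : D) {v : Reg p q} {ip o m a b c Q}
    (h : ∀ v', Q (v', stk ip o m (x.ser.reverse ++ none :: a) b c)) :
    Runs toA (v, stk ip o (x.ser ++ m) a b c) (9 * x.size + 4) Q := by
  refine Runs.seq_push ?_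
  simp
  exact runs_scan _ _ x (by simpa using h)

theorem runs_toB (x : D) {v : Reg p q} {ip o m a b c Q}
    (h : ∀ v', Q (v', stk ip o m a (x.ser.reverse ++ none :: b) c)) :
    Runs toB (v, stk ip o (x.ser ++ m) a b c) (9 * x.size + 4) Q := by
  refine Runs.seq_push ?_
  simp
  exact runs_scan _ _ x (by simpa using h)

theorem runs_fromA (x : D) {v : Reg p q} {ip o m a b c Q}
    (h : ∀ v', Q (v', stk ip o (x.ser ++ m) a b c)) :
    Runs restoreA (v, stk ip o m (x.ser.reverse ++ none :: a) b c) (3 * x.size + 2) Q := by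
  refine (runs_restoreA x.ser.reverse (by simpa using x.ser_ne_none) (by simpa using h)).mono
    (by simp [D.length_ser]) fun _ h => h

theorem runs_fromB (x : D) {v : Reg p q} {ip o m a b c Q}
    (h : ∀ v', Q (v', stk ip o (x.ser ++ m) a b c)) :
    Runs restoreB (v, stk ip o m a (x.ser.reverse ++ none :: b) c) (3 * x.size + 2) Q := by
  refine (runs_restoreB x.ser.reverse (by simpa using x.ser_ne_none) (by simpa using h)).mono
    (by simp [D.length_ser]) fun _ h => h

/-- Join the two topmost trees, the first of which is the left subtree. -/
def pushCons : Prog p q := .push .m fun _ => some true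

/-- Push the tree `nil`. -/
def pushNil : Prog p q := .push .m fun _ => some false

/-- Replace `x` by `cons x x`. -/
def dup : Prog p q :=
  .seq (.push .a fun _ => none) <| .seq (.push .b fun _ => none) <| .seq (scan true true) <|
    .seq restoreA <| .seq restoreB pushCons

theorem impl_dup (x : D) : Impl (dup : Prog p q) x (.cons x x) (15 * x.size + 10) := by
  intro v ip o m a b c Q hQ
  refine Runs.mono (T := (9 * x.size + 3 + (3 * x.size + 2 + (3 * x.size + 2 + 1))) + 1 + 1) ?_
    (by omega) fun _ h => h
  refine Runs.seq_push (Runs.seq_push (Runs.seq ?_))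
  simp
  refine runs_scan true true x fun v => Runs.seq ?_
  simp
  refine runs_fromA x fun v => Runs.seq (runs_fromB x fun v => Runs.push ?_)
  simpa [D.ser] using hQ v

/-- Replace `cons x y` by `cons y x`. -/
def swap : Prog p q :=
  .seq popX <| .seq toA <| .seq toB <| .seq restoreA <| .seq restoreB pushCons

theorem impl_swap (x y : D) :
    Impl (swap : Prog p q) (.cons x y) (.cons y x) (12 * x.size + 12 * y.size + 14) := by
  intro v ip o m a b c Q hQ
  refine Runs.mono
    (T := (9 * x.size + 4 + (9 * y.size + 4 + (3 * x.size + 2 + (3 * y.size + 2 + 1)))) + 1) ?_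
    (by omega) fun _ h => h
  refine Runs.seq_pop ?_
  simp [D.ser]
  refine Runs.seq (runs_toA x fun v => Runs.seq (runs_toB y fun v => ?_))
  refine Runs.seq (runs_fromA x fun v => Runs.seq (runs_fromB y fun v => Runs.push ?_))
  simpa [D.ser] using hQ v

/-- Apply a program to the left subtree. -/
def onHd (c : Prog p q) : Prog p q := .seq popX <| .seq c pushCons

theorem impl_onHd {c : Prog p q} {x x' : D} {T : ℕ} (h : Impl c x x' T) (y : D) :
    Impl (onHd c) (.cons x y) (.cons x' y) (T + 2) := by
  intro v ip o m a b c Q hQ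
  refine Runs.seq_pop (Runs.seq ?_)
  simp [D.ser]
  refine h _ _ _ _ _ _ _ _ fun v => Runs.push ?_
  simpa [D.ser] using hQ v

/-- Replace `x` by `cons y z`, where `c` computes `y` and `d` computes `z` from `x`. -/
def pair (c d : Prog p q) : Prog p q := .seq dup <| .seq (onHd d) <| .seq swap (onHd c)

theorem impl_pair {c d : Prog p q} {x y z : D} {T T' : ℕ} (h : Impl c x y T) (h' : Impl d x z T') :
    Impl (pair c d) x (.cons y z) (T + T' + 27 * x.size + 12 * z.size + 28) :=
  ((impl_dup x).seq ((impl_onHd h' x).seq ((impl_swap z x).seq (impl_onHd h z)))).mono (by omega)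

/-- Replace a tree by `nil`. -/
def toNil : Prog p q := .seq (scan false false) pushNil

theorem impl_toNil (x : D) : Impl (toNil : Prog p q) x .nil (9 * x.size + 4) := by
  intro v ip o m a b c Q hQ
  refine Runs.mono (T := 9 * x.size + 3 + 1) ?_ (by omega) fun _ h => h
  refine Runs.seq (runs_scan false false x fun v => Runs.push ?_)
  simpa [D.ser] using hQ v

/-- Replace `cons x y` by `x`. -/
def fst : Prog p q := .seq popX <| .seq toA <| .seq (scan false false) restoreA

theorem impl_fst (x y : D) :
    Impl (fst : Prog p q) (.cons x y) x (12 * x.size + 9 * y.size + 10) := by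
  intro v ip o m a b c Q hQ
  refine Runs.mono (T := (9 * x.size + 4 + (9 * y.size + 3 + (3 * x.size + 2))) + 1) ?_
    (by omega) fun _ h => h
  refine Runs.seq_pop ?_
  simp [D.ser]
  refine Runs.seq (runs_toA x fun v => Runs.seq (runs_scan false false y fun v => ?_))
  exact runs_fromA x hQ

/-- Replace `cons x y` by `y`. -/
def snd : Prog p q := .seq popX (scan false false)

theorem impl_snd (x y : D) :
    Impl (snd : Prog p q) (.cons x y) y (9 * x.size + 4) := by
  intro v ip o m a b c Q hQ
  refine Runs.mono (T := 9 * x.size + 3 + 1) ?_ (by omega) fun _ h => h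
  refine Runs.seq_pop ?_
  simp [D.ser]
  exact runs_scan false false x hQ

/-- Test whether the tree on the main stack has the form `cons (cons _ _) _`. -/
def test : Prog p q :=
  .seq popX <| .ite (fun v => v.x == some true)
    (.seq (.pop .m fun v s => { v with y := s.getD none }) <|
      .seq (.push .m fun v => v.y) <| .seq pushCons <|
        .load fun v => { v with f := v.y == some true })
    (.seq pushNil (.load fun v => { v with f := false }))

/-- Whether a tree has the form `cons (cons _ _) _`. -/
def _root_.QuerySynth.D.test : D → Bool
  | .cons (.cons _ _) _ => true
  | _ => false

theorem runs_test (x : D) {v : Reg p q} {ip o m a b c Q}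
    (h : ∀ v', v'.f = x.test → Q (v', stk ip o (x.ser ++ m) a b c)) :
    Runs test (v, stk ip o (x.ser ++ m) a b c) 8 Q := by
  refine Runs.mono (T := (4 + 2 + 1) + 1) ?_ (by omega) fun _ h => h
  refine Runs.seq_pop (Runs.ite (fun hp => ?_) fun hp => ?_)
  · cases x with
    | nil => simp [D.ser] at hp
    | cons x y =>
      refine Runs.seq_pop (Runs.seq_push (Runs.seq_push (Runs.load ?_)))
      cases x <;> simp [D.ser, D.test] at h ⊢ <;> exact h _ rfl
  · cases x with
    | nil =>
      refine Runs.seq_push (Runs.load ?_)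
      simp [D.ser, D.test] at h ⊢
      exact h _ rfl
    | cons x y => simp [D.ser] at hp

/-- Run `c` if the tree has the form `cons (cons _ _) _`, and `d` otherwise. -/
def branch (c d : Prog p q) : Prog p q := .seq test (.ite (fun v => v.f) c d)

theorem impl_branch_true {c d : Prog p q} {x y : D} {T : ℕ} (hx : x.test = true)
    (h : Impl c x y T) : Impl (branch c d) x y (T + 9) := by
  intro v ip o m a b c Q hQ
  refine Runs.mono (T := 8 + (T + 0 + 1)) ?_ (by omega) fun _ h => h
  refine Runs.seq (runs_test x fun v hv => Runs.ite (T := T) (T' := 0)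
    (fun _ => h _ _ _ _ _ _ _ _ hQ) fun hp => ?_)
  rw [hx] at hv
  simp [hv] at hp

theorem impl_branch_false {c d : Prog p q} {x y : D} {T : ℕ} (hx : x.test = false)
    (h : Impl d x y T) : Impl (branch c d) x y (T + 9) := by
  intro v ip o m a b c Q hQ
  refine Runs.mono (T := 8 + (0 + T + 1)) ?_ (by omega) fun _ h => h
  refine Runs.seq (runs_test x fun v hv => Runs.ite (T := 0) (T' := T)
    (fun hp => ?_) fun _ => h _ _ _ _ _ _ _ _ hQ)
  rw [hx] at hv
  simp [hv] at hp

/-- Run `c` as long as the tree has the form `cons (cons _ _) _`. -/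
def whileTest (c : Prog p q) : Prog p q := .seq test (.loop (fun v => v.f) (.seq c test))

/-- A loop whose body transforms `z 0` into `z 1`, `z 1` into `z 2` and so on. -/
theorem impl_whileTest {c : Prog p q} (n : ℕ) (z : ℕ → D) {T : ℕ}
    (ht : ∀ i < n, (z i).test = true) (hn : (z n).test = false)
    (h : ∀ i < n, Impl c (z i) (z (i + 1)) T) :
    Impl (whileTest c) (z 0) (z n) (n * (T + 9) + 9) := by
  intro v ip o m a b c' Q hQ
  refine Runs.mono (T := 8 + (n * (T + 9) + 1)) ?_ (by omega) fun _ h => h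
  refine Runs.seq (runs_test _ fun v hv => ?_)
  induction n generalizing z v with
  | zero =>
    refine (Runs.loop_false (by rw [hn] at hv; exact hv) (hQ v)).mono (by omega) fun _ h => h
  | succ n ih =>
    refine Runs.mono (T := (T + 8) + (n * (T + 9) + 1) + 1) ?_ (by ring_nf; omega) fun _ h => h
    refine Runs.loop_true (by rw [ht 0 (by omega)] at hv; exact hv) (Runs.seq ?_)
    refine h 0 (by omega) _ _ _ _ _ _ _ _ fun v => runs_test _ fun v hv => ?_
    exact ih (fun i => z (i + 1)) (fun i hi => ht _ (by omega)) hn (fun i hi => h _ (by omega))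
      hQ v hv

/-- Pop a symbol from `a` into the register `x`. -/
def popAX : Prog p q := .pop .a fun v s => { v with x := s.getD none }

/-- Pop a symbol from `b` into the register `y`. -/
def popBY : Prog p q := .pop .b fun v s => { v with y := s.getD none }

/-- Compare the symbols above the topmost separators of the stacks `a` and `b` one by one. -/
def cmpLoop : Prog p q :=
  .loop (fun v => v.x.isSome && v.y.isSome)
    (.seq (.load fun v => { v with f := v.f && v.x == v.y }) (.seq popAX popBY))

/-- The topmost symbols of the lists `l` and `l'` are in the registers at the start. At the end,
`l₁` and `l₁'` remain uncompared, their topmost symbols are in the registers, and the flag together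
with these symbols tells whether `l = l'`. -/
theorem runs_cmpLoop (l l' : List (Option Bool)) (hl : ∀ s ∈ l, s ≠ none) (hl' : ∀ s ∈ l', s ≠ none)
    {v : Reg p q} {ip o m a b c Q} (hx : v.x = (l ++ none :: a).head?.getD none)
    (hy : v.y = (l' ++ none :: b).head?.getD none)
    (h : ∀ (v' : Reg p q) (l₁ l₁' : List (Option Bool)), (∀ s ∈ l₁, s ≠ none) →
      (∀ s ∈ l₁', s ≠ none) → l₁.length ≤ l.length → l₁'.length ≤ l'.length →
      v'.x = (l₁ ++ none :: a).head?.getD none → v'.y = (l₁' ++ none :: b).head?.getD none →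
      (v'.f && v'.x == v'.y) = (v.f && decide (l = l')) →
      Q (v', stk ip o m (l₁ ++ none :: a).tail (l₁' ++ none :: b).tail c)) :
    Runs cmpLoop (v, stk ip o m (l ++ none :: a).tail (l' ++ none :: b).tail c)
      (4 * l.length + 1) Q := by
  induction l generalizing l' v with
  | nil =>
    refine Runs.loop_false (by simp at hx; simp [hx])
      (h v [] l' (by simp) hl' (by simp) le_rfl hx hy ?_)
    cases l' with
    | nil => simp at hx hy; simp [hx, hy]
    | cons s l' =>
      simp at hx hy hl'
      obtain ⟨s, rfl⟩ := Option.ne_none_iff_exists'.1 hl'.1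
      simp [hx, hy]
  | cons s l ih =>
    obtain ⟨s, rfl⟩ := Option.ne_none_iff_exists'.1 (hl s (by simp))
    cases l' with
    | nil =>
      refine (Runs.loop_false (by simp at hy; simp [hy])
        (h v (some s :: l) [] hl (by simp) le_rfl le_rfl hx hy ?_)).mono (by omega) fun _ h => h
      simp at hx hy
      simp [hx, hy]
    | cons s' l' =>
      obtain ⟨s', rfl⟩ := Option.ne_none_iff_exists'.1 (hl' s' (by simp))
      refine Runs.mono (T := (4 * l.length + 1) + 4) ?_ (by simp; omega) fun _ h => h
      simp at hx hy
      refine Runs.loop_seq (by simp [hx, hy]) (Runs.seq_assoc (Runs.seq_load (Runs.seq_assoc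
        (Runs.seq_pop (Runs.seq_pop ?_)))))
      simp
      refine ih l' (fun s hs => hl s (by simp [hs])) (fun s hs => hl' s (by simp [hs])) (by simp)
        (by simp) ?_
      intro v' l₁ l₁' h₁ h₂ h₃ h₄ h₅ h₆ h₇
      refine h v' l₁ l₁' h₁ h₂ (by simp; omega) (by simp; omega) h₅ h₆ ?_
      rw [h₇]
      simp [hx, hy, Bool.and_assoc, beq_eq_decide]

/-- Remove what `cmpLoop` has left above the topmost separator of the stack `a`. -/
theorem runs_drainA (l : List (Option Bool)) (hl : ∀ s ∈ l, s ≠ none)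
    {v : Reg p q} {ip o m a b c Q} (hx : v.x = (l ++ none :: a).head?.getD none)
    (h : ∀ v', v'.f = v.f → v'.y = v.y → Q (v', stk ip o m a b c)) :
    Runs (.loop (fun v => v.x.isSome) popAX) (v, stk ip o m (l ++ none :: a).tail b c)
      (2 * l.length + 1) Q := by
  induction l generalizing v with
  | nil => exact (Runs.loop_false (by simpa using hx) (h v rfl rfl)).mono (by omega) fun _ h => h
  | cons s l ih =>
    refine Runs.mono (T := (2 * l.length + 1) + 2) ?_ (by simp; omega) fun _ h => h
    obtain ⟨s, rfl⟩ := Option.ne_none_iff_exists'.1 (hl s (by simp))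
    refine Runs.loop_seq (by simp [hx]) (Runs.seq_pop ?_)
    simp
    exact ih (fun s hs => hl s (by simp [hs])) (by simp) h

/-- Remove what `cmpLoop` has left above the topmost separator of the stack `b`. -/
theorem runs_drainB (l : List (Option Bool)) (hl : ∀ s ∈ l, s ≠ none)
    {v : Reg p q} {ip o m a b c Q} (hy : v.y = (l ++ none :: b).head?.getD none)
    (h : ∀ v', v'.f = v.f → Q (v', stk ip o m a b c)) :
    Runs (.loop (fun v => v.y.isSome) popBY) (v, stk ip o m a (l ++ none :: b).tail c)
      (2 * l.length + 1) Q := by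
  induction l generalizing v with
  | nil => exact (Runs.loop_false (by simpa using hy) (h v rfl)).mono (by omega) fun _ h => h
  | cons s l ih =>
    refine Runs.mono (T := (2 * l.length + 1) + 2) ?_ (by simp; omega) fun _ h => h
    obtain ⟨s, rfl⟩ := Option.ne_none_iff_exists'.1 (hl s (by simp))
    refine Runs.loop_seq (by simp [hy]) (Runs.seq_pop ?_)
    simp
    exact ih (fun s hs => hl s (by simp [hs])) (by simp) h

/-- Replace `cons x y` by the truth value of `x = y`. -/
def eqTest : Prog p q :=
  .seq popX <| .seq toA <| .seq toB <| .seq (.load fun v => { v with f := true }) <|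
    .seq popAX <| .seq popBY <| .seq cmpLoop <|
    .seq (.load fun v => { v with f := v.f && v.x == v.y }) <|
    .seq (.loop (fun v => v.x.isSome) popAX) <| .seq (.loop (fun v => v.y.isSome) popBY) <|
    .ite (fun v => v.f) (.seq pushNil (.seq pushNil pushCons)) pushNil

/-- Truth values as binary trees. -/
def _root_.QuerySynth.D.ofBool : Bool → D
  | false => .nil
  | true => .cons .nil .nil

theorem impl_eqTest (x y : D) :
    Impl (eqTest : Prog p q) (.cons x y) (.ofBool (decide (x.ser = y.ser)))
      (15 * x.size + 11 * y.size + 21) := by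
  intro v ip o m a b c Q hQ
  refine Runs.mono (T := (9 * x.size + 4 + (9 * y.size + 4 +
    ((4 * x.size + 1 + ((2 * x.size + 1 + (2 * y.size + 1 + (3 + 1 + 1))) + 1)) + 1 + 1 + 1))) + 1)
    ?_ (by omega) fun _ h => h
  refine Runs.seq_pop ?_
  simp only [D.ser, List.cons_append, List.append_assoc, stk_m, List.head?_cons, List.tail_cons,
    update_m]
  refine Runs.seq (runs_toA x fun v => Runs.seq (runs_toB y fun v => ?_))
  refine Runs.seq_load (Runs.seq_pop (Runs.seq_pop (Runs.seq ?_)))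
  simp only [stk_a, stk_b, update_a, update_b]
  have ex : x.size = x.ser.reverse.length := by simp [D.length_ser]
  have ey : y.size = y.ser.reverse.length := by simp [D.length_ser]
  rw [ex, ey]
  have hx := x.ser_ne_none
  have hy := y.ser_ne_none
  refine runs_cmpLoop x.ser.reverse y.ser.reverse (by simpa using hx) (by simpa using hy) rfl rfl ?_
  intro v' l l' h₁ h₂ h₃ h₄ h₅ h₆ h₇
  refine Runs.seq_load (Runs.seq ?_)
  refine (runs_drainA (Q := fun s' => Runs _ s' _ Q) l h₁ (by simpa using h₅)
    fun v'' hf hy' => ?_).mono (by omega) fun _ h => h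
  refine Runs.seq ?_
  refine (runs_drainB (Q := fun s' => Runs _ s' _ Q) l' h₂ (by rw [hy']; simpa using h₆)
    fun w hf' => ?_).mono (by omega) fun _ h => h
  have hv : w.f = decide (x.ser = y.ser) := by
    rw [hf', hf]
    simpa using h₇
  refine Runs.ite (fun h => ?_) fun h => ?_
  · refine Runs.seq_push (Runs.seq_push (Runs.push ?_))
    simp only [hv] at h
    simpa [h, D.ofBool, D.ser] using hQ w
  · refine Runs.push ?_
    simp only [hv] at h
    simpa [h, D.ofBool, D.ser] using hQ w

end Prog

end BinaryTreePrograms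

/-! ### Polynomial bounds -/

/-- `PB g`: the function `g` is bounded by a polynomial. -/
def PB (g : ℕ → ℕ) : Prop := ∃ k, ∀ n, g n ≤ (n + 2) ^ k

theorem two_pow_le_add_two_pow (n k : ℕ) : 2 ^ k ≤ (n + 2) ^ k := Nat.pow_le_pow_left (by omega) k

theorem PB.mono {g h : ℕ → ℕ} (hg : PB g) (hle : ∀ n, h n ≤ g n) : PB h := by
  obtain ⟨k, hk⟩ := hg
  exact ⟨k, fun n => (hle n).trans (hk n)⟩

theorem PB.const (c : ℕ) : PB fun _ => c :=
  ⟨c, fun n => Nat.lt_two_pow_self.le.trans (two_pow_le_add_two_pow n c)⟩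

theorem PB.id : PB fun n => n := ⟨1, fun n => by simp⟩

theorem PB.mul {g h : ℕ → ℕ} (hg : PB g) (hh : PB h) : PB fun n => g n * h n := by
  obtain ⟨k, hk⟩ := hg
  obtain ⟨l, hl⟩ := hh
  exact ⟨k + l, fun n => by rw [pow_add]; exact Nat.mul_le_mul (hk n) (hl n)⟩

theorem PB.add {g h : ℕ → ℕ} (hg : PB g) (hh : PB h) : PB fun n => g n + h n := by
  obtain ⟨k, hk⟩ := hg
  obtain ⟨l, hl⟩ := hh
  refine ⟨k + l + 1, fun n => ?_⟩
  have h1 : g n ≤ (n + 2) ^ (k + l) := (hk n).trans (Nat.pow_le_pow_right (by omega) (by omega))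
  have h2 : h n ≤ (n + 2) ^ (k + l) := (hl n).trans (Nat.pow_le_pow_right (by omega) (by omega))
  rw [pow_succ]
  nlinarith [Nat.zero_le (n * (n + 2) ^ (k + l))]

theorem PB.pow {g : ℕ → ℕ} (hg : PB g) (k : ℕ) : PB fun n => g n ^ k := by
  obtain ⟨l, hl⟩ := hg
  exact ⟨l * k, fun n => by rw [pow_mul]; exact Nat.pow_le_pow_left (hl n) k⟩

theorem PB.comp {g h : ℕ → ℕ} (hg : PB g) (hh : PB h) : PB fun n => g (h n) := by
  obtain ⟨k, hk⟩ := hg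
  exact ((hh.add (PB.const 2)).pow k).mono fun n => hk (h n)

theorem PB.add_two_pow (k : ℕ) : PB fun n => (n + 2) ^ k := (PB.id.add (PB.const 2)).pow k

/-! ### Encodings by binary trees, and polynomial-time functions -/

/-- An injective encoding of the elements of `α` by binary trees. -/
class Enc (α : Type) where
  enc : α → D
  inj : Function.Injective enc

open Enc (enc)

/-- The size of the encoding of `x`. -/
def sz {α : Type} [Enc α] (x : α) : ℕ := (enc x).size

theorem sz_pos {α : Type} [Enc α] (x : α) : 0 < sz x := D.size_pos _

instance : Enc D := ⟨id, fun _ _ h => h⟩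

instance : Enc Unit := ⟨fun _ => .nil, fun _ _ _ => rfl⟩

instance : Enc Bool := ⟨D.ofBool, by rintro (_ | _) (_ | _) h <;> simp [D.ofBool] at h ⊢⟩

instance {α β : Type} [Enc α] [Enc β] : Enc (α × β) where
  enc x := .cons (enc x.1) (enc x.2)
  inj := by
    rintro ⟨a, b⟩ ⟨a', b'⟩ h
    simp only [D.cons.injEq] at h
    rw [Enc.inj h.1, Enc.inj h.2]

/-- Lists of trees as trees. -/
def D.ofList : List D → D
  | [] => .nil
  | x :: l => .cons x (ofList l)

theorem D.ofList_injective : Function.Injective D.ofList := by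
  intro l
  induction l with
  | nil => rintro (_ | ⟨x, l⟩) h <;> simp [ofList] at h ⊢
  | cons x l ih =>
    rintro (_ | ⟨x', l'⟩) h
    · simp [ofList] at h
    · simp only [ofList, D.cons.injEq] at h
      rw [h.1, ih h.2]

instance {α : Type} [Enc α] : Enc (List α) where
  enc l := D.ofList (l.map enc)
  inj _ _ h := List.map_injective_iff.2 Enc.inj (D.ofList_injective h)

instance {α : Type} [Enc α] : Enc (Option α) where
  enc o := enc o.toList
  inj := by
    rintro (_ | a) (_ | b) h <;> simp at h ⊢ <;> simpa using Enc.inj h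

/-- Numbers are encoded in unary. -/
instance : Enc ℕ where
  enc n := enc (List.replicate n ())
  inj m n h := by simpa using congrArg List.length (Enc.inj h)

/-- The elements of a finite type are encoded by numbers. -/
@[reducible]
noncomputable def Enc.ofFinite (α : Type) [Finite α] : Enc α where
  enc x := enc ((Finite.equivFin α x : Fin (Nat.card α)) : ℕ)
  inj x y h := by simpa [Fin.val_inj] using Enc.inj h

section Sizes

variable {α β : Type} [Enc α] [Enc β]

@[simp] theorem enc_pair (x : α) (y : β) : enc (x, y) = .cons (enc x) (enc y) := rfl
@[simp] theorem enc_nil : enc ([] : List α) = .nil := rfl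
@[simp] theorem enc_cons (x : α) (l : List α) : enc (x :: l) = .cons (enc x) (enc l) := rfl
@[simp] theorem enc_none : enc (none : Option α) = .nil := rfl
@[simp] theorem enc_some (x : α) : enc (some x) = .cons (enc x) .nil := rfl
@[simp] theorem enc_zero : enc 0 = .nil := rfl
@[simp] theorem enc_succ (n : ℕ) : enc (n + 1) = .cons .nil (enc n) := by
  change enc (List.replicate (n + 1) ()) = _
  rw [List.replicate_succ]
  rfl
@[simp] theorem enc_true : enc true = .cons .nil .nil := rfl
@[simp] theorem enc_false : enc false = .nil := rfl

@[simp] theorem sz_pair (x : α) (y : β) : sz (x, y) = sz x + sz y + 1 := rfl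
@[simp] theorem sz_nil : sz ([] : List α) = 1 := rfl
@[simp] theorem sz_cons (x : α) (l : List α) : sz (x :: l) = sz x + sz l + 1 := rfl
@[simp] theorem sz_none : sz (none : Option α) = 1 := rfl
@[simp] theorem sz_some (x : α) : sz (some x) = sz x + 2 := rfl
@[simp] theorem sz_nat (n : ℕ) : sz n = 2 * n + 1 := by
  induction n with
  | zero => rfl
  | succ n ih =>
    unfold sz at ih ⊢
    rw [enc_succ, D.size, ih, D.size]
    ring
theorem sz_bool_le (b : Bool) : sz b ≤ 3 := by cases b <;> simp [sz, D.size]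

theorem sz_fst_le (x : α × β) : sz x.1 ≤ sz x := by
  obtain ⟨a, b⟩ := x; simp; omega

theorem sz_snd_le (x : α × β) : sz x.2 ≤ sz x := by
  obtain ⟨a, b⟩ := x; simp; omega

theorem sz_le_of_mem {x : α} {l : List α} (h : x ∈ l) : sz x ≤ sz l := by
  induction l with
  | nil => simp at h
  | cons y l ih =>
    rcases List.mem_cons.1 h with rfl | h
    · simp; omega
    · have := ih h; simp; omega

theorem length_le_sz (l : List α) : l.length ≤ sz l := by
  induction l with
  | nil => simp
  | cons y l ih => simp; omega

theorem sz_append (l l' : List α) : sz (l ++ l') + 1 = sz l + sz l' := by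
  induction l with
  | nil => simp; omega
  | cons y l ih => simp; omega

theorem sz_reverse (l : List α) : sz l.reverse = sz l := by
  induction l with
  | nil => rfl
  | cons y l ih => have := sz_append l.reverse [y]; simp at this ⊢; omega

theorem sz_suffix_le {l l' : List α} (h : l' <:+ l) : sz l' ≤ sz l := by
  obtain ⟨u, rfl⟩ := h
  have := sz_append u l'
  have := sz_pos u
  omega

theorem sz_le_length_mul (l : List α) (B : ℕ) (h : ∀ x ∈ l, sz x ≤ B) :
    sz l ≤ l.length * (B + 1) + 1 := by
  induction l with
  | nil => simp
  | cons y l ih =>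
    have h1 := ih fun x hx => h x (by simp [hx])
    have h2 := h y (by simp)
    simp
    nlinarith

end Sizes

/-- `PT f`: the function `f` is computed in polynomial time, by a program on a machine with any
input and output alphabets. The values of `f` are required to have polynomial size as well. The
closure properties are tagged with `fun_prop`, which then proves `PT f` from the form of `f`. -/
@[fun_prop]
def PT {α β : Type} [Enc α] [Enc β] (f : α → β) : Prop :=
  ∃ k, ∀ p q, ∃ c : Prog p q, ∀ x,
    Impl c (enc x) (enc (f x)) ((sz x + 2) ^ k) ∧ sz (f x) ≤ (sz x + 2) ^ k

namespace PT

variable {α β γ δ : Type} [Enc α] [Enc β] [Enc γ] [Enc δ]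

/-- The time bound may be any polynomially bounded function. -/
theorem of_bound {f : α → β} {g : ℕ → ℕ} (hg : PB g)
    (h : ∀ p q, ∃ c : Prog p q, ∀ x,
      Impl c (enc x) (enc (f x)) (g (sz x)) ∧ sz (f x) ≤ g (sz x)) : PT f := by
  obtain ⟨k, hk⟩ := hg
  refine ⟨k, fun p q => ?_⟩
  obtain ⟨c, hc⟩ := h p q
  exact ⟨c, fun x => ⟨(hc x).1.mono (hk _), (hc x).2.trans (hk _)⟩⟩

/-- Being computable in polynomial time depends on the encodings of the values only. -/
theorem congr_enc {f : α → β} {g : α → γ} (hf : PT f) (h : ∀ x, enc (g x) = enc (f x)) : PT g := by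
  obtain ⟨k, hk⟩ := hf
  refine ⟨k, fun p q => ?_⟩
  obtain ⟨c, hc⟩ := hk p q
  refine ⟨c, fun x => ?_⟩
  have := hc x
  rw [h x]
  unfold sz at this ⊢
  rw [h x]
  exact this

theorem size_le {f : α → β} (hf : PT f) : ∃ k, ∀ x, sz (f x) ≤ (sz x + 2) ^ k := by
  obtain ⟨k, hk⟩ := hf
  obtain ⟨c, hc⟩ := hk 0 0
  exact ⟨k, fun x => (hc x).2⟩

/-- A map which preserves encodings costs nothing. -/
theorem cast {f : α → β} (h : ∀ x, enc (f x) = enc x) : PT f := by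
  refine of_bound (g := fun n => n + 1) (PB.id.add (PB.const 1)) fun p q => ?_
  refine ⟨.load id, fun x => ⟨?_, by simp [sz, h]⟩⟩
  rw [h]
  intro v ip o m a b c Q hQ
  exact (Runs.load (hQ _)).mono (by omega) fun _ h => h

@[fun_prop]
theorem id : PT (fun x : α => x) := cast fun _ => rfl

@[fun_prop]
theorem comp {g : β → γ} {f : α → β} (hg : PT g) (hf : PT f) : PT fun x => g (f x) := by
  obtain ⟨k, hk⟩ := hf
  obtain ⟨l, hl⟩ := hg
  refine of_bound (g := fun n => (n + 2) ^ k + ((n + 2) ^ k + 2) ^ l)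
    ((PB.add_two_pow k).add ((PB.add_two_pow l).comp (PB.add_two_pow k))) fun p q => ?_
  obtain ⟨c, hc⟩ := hk p q
  obtain ⟨d, hd⟩ := hl p q
  refine ⟨.seq c d, fun x => ?_⟩
  have h1 := hc x
  have h2 := hd (f x)
  have h3 : (sz (f x) + 2) ^ l ≤ ((sz x + 2) ^ k + 2) ^ l := Nat.pow_le_pow_left (by omega) l
  exact ⟨(h1.1.seq h2.1).mono (by omega), by omega⟩

@[fun_prop]
theorem pair {f : α → β} {g : α → γ} (hf : PT f) (hg : PT g) : PT fun x => (f x, g x) := by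
  obtain ⟨k, hk⟩ := hf
  obtain ⟨l, hl⟩ := hg
  refine of_bound (g := fun n => (n + 2) ^ k + (n + 2) ^ l + 27 * n + 12 * (n + 2) ^ l + 28)
    (((((PB.add_two_pow k).add (PB.add_two_pow l)).add ((PB.const 27).mul PB.id)).add
      ((PB.const 12).mul (PB.add_two_pow l))).add (PB.const 28)) fun p q => ?_
  obtain ⟨c, hc⟩ := hk p q
  obtain ⟨d, hd⟩ := hl p q
  refine ⟨Prog.pair c d, fun x => ?_⟩
  have h1 := hc x
  have h2 := hd x
  refine ⟨(Prog.impl_pair h1.1 h2.1).mono ?_, by simp; omega⟩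
  have : (enc (g x)).size ≤ (sz x + 2) ^ l := h2.2
  have : (enc x).size = sz x := rfl
  omega

theorem fst' : PT (fun x : α × β => x.1) := by
  refine of_bound (g := fun n => 12 * n + 10) (((PB.const 12).mul PB.id).add (PB.const 10))
    fun p q => ⟨Prog.fst, fun x => ⟨(Prog.impl_fst _ _).mono ?_, ?_⟩⟩
  · obtain ⟨a, b⟩ := x
    simp [sz, D.size]
    omega
  · have := sz_fst_le x
    omega

theorem snd' : PT (fun x : α × β => x.2) := by
  refine of_bound (g := fun n => 9 * n + 4) (((PB.const 9).mul PB.id).add (PB.const 4))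
    fun p q => ⟨Prog.snd, fun x => ⟨(Prog.impl_snd _ _).mono ?_, ?_⟩⟩
  · obtain ⟨a, b⟩ := x
    simp [sz, D.size]
    omega
  · have := sz_snd_le x
    omega

@[fun_prop]
theorem fst {f : α → β × γ} (hf : PT f) : PT fun x => (f x).1 := comp fst' hf

@[fun_prop]
theorem snd {f : α → β × γ} (hf : PT f) : PT fun x => (f x).2 := comp snd' hf

theorem toNil : PT (fun _ : α => D.nil) := by
  refine of_bound (g := fun n => 9 * n + 4) (((PB.const 9).mul PB.id).add (PB.const 4))
    fun p q => ⟨Prog.toNil, fun x => ⟨Prog.impl_toNil _, ?_⟩⟩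
  simp [sz, enc, D.size]

@[fun_prop]
theorem const (y : β) : PT (fun _ : α => y) := by
  suffices h : ∀ d : D, PT (fun _ : α => d) from (h (enc y)).congr_enc fun _ => rfl
  intro d
  induction d with
  | nil => exact toNil
  | cons d d' h h' => exact (h.pair h').congr_enc fun _ => rfl

/-- Branching on whether the first component of the encoding is nonempty. -/
theorem branch {f : α → β} {P : α → Bool} (hP : ∀ x, (enc x).test = P x)
    {f₁ : γ → β} {f₂ : δ → β} (h₁ : PT f₁) (h₂ : PT f₂)
    (hf₁ : ∀ x, P x = true → ∃ y, enc y = enc x ∧ f x = f₁ y)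
    (hf₂ : ∀ x, P x = false → ∃ y, enc y = enc x ∧ f x = f₂ y) : PT f := by
  obtain ⟨k, hk⟩ := h₁
  obtain ⟨l, hl⟩ := h₂
  refine of_bound (g := fun n => (n + 2) ^ k + (n + 2) ^ l + 9)
    (((PB.add_two_pow k).add (PB.add_two_pow l)).add (PB.const 9)) fun p q => ?_
  obtain ⟨c, hc⟩ := hk p q
  obtain ⟨d, hd⟩ := hl p q
  refine ⟨Prog.branch c d, fun x => ?_⟩
  cases hx : P x with
  | true =>
    obtain ⟨y, hy, e⟩ := hf₁ x hx
    have := hc y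
    unfold sz at this ⊢
    rw [hy] at this
    rw [e]
    exact ⟨(Prog.impl_branch_true (by rw [hP, hx]) this.1).mono (by omega), by omega⟩
  | false =>
    obtain ⟨y, hy, e⟩ := hf₂ x hx
    have := hd y
    unfold sz at this ⊢
    rw [hy] at this
    rw [e]
    exact ⟨(Prog.impl_branch_false (by rw [hP, hx]) this.1).mono (by omega), by omega⟩

@[fun_prop]
theorem cond {c : α → Bool} {f g : α → β} (hc : PT c) (hf : PT f) (hg : PT g) :
    PT fun x => bif c x then f x else g x := by
  have : PT fun z : Bool × α => bif z.1 then f z.2 else g z.2 := by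
    refine branch (P := fun z => z.1) (fun z => ?_) (hf.comp (snd' (α := Bool)))
      (hg.comp (snd' (α := Bool))) (fun z hz => ⟨z, rfl, ?_⟩) (fun z hz => ⟨z, rfl, ?_⟩)
    · obtain ⟨b, x⟩ := z
      cases b <;> rfl
    all_goals simp [hz]
  exact this.comp (hc.pair .id)

@[fun_prop]
theorem ite {c : α → Bool} {f g : α → β} (hc : PT c) (hf : PT f) (hg : PT g) :
    PT fun x => if c x = true then f x else g x :=
  (hc.cond hf hg).congr_enc fun x => by cases c x <;> rfl

@[fun_prop]
theorem and {f g : α → Bool} (hf : PT f) (hg : PT g) : PT fun x => f x && g x :=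
  (hf.cond hg (const false)).congr_enc fun x => by cases f x <;> rfl

@[fun_prop]
theorem or {f g : α → Bool} (hf : PT f) (hg : PT g) : PT fun x => f x || g x :=
  (hf.cond (const true) hg).congr_enc fun x => by cases f x <;> rfl

@[fun_prop]
theorem not {f : α → Bool} (hf : PT f) : PT fun x => !f x :=
  (hf.cond (const false) (const true)).congr_enc fun x => by cases f x <;> rfl

@[fun_prop]
theorem decide_eq [DecidableEq β] {f g : α → β} (hf : PT f) (hg : PT g) :
    PT fun x => decide (f x = g x) := by
  have : PT fun z : β × β => decide (z.1 = z.2) := by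
    refine of_bound (g := fun n => 15 * n + 21) (((PB.const 15).mul PB.id).add (PB.const 21))
      fun p q => ⟨Prog.eqTest, fun x => ⟨?_, ?_⟩⟩
    · have h : decide (x.1 = x.2) = decide ((enc x.1).ser = (enc x.2).ser) :=
        decide_eq_decide.2 (D.ser_injective.eq_iff.trans Enc.inj.eq_iff).symm
      rw [h]
      refine (Prog.impl_eqTest (enc x.1) (enc x.2)).mono ?_
      obtain ⟨a, b⟩ := x
      simp [sz, D.size]
      omega
    · have := sz_bool_le (decide (x.1 = x.2))
      omega
  exact this.comp (hf.pair hg)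

@[fun_prop]
theorem list_cons {f : α → β} {g : α → List β} (hf : PT f) (hg : PT g) :
    PT fun x => f x :: g x := (hf.pair hg).congr_enc fun _ => rfl

@[fun_prop]
theorem option_some {f : α → β} (hf : PT f) : PT fun x => Option.some (f x) :=
  (hf.pair (const D.nil)).congr_enc fun _ => rfl

@[fun_prop]
theorem succ {f : α → ℕ} (hf : PT f) : PT fun x => f x + 1 :=
  ((const D.nil).pair hf).congr_enc fun x => by rw [enc_succ]; rfl

/-- Case distinction on a list. -/
theorem list_cases {l : α → List β} {f : α → γ} {g : α → β → List β → γ} (hl : PT l) (hf : PT f)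
    (hg : PT fun z : α × β × List β => g z.1 z.2.1 z.2.2) :
    PT fun x => (match l x with | [] => f x | b :: t => g x b t : γ) := by
  have : PT fun z : List β × α =>
      (match z.1 with | [] => f z.2 | b :: t => g z.2 b t : γ) := by
    refine branch (P := fun z => !z.1.isEmpty) (fun z => ?_)
      (f₁ := fun w : (β × List β) × α => g w.2 w.1.1 w.1.2)
      (hg.comp (f := fun w : (β × List β) × α => (w.2, w.1.1, w.1.2)) (by fun_prop))
      (hf.comp (snd' (α := List β))) (fun z hz => ?_) (fun z hz => ⟨z, rfl, ?_⟩)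
    · obtain ⟨l, x⟩ := z
      cases l <;> rfl
    · obtain ⟨l, x⟩ := z
      cases l with
      | nil => simp at hz
      | cons b t => exact ⟨((b, t), x), rfl, rfl⟩
    · obtain ⟨l, x⟩ := z
      cases l with
      | nil => rfl
      | cons b t => simp at hz
  exact this.comp (hl.pair .id)

end PT

/-! ### Polynomial-time functions on lists -/

namespace PT

variable {α β γ δ X : Type} [Enc α] [Enc β] [Enc γ] [Enc δ] [Enc X]

/-- Folding a polynomial-time function over a list takes polynomial time, provided that all
intermediate values have polynomial size. -/
theorem foldl {l : X → List α} {b : X → β} {f : X → β → α → β} (hl : PT l) (hb : PT b)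
    (hf : PT fun z : X × β × α => f z.1 z.2.1 z.2.2)
    (hs : ∃ k, ∀ x l', l' <+: l x → sz (l'.foldl (f x) (b x)) ≤ (sz x + 2) ^ k) :
    PT fun x => (l x).foldl (f x) (b x) := by
  -- The loop works on triples of the rest of the list, the argument `x` and the accumulator. It
  -- stops when the rest is empty, since `Prog.whileTest` tests whether there is a first entry.
  suffices h : PT fun x => (([] : List α), x, (l x).foldl (f x) (b x)) from
    (show PT fun w : List α × X × β => w.2.2 by fun_prop).comp h
  obtain ⟨ks, hs⟩ := hs
  obtain ⟨ki, hi⟩ := show PT fun x => (l x, x, b x) by fun_prop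
  obtain ⟨kb, hbody⟩ := show PT fun w : (α × List α) × X × β =>
      (w.1.2, w.2.1, f w.2.1 w.2.2 w.1.1) from by
    have : PT fun w : (α × List α) × X × β => f w.2.1 w.2.2 w.1.1 :=
      hf.comp (f := fun w : (α × List α) × X × β => (w.2.1, w.2.2, w.1.1)) (by fun_prop)
    fun_prop
  obtain ⟨kl, hlen⟩ := hl.size_le
  refine of_bound (g := fun n => (n + 2) ^ ki +
    ((n + 2) ^ kl * (((n + 2) ^ kl + (n + (n + 2) ^ ks + 1) + 1 + 2) ^ kb + 9) + 9) +
      (n + (n + 2) ^ ks + 3))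
    (((PB.add_two_pow ki).add (((PB.add_two_pow kl).mul (PB.add (PB.pow ((((PB.add_two_pow kl).add
      ((PB.id.add (PB.add_two_pow ks)).add (PB.const 1))).add (PB.const 1)).add (PB.const 2)) kb)
      (PB.const 9))).add (PB.const 9))).add ((PB.id.add (PB.add_two_pow ks)).add (PB.const 3)))
    fun p q => ?_
  obtain ⟨c, hc⟩ := hi p q
  obtain ⟨d, hd⟩ := hbody p q
  refine ⟨.seq c (Prog.whileTest d), fun x => ⟨?_, ?_⟩⟩
  · let z : ℕ → D := fun i => enc ((l x).drop i, x, ((l x).take i).foldl (f x) (b x))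
    have hw := Prog.impl_whileTest (c := d) (l x).length z
      (T := (((sz x + 2) ^ kl + (sz x + (sz x + 2) ^ ks + 1) + 1) + 2) ^ kb) (fun i hi => ?_) ?_
      (fun i hi => ?_)
    · have h0 : z 0 = enc (l x, x, b x) := by simp [z]
      have hn : z (l x).length = enc (([] : List α), x, (l x).foldl (f x) (b x)) := by simp [z]
      rw [h0, hn] at hw
      refine ((hc x).1.seq hw).mono ?_
      have := Nat.mul_le_mul_right
        ((((sz x + 2) ^ kl + (sz x + (sz x + 2) ^ ks + 1) + 1) + 2) ^ kb + 9)
        ((length_le_sz (l x)).trans (hlen x))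
      omega
    · simp only [z]
      rw [List.drop_eq_getElem_cons hi]
      rfl
    · simp only [z, List.drop_length]
      rfl
    · have h1 := (hd (((l x)[i], (l x).drop (i + 1)), x, ((l x).take i).foldl (f x) (b x))).1
      have h2 : z i = enc (((l x)[i], (l x).drop (i + 1)), x,
          ((l x).take i).foldl (f x) (b x)) := by
        simp only [z]
        rw [List.drop_eq_getElem_cons hi]
        rfl
      have h3 : z (i + 1) = enc ((l x).drop (i + 1), x,
          f x (((l x).take i).foldl (f x) (b x)) (l x)[i]) := by
        simp only [z]
        rw [List.take_add_one, List.foldl_append]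
        simp [hi]
      rw [h2, h3]
      refine h1.mono (Nat.pow_le_pow_left ?_ _)
      have h4 := hs x _ (List.take_prefix i (l x))
      have h5 := (sz_suffix_le (List.drop_suffix i (l x))).trans (hlen x)
      rw [List.drop_eq_getElem_cons hi, sz_cons] at h5
      simp only [sz_pair]
      omega
  · have := hs x _ (List.prefix_refl (l x))
    simp
    omega

theorem foldl_sz_le {l l' : List α} {b : β} {f : β → α → β} {C : ℕ} (h : l' <+: l)
    (hf : ∀ b, ∀ a ∈ l, sz (f b a) ≤ sz b + C) : sz (l'.foldl f b) ≤ sz b + sz l * C := by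
  suffices H : sz (l'.foldl f b) ≤ sz b + l'.length * C by
    have h1 : l'.length ≤ sz l := h.length_le.trans (length_le_sz l)
    have := Nat.mul_le_mul_right C h1
    omega
  have hf' : ∀ b, ∀ a ∈ l', sz (f b a) ≤ sz b + C := fun b a ha => hf b a (h.subset ha)
  clear hf h
  induction l' generalizing b with
  | nil => simp
  | cons a l' ih =>
    have h1 := @ih (f b a) fun b a ha => hf' b a (by simp [ha])
    have h2 := hf' b a (by simp)
    simp only [List.foldl_cons, List.length_cons]
    linarith

/-- A fold in which every step increases the size by a polynomial in the size of the input. -/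
theorem foldl_add {l : X → List α} {b : X → β} {f : X → β → α → β} {C : ℕ → ℕ} (hl : PT l)
    (hb : PT b) (hf : PT fun z : X × β × α => f z.1 z.2.1 z.2.2) (hC : PB C)
    (hs : ∀ x b, ∀ a ∈ l x, sz (f x b a) ≤ sz b + C (sz x)) :
    PT fun x => (l x).foldl (f x) (b x) := by
  refine hl.foldl hb hf ?_
  obtain ⟨kl, hlen⟩ := hl.size_le
  obtain ⟨kb, hb⟩ := hb.size_le
  obtain ⟨k, hk⟩ := ((PB.add_two_pow kb).add ((PB.add_two_pow kl).mul hC))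
  refine ⟨k, fun x l' h => ?_⟩
  have h1 := foldl_sz_le (b := b x) h (hs x)
  have h2 := Nat.mul_le_mul_right (C (sz x)) (hlen x)
  have h3 := hb x
  have h4 := hk (sz x)
  beta_reduce at h4
  omega

@[fun_prop]
theorem reverse {l : X → List α} (hl : PT l) : PT fun x => (l x).reverse := by
  have : PT fun l : List α => l.foldl (fun acc a => a :: acc) [] :=
    foldl_add .id (by fun_prop) (by fun_prop) (C := fun n => n + 1) (PB.id.add (PB.const 1))
      fun l b a ha => by have := sz_le_of_mem ha; simp; omega
  exact (this.comp hl).congr_enc fun x => by simp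

theorem foldl_cons_eq {ι : Type} (l l' : List ι) :
    l.foldl (fun acc a => a :: acc) l' = l.reverse ++ l' := by
  induction l generalizing l' with
  | nil => rfl
  | cons a l ih => simp [ih]

theorem reverse_append : PT fun z : List α × List α => z.1.reverse ++ z.2 := by
  have : PT fun z : List α × List α => z.1.foldl (fun acc a => a :: acc) z.2 :=
    foldl_add (by fun_prop) (by fun_prop) (by fun_prop) (C := fun n => n + 1)
      (PB.id.add (PB.const 1)) fun z b a ha => by
        have h1 := sz_le_of_mem ha
        have h2 := sz_fst_le z
        simp
        omega
  simpa only [foldl_cons_eq] using this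

@[fun_prop]
theorem append {l l' : X → List α} (hl : PT l) (hl' : PT l') : PT fun x => l x ++ l' x := by
  have := (reverse_append (α := α)).comp (hl.reverse.pair hl')
  simpa using this

@[fun_prop]
theorem flatMap {l : X → List α} {f : X → α → List β} (hl : PT l)
    (hf : PT fun z : X × α => f z.1 z.2) : PT fun x => (l x).flatMap (f x) := by
  obtain ⟨k, hk⟩ := hf.size_le
  obtain ⟨kl, hlen⟩ := hl.size_le
  have h1 : PT fun z : X × List β × α => (f z.1 z.2.2).reverse ++ z.2.1 := by
    have : PT fun z : X × List β × α => f z.1 z.2.2 :=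
      hf.comp (f := fun z : X × List β × α => (z.1, z.2.2)) (by fun_prop)
    fun_prop
  have h2 : PT fun x => (l x).foldl (fun acc a => (f x a).reverse ++ acc) [] := by
    refine foldl_add hl (by fun_prop) h1 (C := fun n => (n + (n + 2) ^ kl + 1 + 2) ^ k)
      (PB.pow (((PB.id.add (PB.add_two_pow kl)).add (PB.const 1)).add (PB.const 2)) k)
      fun x b a ha => ?_
    have h1 := sz_append (f x a).reverse b
    have h2 : sz (f x a) ≤ (sz x + sz a + 1 + 2) ^ k := hk (x, a)
    have h3 := (sz_le_of_mem ha).trans (hlen x)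
    have h4 := Nat.pow_le_pow_left
      (show sz x + sz a + 1 + 2 ≤ sz x + (sz x + 2) ^ kl + 1 + 2 by omega) k
    rw [sz_reverse] at h1
    omega
  refine h2.reverse.congr_enc fun x => congrArg enc ?_
  have : ∀ (l : List α) (acc : List β),
      (l.foldl (fun acc a => (f x a).reverse ++ acc) acc).reverse =
        acc.reverse ++ l.flatMap (f x) := by
    intro l
    induction l with
    | nil => simp
    | cons a l ih => intro acc; rw [List.foldl_cons, ih]; simp
  simpa using (this (l x) []).symm

@[fun_prop]
theorem map {l : X → List α} {f : X → α → β} (hl : PT l)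
    (hf : PT fun z : X × α => f z.1 z.2) : PT fun x => (l x).map (f x) := by
  have : PT fun x => (l x).flatMap fun a => [f x a] := by fun_prop
  refine this.congr_enc fun x => congrArg enc ?_
  exact List.map_eq_flatMap

@[fun_prop]
theorem filter {l : X → List α} {f : X → α → Bool} (hl : PT l)
    (hf : PT fun z : X × α => f z.1 z.2) : PT fun x => (l x).filter (f x) := by
  have : PT fun x => (l x).flatMap fun a => if f x a = true then [a] else [] := by fun_prop
  refine this.congr_enc fun x => congrArg enc ?_
  induction l x with
  | nil => rfl
  | cons a l ih => cases h : f x a <;> simp [h, ih]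

@[fun_prop]
theorem isEmpty {l : X → List α} (hl : PT l) : PT fun x => (l x).isEmpty :=
  (hl.list_cases (const true) (g := fun _ _ _ => false) (by fun_prop)).congr_enc fun x => by
    cases l x <;> rfl

@[fun_prop]
theorem tail {l : X → List α} (hl : PT l) : PT fun x => (l x).tail :=
  (hl.list_cases (const []) (g := fun _ _ t => t) (by fun_prop)).congr_enc fun x => by
    cases l x <;> rfl

@[fun_prop]
theorem head? {l : X → List α} (hl : PT l) : PT fun x => (l x).head? :=
  (hl.list_cases (const none) (g := fun _ a _ => some a) (by fun_prop)).congr_enc fun x => by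
    cases l x <;> rfl

@[fun_prop]
theorem toList {o : X → Option α} (ho : PT o) : PT fun x => (o x).toList :=
  ho.congr_enc fun _ => rfl

@[fun_prop]
theorem option_elim {o : X → Option α} {f : X → β} {g : X → α → β} (ho : PT o) (hf : PT f)
    (hg : PT fun z : X × α => g z.1 z.2) : PT fun x => (o x).elim (f x) (g x) := by
  have h : PT fun z : X × α × List α => g z.1 z.2.1 :=
    hg.comp (f := fun z : X × α × List α => (z.1, z.2.1)) (by fun_prop)
  exact ((toList ho).list_cases hf (g := fun x a _ => g x a) h).congr_enc fun x => by
    cases o x <;> rfl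

@[fun_prop]
theorem option_map {o : X → Option α} {g : X → α → β} (ho : PT o)
    (hg : PT fun z : X × α => g z.1 z.2) : PT fun x => (o x).map (g x) :=
  (ho.option_elim (const none) (g := fun x a => some (g x a)) (by fun_prop)).congr_enc
    fun x => by cases o x <;> rfl

@[fun_prop]
theorem option_bind {o : X → Option α} {g : X → α → Option β} (ho : PT o)
    (hg : PT fun z : X × α => g z.1 z.2) : PT fun x => (o x).bind (g x) :=
  (ho.option_elim (const none) hg).congr_enc fun x => by cases o x <;> rfl

@[fun_prop]
theorem option_getD {o : X → Option α} {f : X → α} (ho : PT o) (hf : PT f) :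
    PT fun x => (o x).getD (f x) :=
  (ho.option_elim hf (g := fun _ a => a) (by fun_prop)).congr_enc
    fun x => by cases o x <;> rfl

@[fun_prop]
theorem isSome {o : X → Option α} (ho : PT o) : PT fun x => (o x).isSome :=
  (ho.option_elim (const false) (g := fun _ _ => true) (by fun_prop)).congr_enc
    fun x => by cases o x <;> rfl

@[fun_prop]
theorem any {l : X → List α} {f : X → α → Bool} (hl : PT l)
    (hf : PT fun z : X × α => f z.1 z.2) : PT fun x => (l x).any (f x) := by
  have : PT fun x => !((l x).filter (f x)).isEmpty := by fun_prop
  refine this.congr_enc fun x => congrArg enc ?_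
  rw [Bool.eq_iff_iff]
  simp [List.filter_eq_nil_iff]

@[fun_prop]
theorem all {l : X → List α} {f : X → α → Bool} (hl : PT l)
    (hf : PT fun z : X × α => f z.1 z.2) : PT fun x => (l x).all (f x) := by
  have : PT fun x => !(l x).any fun a => !f x a := by fun_prop
  refine this.congr_enc fun x => congrArg enc ?_
  rw [Bool.eq_iff_iff]
  simp

@[fun_prop]
theorem find? {l : X → List α} {f : X → α → Bool} (hl : PT l)
    (hf : PT fun z : X × α => f z.1 z.2) : PT fun x => (l x).find? (f x) := by
  have : PT fun x => ((l x).filter (f x)).head? := by fun_prop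
  exact this.congr_enc fun x => congrArg enc (List.head?_filter).symm

@[fun_prop]
theorem findSome? {l : X → List α} {f : X → α → Option β} (hl : PT l)
    (hf : PT fun z : X × α => f z.1 z.2) : PT fun x => (l x).findSome? (f x) := by
  have : PT fun x => ((l x).flatMap fun a => (f x a).toList).head? := by fun_prop
  refine this.congr_enc fun x => congrArg enc ?_
  induction l x with
  | nil => rfl
  | cons a l ih => cases h : f x a <;> simp [h, ih]

@[fun_prop]
theorem contains [DecidableEq α] {l : X → List α} {a : X → α} (hl : PT l) (ha : PT a) :
    PT fun x => decide (a x ∈ l x) := by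
  have : PT fun x => (l x).any fun b => decide (b = a x) := by fun_prop
  refine this.congr_enc fun x => congrArg enc ?_
  rw [Bool.eq_iff_iff]
  simp

@[fun_prop]
theorem length {l : X → List α} (hl : PT l) : PT fun x => (l x).length := by
  have : PT fun x => (l x).map fun _ => () := by fun_prop
  refine this.congr_enc fun x => ?_
  rw [List.map_const']
  rfl

@[fun_prop]
theorem replicate {n : X → ℕ} {a : X → α} (hn : PT n) (ha : PT a) :
    PT fun x => List.replicate (n x) (a x) := by
  have h : PT fun x => List.replicate (n x) () := hn.congr_enc fun _ => rfl
  have : PT fun x => (List.replicate (n x) ()).map fun _ => a x := by fun_prop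
  simpa using this

@[fun_prop]
theorem range {n : X → ℕ} (hn : PT n) : PT fun x => List.range (n x) := by
  -- the numbers are found, in descending order, as the lengths of the list collected so far
  have key : ∀ n, (List.replicate n ()).foldl (fun (acc : List ℕ) _ => acc.length :: acc) [] =
      (List.range n).reverse := by
    intro n
    induction n with
    | zero => rfl
    | succ n ih => rw [List.replicate_succ', List.foldl_append, ih]; simp [List.range_succ]
  have : PT fun l : List Unit => l.foldl (fun (acc : List ℕ) _ => acc.length :: acc) [] := by
    refine foldl (by fun_prop) (by fun_prop) (by fun_prop) ?_
    obtain ⟨k, hk⟩ := (PB.id.mul (((PB.const 2).mul PB.id).add (PB.const 2))).add (PB.const 1)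
    refine ⟨k, fun x l' h => ?_⟩
    have h1 := h.length_le.trans (length_le_sz x)
    have h2 : l' = List.replicate l'.length () := List.eq_replicate_iff.2 ⟨rfl, fun _ _ => rfl⟩
    rw [h2, key, sz_reverse]
    have h3 := sz_le_length_mul (List.range l'.length) (2 * sz x + 1) fun n hn => by
      have := List.mem_range.1 hn
      rw [sz_nat]; omega
    refine h3.trans (le_trans ?_ (hk (sz x)))
    rw [List.length_range]
    exact Nat.add_le_add_right (Nat.mul_le_mul_right _ h1) 1
  have h : PT fun x => List.replicate (n x) () := hn.congr_enc fun _ => rfl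
  refine (this.comp h).reverse.congr_enc fun x => congrArg enc ?_
  generalize n x = n
  rw [key, List.reverse_reverse]

end PT

/-! ### Case distinctions over finite types, iteration, and arithmetic -/

namespace PT

variable {α β γ δ X : Type} [Enc α] [Enc β] [Enc γ] [Enc δ] [Enc X]

/-- A case distinction over a finite type, with a polynomial-time function in each case. -/
theorem finite_cases {S : Type} [Finite S] [Enc S] {F : S → X → β} (h : ∀ s, PT (F s)) :
    PT fun z : S × X => F z.1 z.2 := by
  classical
  have := Fintype.ofFinite S
  rcases isEmpty_or_nonempty S with hS | ⟨⟨s₀⟩⟩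
  · exact ⟨0, fun p q => ⟨.load _root_.id, fun x => hS.elim x.1⟩⟩
  have key : ∀ L : List S, ∃ G : S × X → β, PT G ∧ ∀ z, z.1 ∈ L → G z = F z.1 z.2 := by
    intro L
    induction L with
    | nil => exact ⟨fun z => F s₀ z.2, (h s₀).comp snd', by simp⟩
    | cons s L ih =>
      obtain ⟨G, hG, hGL⟩ := ih
      refine ⟨fun z => bif decide (z.1 = s) then F s z.2 else G z,
        cond (by fun_prop) ((h s).comp snd') hG, fun z hz => ?_⟩
      by_cases e : z.1 = s
      · simp [e]
      · simpa [e] using hGL z ((List.mem_cons.1 hz).resolve_left e)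
  obtain ⟨G, hG, hGL⟩ := key Finset.univ.toList
  exact hG.congr_enc fun z => congrArg enc (hGL z (by simp)).symm

theorem finite_cases' {S : Type} [Finite S] [Enc S] {F : S → X → β} (h : ∀ s, PT (F s))
    {s : X → S} (hs : PT s) : PT fun x => F (s x) x :=
  (finite_cases h).comp (hs.pair .id)

/-- Every function on a finite type is computable in polynomial time. -/
theorem of_finite {S : Type} [Finite S] [Enc S] (F : S → β) {s : X → S} (hs : PT s) :
    PT fun x => F (s x) :=
  finite_cases' (F := fun s _ => F s) (fun s => const (F s)) hs

theorem sz_bounded_of_finite (S : Type) [Finite S] [Enc S] : ∃ C, ∀ s : S, sz s ≤ C := by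
  obtain ⟨C, hC⟩ := (Set.finite_range fun s : S => sz s).bddAbove
  exact ⟨C, fun s => hC ⟨s, rfl⟩⟩

theorem foldl_const_fun {ι κ : Type} (l : List ι) (f : κ → κ) (b : κ) :
    l.foldl (fun acc _ => f acc) b = f^[l.length] b := by
  induction l generalizing b with
  | nil => rfl
  | cons a l ih => simp [ih]

/-- Iterating a function polynomially often, provided that all intermediate values have polynomial
size. -/
theorem iterate {n : X → ℕ} {b : X → β} {f : X → β → β} (hn : PT n) (hb : PT b)
    (hf : PT fun z : X × β => f z.1 z.2)
    (hs : ∃ k, ∀ x, ∀ m ≤ n x, sz ((f x)^[m] (b x)) ≤ (sz x + 2) ^ k) :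
    PT fun x => (f x)^[n x] (b x) := by
  have h : PT fun z : X × β × Unit => f z.1 z.2.1 :=
    hf.comp (f := fun z : X × β × Unit => (z.1, z.2.1)) (by fun_prop)
  obtain ⟨k, hk⟩ := hs
  have := foldl (l := fun x => List.replicate (n x) ()) (f := fun x b _ => f x b)
    (by fun_prop) hb h ⟨k, fun x l' hl' => by
      have := hl'.length_le
      rw [List.length_replicate] at this
      rw [foldl_const_fun]
      exact hk x _ this⟩
  simpa [foldl_const_fun] using this

theorem iterate_sz_le {f : β → β} {b : β} {m : ℕ} (h : ∀ b, sz (f b) ≤ sz b) :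
    sz (f^[m] b) ≤ sz b := by
  induction m generalizing b with
  | zero => rfl
  | succ m ih => exact ih.trans (h b)

/-- Iterating a function polynomially often, provided that every step increases the size by a
polynomial in the size of the input as long as an invariant holds. -/
theorem iterate_add {n : X → ℕ} {b : X → β} {f : X → β → β} (Inv : X → β → Prop) {C : ℕ → ℕ}
    (hn : PT n) (hb : PT b) (hf : PT fun z : X × β => f z.1 z.2) (hC : PB C)
    (h₀ : ∀ x, Inv x (b x)) (h₁ : ∀ x y, Inv x y → Inv x (f x y))
    (hs : ∀ x y, Inv x y → sz (f x y) ≤ sz y + C (sz x)) : PT fun x => (f x)^[n x] (b x) := by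
  obtain ⟨kn, hn'⟩ := hn.size_le
  obtain ⟨kb, hb'⟩ := hb.size_le
  obtain ⟨k, hk⟩ := ((PB.add_two_pow kb).add ((PB.add_two_pow kn).mul hC))
  refine iterate hn hb hf ⟨k, fun x m hm => le_trans ?_ (hk (sz x))⟩
  have key : ∀ m, Inv x ((f x)^[m] (b x)) ∧ sz ((f x)^[m] (b x)) ≤ sz (b x) + m * C (sz x) := by
    intro m
    induction m with
    | zero => simpa using h₀ x
    | succ m ih =>
      rw [Function.iterate_succ_apply']
      refine ⟨h₁ _ _ ih.1, (hs _ _ ih.1).trans ?_⟩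
      have := ih.2
      linarith
  have h3 : n x ≤ (sz x + 2) ^ kn := by
    have := hn' x
    rw [sz_nat] at this
    omega
  exact (key m).2.trans (add_le_add (hb' x) (Nat.mul_le_mul_right _ (hm.trans h3)))

theorem sz_tail_le (l : List α) : sz l.tail ≤ sz l := sz_suffix_le (List.tail_suffix l)

@[fun_prop]
theorem drop {n : X → ℕ} {l : X → List α} (hn : PT n) (hl : PT l) :
    PT fun x => (l x).drop (n x) := by
  obtain ⟨k, hk⟩ := hl.size_le
  have := iterate (f := fun (_ : X) (l : List α) => l.tail) hn hl (by fun_prop)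
    ⟨k, fun x m _ => (iterate_sz_le sz_tail_le).trans (hk x)⟩
  refine this.congr_enc fun x => congrArg enc ?_
  generalize l x = l
  induction n x generalizing l with
  | zero => rfl
  | succ n ih => rw [Function.iterate_succ_apply, ← ih, ← List.drop_one, List.drop_drop, add_comm]

@[fun_prop]
theorem getD {n : X → ℕ} {l : X → List α} {d : X → α} (hn : PT n) (hl : PT l) (hd : PT d) :
    PT fun x => (l x).getD (n x) (d x) := by
  have : PT fun x => ((l x).drop (n x)).head?.getD (d x) := by fun_prop
  refine this.congr_enc fun x => congrArg enc ?_
  simp [List.head?_drop, List.getD]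

@[fun_prop]
theorem decide_lt {m n : X → ℕ} (hm : PT m) (hn : PT n) : PT fun x => decide (m x < n x) := by
  have : PT fun x => decide (m x ∈ List.range (n x)) := by fun_prop
  exact this.congr_enc fun x => by simp

@[fun_prop]
theorem pred {n : X → ℕ} (hn : PT n) : PT fun x => n x - 1 := by
  have h : PT fun x => List.replicate (n x) () := by fun_prop
  refine h.tail.congr_enc fun x => ?_
  rw [List.tail_replicate]
  rfl

@[fun_prop]
theorem add {m n : X → ℕ} (hm : PT m) (hn : PT n) : PT fun x => m x + n x := by
  have : PT fun x => (List.replicate (m x) () ++ List.replicate (n x) ()).length := by fun_prop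
  exact this.congr_enc fun x => by simp

end PT

/-! ### Association lists and tuples -/

/-- The value of a key in an association list, and `0` if there is none. -/
def look {κ : Type} [DecidableEq κ] (l : List (κ × ℕ)) (a : κ) : ℕ :=
  ((l.find? fun e => decide (e.1 = a)).map fun e => e.2).getD 0

theorem look_map {κ : Type} [DecidableEq κ] (l : List κ) (V : κ → ℕ) {a : κ} (ha : a ∈ l) :
    look (l.map fun p => (p, V p)) a = V a := by
  induction l with
  | nil => simp at ha
  | cons b l ih =>
    by_cases h : b = a
    · simp [look, h]
    · have := ih ((List.mem_cons.1 ha).resolve_left fun e => h e.symm)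
      simpa [look, h] using this

@[fun_prop]
theorem PT.look {κ X : Type} [DecidableEq κ] [Enc κ] [Enc X] {l : X → List (κ × ℕ)} {a : X → κ}
    (hl : PT l) (ha : PT a) : PT fun x => look (l x) (a x) := by
  unfold QuerySynth.look
  fun_prop

/-- All lists of length at most `m` with entries from a given list. -/
def tuplesLE {α : Type} : ℕ → List α → List (List α)
  | 0, _ => [[]]
  | m + 1, l => [] :: l.flatMap fun a => (tuplesLE m l).map fun t => a :: t

theorem mem_tuplesLE {α : Type} {m : ℕ} {l t : List α} :
    t ∈ tuplesLE m l ↔ t.length ≤ m ∧ ∀ a ∈ t, a ∈ l := by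
  induction m generalizing t with
  | zero => cases t <;> simp [tuplesLE]
  | succ m ih =>
    cases t with
    | nil => simp [tuplesLE]
    | cons a t =>
      simp only [tuplesLE, List.mem_cons, reduceCtorEq, List.mem_flatMap, List.mem_map, ih,
        List.cons.injEq, false_or, List.length_cons, forall_eq_or_imp]
      constructor
      · rintro ⟨b, hb, u, ⟨hu, hu'⟩, rfl, rfl⟩
        exact ⟨by omega, hb, hu'⟩
      · rintro ⟨h, ha, ht⟩
        exact ⟨a, ha, t, ⟨by omega, ht⟩, rfl, rfl⟩

@[fun_prop]
theorem PT.tuplesLE {α X : Type} [Enc α] [Enc X] (m : ℕ) {l : X → List α} (hl : PT l) :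
    PT fun x => tuplesLE m (l x) := by
  suffices h : PT fun l : List α => QuerySynth.tuplesLE m l from h.comp hl
  clear hl l
  induction m with
  | zero => exact PT.const _
  | succ m ih =>
    have h : PT fun z : List α × α => (QuerySynth.tuplesLE m z.1).map fun t => z.2 :: t :=
      PT.map (ih.comp PT.fst') (by fun_prop)
    exact (PT.const []).list_cons (PT.flatMap .id h)

/-! ### The input alphabet -/

section Alphabet

variable (τ : FirstOrder.Language.{0, 0}) (k : ℕ)

theorem finite_sym [Finite τ.Symbols] : Finite (Sym τ k) := by
  refine Finite.of_injective (β := τ.Symbols ⊕ (Fin k × Fin 3) ⊕ Fin 4)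
    (fun
      | .rel R => .inl (.inr ⟨_, R⟩)
      | .fn f => .inl (.inl ⟨_, f⟩)
      | .all x => .inr (.inl (x, 0))
      | .ex x => .inr (.inl (x, 1))
      | .var x => .inr (.inl (x, 2))
      | .ite => .inr (.inr 0)
      | .and => .inr (.inr 1)
      | .or => .inr (.inr 2)
      | .not => .inr (.inr 3)) ?_
  intro a b h
  cases a <;> cases b <;> simp at h ⊢ <;> exact h

theorem finite_letter [Finite τ.Symbols] : Finite (Letter τ k) := by
  have := finite_sym τ k
  refine Finite.of_injective (β := Sym τ k ⊕ Bool ⊕ Bool)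
    (fun
      | .sym a => .inl a
      | .bit b => .inr (.inl b)
      | .tick => .inr (.inr true)
      | .mark => .inr (.inr false)) ?_
  intro a b h
  cases a <;> cases b <;> simp at h ⊢ <;> exact h

end Alphabet

section QuerySynthesis

variable {τ : FirstOrder.Language.{0, 0}} {k : ℕ}

attribute [instance] finite_sym finite_letter

noncomputable instance : DecidableEq (Letter τ k) := Classical.decEq _
noncomputable instance : DecidableEq τ.Symbols := Classical.decEq _

/-- Words over the input alphabet. -/
abbrev Word (τ : FirstOrder.Language.{0, 0}) (k : ℕ) : Type := List (Letter τ k)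

section FiniteSignature

variable [Fintype τ.Symbols]

noncomputable instance : Enc (Sym τ k) := Enc.ofFinite _
noncomputable instance : Enc (Letter τ k) := Enc.ofFinite _
noncomputable instance : Enc τ.Symbols := Enc.ofFinite _
noncomputable instance : Enc (Finset (Fin k)) := Enc.ofFinite _

end FiniteSignature

/-! ### Reading numbers -/

/-- Move one `tick` from the word to the counter. -/
noncomputable def tickStep (s : ℕ × Word τ k) : ℕ × Word τ k :=
  bif decide (s.2.head? = some .tick) then (s.1 + 1, s.2.tail) else s

/-- Read a number in unary, and return it with the rest of the word. -/
noncomputable def readNat (w : Word τ k) : Option (ℕ × Word τ k) :=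
  bif decide ((tickStep^[w.length] (0, w)).2.head? = some .mark) then
    some ((tickStep^[w.length] (0, w)).1, (tickStep^[w.length] (0, w)).2.tail)
  else none

theorem tickStep_iterate {u : Word τ k} (hu : u.head? ≠ some .tick) (i j m : ℕ) (h : j ≤ m) :
    tickStep^[m] (i, List.replicate j .tick ++ u) = (i + j, u) := by
  induction m generalizing i j with
  | zero => obtain rfl : j = 0 := by omega
            rfl
  | succ m ih =>
    rw [Function.iterate_succ_apply]
    cases j with
    | zero =>
      have : tickStep (i, List.replicate 0 .tick ++ u) = (i, List.replicate 0 .tick ++ u) := by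
        simp [tickStep, hu]
      rw [this, ih i 0 (by omega)]
    | succ j =>
      have : tickStep (i, List.replicate (j + 1) .tick ++ u) =
          (i + 1, List.replicate j .tick ++ u) := by
        simp [tickStep, List.replicate_succ]
      rw [this, ih _ _ (by omega), add_right_comm, add_assoc]

theorem exists_replicate_tick (w : Word τ k) :
    ∃ j u, w = List.replicate j .tick ++ u ∧ u.head? ≠ some .tick := by
  induction w with
  | nil => exact ⟨0, [], rfl, by simp⟩
  | cons a w ih =>
    by_cases h : a = .tick
    · obtain ⟨j, u, rfl, hu⟩ := ih
      exact ⟨j + 1, u, by simp [h, List.replicate_succ], hu⟩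
    · exact ⟨0, a :: w, rfl, by simpa using h⟩

theorem readNat_eq_some {w : Word τ k} {n : ℕ} {r : Word τ k} :
    readNat w = some (n, r) ↔ w = encNat n ++ r := by
  have key : ∀ (j : ℕ) (u : Word τ k), u.head? ≠ some .tick →
      tickStep^[(List.replicate j Letter.tick ++ u).length]
        (0, List.replicate j Letter.tick ++ u) = (j, u) := fun j u hu => by
    rw [tickStep_iterate hu _ _ _ (by simp), zero_add]
  constructor
  · intro h
    obtain ⟨j, u, rfl, hu⟩ := exists_replicate_tick w
    rw [readNat, key j u hu] at h
    cases u with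
    | nil => simp at h
    | cons a u =>
      by_cases ha : a = .mark
      · simp [ha] at h
        simp [encNat, ha, h.1, h.2]
      · simp [ha] at h
  · rintro rfl
    have : encNat n ++ r = List.replicate n .tick ++ (.mark :: r) := by simp [encNat]
    rw [readNat, this, key n _ (by simp)]
    simp

theorem readNat_encNat (n : ℕ) (r : Word τ k) : readNat (encNat n ++ r) = some (n, r) :=
  readNat_eq_some.2 rfl

section Complexity

variable [Fintype τ.Symbols] {X : Type} [Enc X]

theorem sz_encNat_ge (n : ℕ) (r : Word τ k) : 2 * n + sz r + 2 ≤ sz (encNat n ++ r) := by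
  induction n with
  | zero =>
    have := sz_pos (Letter.mark : Letter τ k)
    simp [encNat]
    omega
  | succ n ih =>
    have := sz_pos (Letter.tick : Letter τ k)
    simp [encNat, List.replicate_succ] at ih ⊢
    omega

theorem PT.readNat {w : X → Word τ k} (hw : PT w) : PT fun x => readNat (w x) := by
  suffices h : PT fun w : Word τ k => tickStep^[w.length] (0, w) by
    have : PT fun w : Word τ k => QuerySynth.readNat w := by
      unfold QuerySynth.readNat
      fun_prop
    exact this.comp hw
  refine PT.iterate_add (fun _ _ => True) (f := fun _ s => tickStep s) (C := fun _ => 2)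
    (by fun_prop) (by fun_prop) (by unfold tickStep; fun_prop) (PB.const 2) (by simp) (by simp) ?_
  rintro - ⟨n, w⟩ -
  have := PT.sz_tail_le w
  by_cases h : w.head? = some .tick
  · simp [tickStep, h]; omega
  · simp [tickStep, h]

attribute [fun_prop] PT.readNat

end Complexity

/-! ### Reading trees -/

/-- The arity of a letter which is a symbol of the ranked alphabet. -/
def letterArity : Letter τ k → Option ℕ
  | .sym a => some a.arity
  | _ => none

/-- Read the root symbol of the first tree of a sequence of trees. The state is the number of trees
which remain to be read together with the rest of the word. -/
noncomputable def treeStep (q : ℕ) (s : ℕ × Word τ k) : Option (ℕ × Word τ k) :=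
  bif decide (s.1 = 0) then some s
  else
    (s.2.head?.bind letterArity).elim
      ((readNat s.2).bind fun e => bif decide (e.1 < q) then some (s.1 - 1, e.2) else none)
      fun l => some (s.1 - 1 + l, s.2.tail)

/-- The state after as many steps as the word has letters. -/
noncomputable def treeState (q n : ℕ) (w : Word τ k) : Option (ℕ × Word τ k) :=
  (fun s : Option (ℕ × Word τ k) => s.bind (treeStep q))^[w.length] (some (n, w))

/-- Read `n` trees with nonterminals smaller than `q`, and return the rest of the word. -/
noncomputable def readTrees (q n : ℕ) (w : Word τ k) : Option (Word τ k) :=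
  (treeState q n w).bind fun s => bif decide (s.1 = 0) then some s.2 else none

theorem encTree_node {q : ℕ} (a : Sym τ k) (ts : Fin a.arity → Tree τ k (Fin q)) :
    encTree (.node a ts) = .sym a :: (List.ofFn ts).flatMap encTree := by
  rw [encTree, List.ofFn_eq_map, List.flatMap_map]

theorem bind_iterate_none {α : Type} (f : α → Option α) (m : ℕ) :
    (fun s : Option α => s.bind f)^[m] none = none := by
  induction m with
  | zero => rfl
  | succ m ih => rw [Function.iterate_succ_apply]; exact ih

/-- If `n` trees can be read, then the word starts with the encodings of `n` trees. -/
theorem treeStep_sound {q : ℕ} (m n : ℕ) (w r : Word τ k)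
    (h : (fun s : Option (ℕ × Word τ k) => s.bind (treeStep q))^[m] (some (n, w)) = some (0, r)) :
    ∃ ts : List (Tree τ k (Fin q)), ts.length = n ∧ w = ts.flatMap encTree ++ r := by
  induction m generalizing n w with
  | zero =>
    simp at h
    exact ⟨[], by simp [h.1], by simp [h.2]⟩
  | succ m ih =>
    rw [Function.iterate_succ_apply] at h
    cases n with
    | zero =>
      have : (some (0, w)).bind (treeStep q) = some (0, w) := by simp [treeStep]
      rw [this] at h
      exact ih _ _ h
    | succ n =>
      cases ha : w.head?.bind letterArity with
      | none =>
        cases hr : readNat w with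
        | none =>
          have : (some (n + 1, w)).bind (treeStep q) = none := by simp [treeStep, ha, hr]
          rw [this, bind_iterate_none] at h
          simp at h
        | some e =>
          obtain ⟨B, r'⟩ := e
          by_cases hB : B < q
          · have : (some (n + 1, w)).bind (treeStep q) = some (n, r') := by
              simp [treeStep, ha, hr, hB]
            rw [this] at h
            obtain ⟨ts, hts, rfl⟩ := ih _ _ h
            refine ⟨.leaf ⟨B, hB⟩ :: ts, by simp [hts], ?_⟩
            rw [readNat_eq_some.1 hr]
            simp [encTree]
          · have : (some (n + 1, w)).bind (treeStep q) = none := by simp [treeStep, ha, hr, hB]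
            rw [this, bind_iterate_none] at h
            simp at h
      | some l =>
        cases w with
        | nil => simp at ha
        | cons a w =>
          have : (some (n + 1, a :: w)).bind (treeStep q) = some (n + l, w) := by
            simp only [List.head?_cons, Option.bind_some] at ha
            simp [treeStep, ha]
          rw [this] at h
          obtain ⟨ts, hts, rfl⟩ := ih _ _ h
          cases a with
          | sym a =>
            simp [letterArity] at ha
            subst ha
            refine ⟨.node a (fun i => ts[i.1]) :: ts.drop a.arity, by simp [hts], ?_⟩
            have : List.ofFn (fun i : Fin a.arity => ts[i.1]) = ts.take a.arity := by
              apply List.ext_getElem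
              · simp; omega
              · simp
            rw [List.flatMap_cons, encTree_node, this, List.cons_append, List.cons_append,
              ← List.flatMap_append, List.take_append_drop]
          | _ => simp [letterArity] at ha

theorem treeStep_zero {q : ℕ} (m : ℕ) (r : Word τ k) :
    (fun s : Option (ℕ × Word τ k) => s.bind (treeStep q))^[m] (some (0, r)) = some (0, r) := by
  induction m with
  | zero => rfl
  | succ m ih =>
    rw [Function.iterate_succ_apply]
    simpa [treeStep] using ih

/-- The encoding of a tree is read in at most as many steps as it has letters. -/
theorem treeStep_complete {q : ℕ} (t : Tree τ k (Fin q)) :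
    ∃ m ≤ (encTree t).length, ∀ n r,
      (fun s : Option (ℕ × Word τ k) => s.bind (treeStep q))^[m] (some (n + 1, encTree t ++ r)) =
        some (n, r) := by
  induction t with
  | leaf B =>
    refine ⟨1, by simp [encTree, encNat], fun n r => ?_⟩
    have h1 : ((encNat (B : ℕ) : Word τ k) ++ r).head?.bind letterArity = none := by
      cases h : (B : ℕ) <;> simp [encNat, List.replicate_succ, letterArity]
    rw [Function.iterate_one, Option.bind_some, treeStep]
    simp only [encTree, h1]
    simp [readNat_encNat]
  | node a ts ih =>
    have key : ∀ l : List (Tree τ k (Fin q)), (∀ t ∈ l, ∃ m ≤ (encTree t).length, ∀ n r,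
        (fun s : Option (ℕ × Word τ k) => s.bind (treeStep q))^[m]
          (some (n + 1, encTree t ++ r)) = some (n, r)) →
        ∃ m ≤ (l.flatMap encTree).length, ∀ n r,
        (fun s : Option (ℕ × Word τ k) => s.bind (treeStep q))^[m]
          (some (n + l.length, l.flatMap encTree ++ r)) = some (n, r) := by
      intro l
      induction l with
      | nil => exact fun _ => ⟨0, by simp, by simp⟩
      | cons t l ihl =>
        intro h
        obtain ⟨m₁, h₁, e₁⟩ := h t (by simp)
        obtain ⟨m₂, h₂, e₂⟩ := ihl fun t ht => h t (by simp [ht])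
        refine ⟨m₂ + m₁, by rw [List.flatMap_cons, List.length_append]; omega, fun n r => ?_⟩
        rw [Function.iterate_add_apply, List.flatMap_cons, List.append_assoc, List.length_cons,
          ← add_assoc, e₁, e₂]
    obtain ⟨m, hm, e⟩ := key (List.ofFn ts) (by simpa [List.mem_ofFn] using ih)
    refine ⟨m + 1, by rw [encTree_node]; simpa using hm, fun n r => ?_⟩
    have := e n r
    rw [List.length_ofFn] at this
    rw [Function.iterate_succ_apply, encTree_node]
    simpa [treeStep, letterArity] using this

theorem readTrees_encTree {q : ℕ} (t : Tree τ k (Fin q)) (r : Word τ k) :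
    readTrees q 1 (encTree t ++ r) = some r := by
  obtain ⟨m, hm, h⟩ := treeStep_complete t
  obtain ⟨j, hj⟩ := Nat.exists_eq_add_of_le
    (show m ≤ (encTree t ++ r).length by simp; omega)
  rw [readTrees, treeState, hj, add_comm, Function.iterate_add_apply, h 0 r, treeStep_zero]
  simp

theorem readTrees_sound {q : ℕ} {w r : Word τ k} (h : readTrees q 1 w = some r) :
    ∃ t : Tree τ k (Fin q), w = encTree t ++ r := by
  rw [readTrees, treeState] at h
  obtain ⟨⟨n, r'⟩, h1, h2⟩ := Option.bind_eq_some_iff.1 h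
  by_cases hn : n = 0
  · simp [hn] at h2
    subst hn h2
    obtain ⟨ts, hts, rfl⟩ := treeStep_sound _ _ _ _ h1
    obtain ⟨t, rfl⟩ := List.length_eq_one_iff.1 hts
    exact ⟨t, by simp⟩
  · simp [hn] at h2

section Complexity

variable [Fintype τ.Symbols] {X : Type} [Enc X]

@[fun_prop]
theorem PT.treeState {q n : X → ℕ} {w : X → Word τ k} (hq : PT q) (hn : PT n) (hw : PT w) :
    PT fun x => treeState (q x) (n x) (w x) := by
  suffices h : PT fun z : ℕ × ℕ × Word τ k => QuerySynth.treeState z.1 z.2.1 z.2.2 from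
    PT.comp (f := fun x => (q x, n x, w x)) h (by fun_prop)
  unfold QuerySynth.treeState
  obtain ⟨C, hC⟩ := (Set.finite_range fun a : Letter τ k => (letterArity a).getD 0).bddAbove
  have hC' : ∀ a l, letterArity a = some l → l ≤ C := fun a l h => by
    have := hC ⟨a, rfl⟩
    simpa [h] using this
  have ha : ∀ {Y : Type} [Enc Y] {f : Y → Letter τ k}, PT f → PT fun y => letterArity (f y) :=
    fun hf => PT.of_finite letterArity hf
  have h1 : PT fun z : (ℕ × ℕ × Word τ k) × (ℕ × Word τ k) => z.2.2.head?.bind letterArity :=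
    PT.option_bind (by fun_prop) (ha (by fun_prop))
  refine PT.iterate_add (fun _ _ => True)
    (f := fun (z : ℕ × ℕ × Word τ k) (s : Option (ℕ × Word τ k)) => s.bind (treeStep z.1))
    (C := fun _ => 2 * C) (by fun_prop) (by fun_prop) ?_ (PB.const _) (by simp) (by simp) ?_
  · have h2 : PT fun z : (ℕ × ℕ × Word τ k) × (ℕ × Word τ k) => treeStep z.1.1 z.2 := by
      unfold treeStep
      fun_prop
    refine PT.option_bind (by fun_prop) ?_
    exact h2.comp (f := fun z : ((ℕ × ℕ × Word τ k) × Option (ℕ × Word τ k)) × (ℕ × Word τ k) =>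
      (z.1.1, z.2)) (by fun_prop)
  · rintro z (_ | ⟨n, w⟩) -
    · simp
    · simp only [Option.bind_some, treeStep]
      by_cases hn : n = 0
      · simp [hn]
      · have ht := PT.sz_tail_le w
        cases hl : w.head?.bind letterArity with
        | some l =>
          have := (Option.bind_eq_some_iff.1 hl)
          obtain ⟨a, -, h⟩ := this
          have := hC' a l h
          simp [hn]
          omega
        | none =>
          cases hr : QuerySynth.readNat w with
          | none => simp [hn]; omega
          | some e =>
            obtain ⟨B, r⟩ := e
            have h := sz_encNat_ge B r
            rw [← readNat_eq_some.1 hr] at h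
            by_cases hB : B < z.1 <;> simp [hn, hB] <;> omega

@[fun_prop]
theorem PT.readTrees {q n : X → ℕ} {w : X → Word τ k} (hq : PT q) (hn : PT n) (hw : PT w) :
    PT fun x => readTrees (q x) (n x) (w x) := by
  unfold QuerySynth.readTrees
  fun_prop

end Complexity

/-! ### Reading tables -/

/-- A tuple as a list of numbers. -/
def ofNats {l n : ℕ} (a : Fin l → Fin n) : List ℕ := List.ofFn fun i => (a i : ℕ)

theorem ofNats_injective {l n : ℕ} : Function.Injective (ofNats : (Fin l → Fin n) → List ℕ) := by
  intro a b h
  funext i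
  exact Fin.ext (congrFun (List.ofFn_injective h) i)

/-- The tuples of length `l` with entries below `n`, in the order used for tables. -/
def keys : ℕ → ℕ → List (List ℕ)
  | 0, _ => [[]]
  | l + 1, n => (keys l n).flatMap fun t => (List.range n).map fun a => a :: t

theorem mem_keys {l n : ℕ} {t : List ℕ} : t ∈ keys l n ↔ t.length = l ∧ ∀ a ∈ t, a < n := by
  induction l generalizing t with
  | zero => cases t <;> simp [keys]
  | succ l ih =>
    cases t with
    | nil => simp [keys]
    | cons a t =>
      simp only [keys, List.mem_flatMap, List.mem_map, List.mem_range, ih, List.cons.injEq,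
        List.length_cons, List.mem_cons, forall_eq_or_imp]
      constructor
      · rintro ⟨u, ⟨hu, hu'⟩, b, hb, rfl, rfl⟩
        exact ⟨by omega, hb, hu'⟩
      · rintro ⟨h, ha, ht⟩
        exact ⟨t, ⟨by omega, ht⟩, a, ha, rfl, rfl⟩

theorem ofNats_mem_keys {l n : ℕ} (a : Fin l → Fin n) : ofNats a ∈ keys l n := by
  simp [mem_keys, ofNats, List.mem_ofFn]

theorem exists_ofNats {l n : ℕ} {t : List ℕ} (h : t ∈ keys l n) :
    ∃ a : Fin l → Fin n, ofNats a = t := by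
  obtain ⟨rfl, h'⟩ := mem_keys.1 h
  exact ⟨fun i => ⟨t[i], h' _ (by simp)⟩, by simp [ofNats]⟩

theorem range_mul_eq (N n : ℕ) : List.range (N * n) =
    (List.range N).flatMap fun t => (List.range n).map fun a => a + n * t := by
  induction N with
  | zero => simp
  | succ N ih =>
    rw [add_mul, one_mul, List.range_add, ih, List.range_succ, List.flatMap_append]
    simp [add_comm, mul_comm]

theorem keys_eq_range (l n : ℕ) : keys l n =
    (List.range (n ^ l)).map fun j => List.ofFn fun i : Fin l => j / n ^ (i : ℕ) % n := by
  induction l with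
  | zero => simp [keys]
  | succ l ih =>
    rw [keys, ih, pow_succ, range_mul_eq, List.flatMap_map, List.map_flatMap]
    congr 1
    funext t
    rw [List.map_map]
    refine List.map_congr_left fun a ha => ?_
    have ha := List.mem_range.1 ha
    simp only [Function.comp_apply, List.ofFn_succ, Fin.val_zero, pow_zero, Nat.div_one,
      Nat.add_mul_mod_self_left, Nat.mod_eq_of_lt ha, Fin.val_succ, pow_succ']
    congr 2
    funext i
    rw [← Nat.div_div_eq_div_mul, Nat.add_mul_div_left _ _ (by omega), Nat.div_eq_of_lt ha,
      zero_add]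

theorem keys_eq (l n : ℕ) : keys l n =
    (List.finRange (n ^ l)).map fun j => ofNats (finFunctionFinEquiv.symm j : Fin l → Fin n) := by
  rw [keys_eq_range, ← List.map_coe_finRange_eq_range, List.map_map]
  rfl

theorem nodup_keys (l n : ℕ) : (keys l n).Nodup := by
  rw [keys_eq]
  exact (List.nodup_finRange _).map (ofNats_injective.comp (Equiv.injective _))

theorem encTable_eq {α : Type} {n l : ℕ} (e : α → Word τ k) (F : (Fin l → Fin n) → α)
    (g : List ℕ → Word τ k) (h : ∀ a, g (ofNats a) = e (F a)) :
    encTable e F = (keys l n).flatMap g := by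
  rw [encTable, keys_eq, List.flatMap_map]
  congr 1
  funext j
  exact (h _).symm

/-- The tuples of length `r`, where `r` is at most `j`. Unlike in `keys r n`, the recursion is on
the constant `j`, so that this is a polynomial-time function of `r` and `n`. -/
def keysLE : ℕ → ℕ → ℕ → List (List ℕ)
  | 0, _, n => keys 0 n
  | j + 1, r, n => bif decide (r = j + 1) then keys (j + 1) n else keysLE j r n

theorem keysLE_eq {j r : ℕ} (h : r ≤ j) (n : ℕ) : keysLE j r n = keys r n := by
  induction j with
  | zero => obtain rfl : r = 0 := by omega
            rfl
  | succ j ih =>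
    by_cases hr : r = j + 1
    · simp [keysLE, hr]
    · simp [keysLE, hr, ih (by omega)]

/-- The arity of a symbol of the signature. -/
def symAr : τ.Symbols → ℕ
  | .inl ⟨l, _⟩ => l
  | .inr ⟨l, _⟩ => l

/-- The names of the tables in the encoding of an example are the symbols of the signature, and
`none` for the answer set. An entry of a table is named by its table and its arguments. -/
abbrev Entry (τ : FirstOrder.Language.{0, 0}) : Type := Option τ.Symbols × List ℕ

/-- Whether the entries of a table are elements of the domain (and not truth values). -/
def isFn : Option τ.Symbols → Bool
  | some (.inl _) => true
  | _ => false

/-- The names of all entries of all tables of an example with answer arity `r` and size `n`. -/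
noncomputable def allKeys [Fintype τ.Symbols] (k r n : ℕ) : List (Entry τ) :=
  ((Finset.univ : Finset τ.Symbols).toList.flatMap fun s =>
    (keys (symAr s) n).map fun t => (some s, t)) ++ (keysLE k r n).map fun t => (none, t)

theorem some_mem_allKeys [Fintype τ.Symbols] {r n : ℕ} {s : τ.Symbols} {t : List ℕ}
    (h : t ∈ keys (symAr s) n) : ((some s, t) : Entry τ) ∈ allKeys k r n := by
  simp [allKeys, h]

theorem none_mem_allKeys [Fintype τ.Symbols] {r n : ℕ} (hr : r ≤ k) {t : List ℕ}
    (h : t ∈ keys r n) : ((none, t) : Entry τ) ∈ allKeys k r n := by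
  simp [allKeys, keysLE_eq hr, h]

theorem nodup_allKeys [Fintype τ.Symbols] {r n : ℕ} (hr : r ≤ k) :
    (allKeys k r n : List (Entry τ)).Nodup := by
  rw [allKeys, keysLE_eq hr, List.nodup_append]
  refine ⟨List.nodup_flatMap.2 ⟨fun s _ => (nodup_keys _ _).map fun a b h => by simpa using h, ?_⟩,
    (nodup_keys _ _).map fun a b h => by simpa using h, ?_⟩
  · refine (Finset.nodup_toList _).imp fun hab x hx hy => ?_
    obtain ⟨t, -, rfl⟩ := List.mem_map.1 hx
    obtain ⟨u, -, h⟩ := List.mem_map.1 hy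
    simp at h
    exact hab h.1.symm
  · rintro ⟨a, t⟩ h ⟨b, u⟩ h'
    simp only [List.mem_flatMap, List.mem_map, Prod.mk.injEq] at h h'
    obtain ⟨s, -, u', -, rfl, -⟩ := h
    obtain ⟨u'', -, rfl, -⟩ := h'
    simp

/-- The encoding of an entry of a table. -/
def encVal (b : Bool) (v : ℕ) : Word τ k := if b then encNat v else [.bit (decide (v = 1))]

/-- The admissible values of an entry of a table in a structure of size `n`. -/
def ValOK (b : Bool) (n v : ℕ) : Prop := if b then v < n else v ≤ 1

open Classical in
/-- The entries of the tables of an example; truth values are numbers. -/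
noncomputable def Example.table {r : ℕ} (E : Example τ r) : Entry τ → ℕ
  | (some (.inl ⟨l, f⟩), t) =>
      if h : ∃ a : Fin l → Fin E.size, ofNats a = t then E.str.funMap f h.choose else 0
  | (some (.inr ⟨l, R⟩), t) =>
      if ∃ a : Fin l → Fin E.size, ofNats a = t ∧ E.str.RelMap R a then 1 else 0
  | (none, t) => if ∃ a : Fin r → Fin E.size, ofNats a = t ∧ a ∈ E.ans then 1 else 0

section Table

variable {r : ℕ} (E : Example τ r)

theorem Example.table_fn {l : ℕ} (f : τ.Functions l) (a : Fin l → Fin E.size) :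
    E.table (some (.inl ⟨l, f⟩), ofNats a) = E.str.funMap f a := by
  have h : ∃ b : Fin l → Fin E.size, ofNats b = ofNats a := ⟨a, rfl⟩
  simp only [Example.table, h, dite_true]
  rw [ofNats_injective h.choose_spec]

open Classical in
theorem Example.table_rel {l : ℕ} (R : τ.Relations l) (a : Fin l → Fin E.size) :
    E.table (some (.inr ⟨l, R⟩), ofNats a) = if E.str.RelMap R a then 1 else 0 := by
  simp [Example.table, ofNats_injective.eq_iff]

open Classical in
theorem Example.table_ans (a : Fin r → Fin E.size) :
    E.table (none, ofNats a) = if a ∈ E.ans then 1 else 0 := by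
  simp [Example.table, ofNats_injective.eq_iff]

theorem Example.valOK_table {n : ℕ} (hn : E.size = n) (e : Entry τ) :
    ValOK (isFn e.1) n (E.table e) := by
  subst hn
  have := E.size_pos
  obtain ⟨(_ | ⟨l, f⟩ | ⟨l, R⟩), t⟩ := e <;> simp [ValOK, isFn, Example.table] <;> split_ifs <;>
    simp_all

theorem encExample_eq [Fintype τ.Symbols] (hr : r ≤ k) :
    (encExample E : Word τ k) = encNat E.size ++
      (allKeys k r E.size).flatMap fun e => encVal (isFn e.1) (E.table e) := by
  rw [encExample, allKeys, keysLE_eq hr, List.flatMap_append, List.append_assoc,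
    List.flatMap_assoc]
  congr 2
  · congr 1
    funext s
    rw [List.flatMap_map]
    rcases s with ⟨l, f⟩ | ⟨l, R⟩
    · exact encTable_eq (l := l) (n := E.size) (fun b : Fin E.size => encNat b) (E.str.funMap f) _
        fun a => by simp [isFn, encVal, E.table_fn]
    · exact encTable_eq (l := l) (n := E.size) encProp (E.str.RelMap R) _
        fun a => by simp [isFn, encVal, E.table_rel, encProp]
  · rw [List.flatMap_map]
    exact encTable_eq _ _ _ fun a => by simp [isFn, encVal, E.table_ans, encProp]

end Table

/-- Read an entry of a table. -/
noncomputable def readVal (n : ℕ) (b : Bool) (w : Word τ k) : Option (ℕ × Word τ k) :=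
  bif b then (readNat w).bind fun e => bif decide (e.1 < n) then some e else none
  else bif decide (w.head? = some (.bit true)) then some (1, w.tail)
  else bif decide (w.head? = some (.bit false)) then some (0, w.tail) else none

theorem readVal_eq_some {n : ℕ} {b : Bool} {w r : Word τ k} {v : ℕ} :
    readVal n b w = some (v, r) ↔ ValOK b n v ∧ w = encVal b v ++ r := by
  cases b with
  | true =>
    simp only [readVal, cond_true, Option.bind_eq_some_iff, ValOK, encVal, if_true]
    constructor
    · rintro ⟨⟨v', r'⟩, h, h'⟩
      by_cases hv : v' < n
      · simp [hv] at h'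
        obtain ⟨rfl, rfl⟩ := h'
        exact ⟨hv, readNat_eq_some.1 h⟩
      · simp [hv] at h'
    · rintro ⟨hv, h⟩
      exact ⟨(v, r), readNat_eq_some.2 h, by simp [hv]⟩
  | false =>
    simp only [readVal, cond_false, ValOK, encVal, Bool.false_eq_true, if_false]
    cases w with
    | nil => simp
    | cons a w =>
      by_cases h1 : a = .bit true
      · simp [h1]
        constructor
        · rintro ⟨rfl, rfl⟩; simp
        · rintro ⟨-, rfl, rfl⟩; simp
      · by_cases h0 : a = .bit false
        · simp [h0]
          constructor
          · rintro ⟨rfl, rfl⟩; simp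
          · rintro ⟨h, h', rfl⟩; simp; omega
        · simp [h1, h0]
          intro _ h
          by_cases hv : v = 1 <;> simp [hv] at h <;> contradiction

/-- Read one further entry of a table. -/
noncomputable def valStep (n : ℕ) (acc : Option (List (Entry τ × ℕ) × Word τ k)) (e : Entry τ) :
    Option (List (Entry τ × ℕ) × Word τ k) :=
  acc.bind fun s => (readVal n (isFn e.1) s.2).map fun v => (s.1 ++ [(e, v.1)], v.2)

/-- Read the entries of the tables with the given names. -/
noncomputable def readVals (n : ℕ) (ks : List (Entry τ)) (w : Word τ k) :
    Option (List (Entry τ × ℕ) × Word τ k) :=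
  ks.foldl (valStep n) (some ([], w))

theorem foldl_valStep_none (n : ℕ) (ks : List (Entry τ)) :
    ks.foldl (valStep (k := k) n) none = none := by
  induction ks with
  | nil => rfl
  | cons e ks ih => exact ih

theorem foldl_valStep_of_table (n : ℕ) (F : Entry τ → ℕ) (hF : ∀ e, ValOK (isFn e.1) n (F e))
    (ks : List (Entry τ)) (T : List (Entry τ × ℕ)) (r : Word τ k) :
    ks.foldl (valStep n) (some (T, ks.flatMap (fun e => encVal (isFn e.1) (F e)) ++ r)) =
      some (T ++ ks.map fun e => (e, F e), r) := by
  induction ks generalizing T with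
  | nil => simp
  | cons e ks ih =>
    have : valStep n (some (T, (e :: ks).flatMap (fun e => encVal (isFn e.1) (F e)) ++ r)) e =
        some (T ++ [(e, F e)], ks.flatMap (fun e => encVal (isFn e.1) (F e)) ++ r) := by
      simp only [valStep, Option.bind_some]
      rw [readVal_eq_some.2 ⟨hF e, by rw [List.flatMap_cons, List.append_assoc]⟩]
      rfl
    rw [List.foldl_cons, this, ih]
    simp

theorem readVals_of_table (n : ℕ) (F : Entry τ → ℕ) (hF : ∀ e, ValOK (isFn e.1) n (F e))
    (ks : List (Entry τ)) (r : Word τ k) :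
    readVals n ks (ks.flatMap (fun e => encVal (isFn e.1) (F e)) ++ r) =
      some (ks.map fun e => (e, F e), r) := by
  rw [readVals, foldl_valStep_of_table n F hF]
  simp

/-- Entries which have been read successfully are those of a table with admissible values. The names
must be distinct, since otherwise an entry could be read twice with different values. -/
theorem exists_table_of_foldl (n : ℕ) (ks : List (Entry τ)) (hks : ks.Nodup)
    (T T' : List (Entry τ × ℕ)) (w r : Word τ k)
    (h : ks.foldl (valStep n) (some (T, w)) = some (T', r)) :
    ∃ F : Entry τ → ℕ, (∀ e ∈ ks, ValOK (isFn e.1) n (F e)) ∧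
      w = ks.flatMap (fun e => encVal (isFn e.1) (F e)) ++ r := by
  induction ks generalizing T w with
  | nil =>
    simp at h
    exact ⟨fun _ => 0, by simp, by simp [h.2]⟩
  | cons e ks ih =>
    rw [List.foldl_cons] at h
    cases hs : valStep n (some (T, w)) e with
    | none => simp [hs, foldl_valStep_none] at h
    | some s =>
      obtain ⟨T₁, w₁⟩ := s
      rw [hs] at h
      obtain ⟨he, hks⟩ := List.nodup_cons.1 hks
      obtain ⟨F, hF, rfl⟩ := ih hks _ _ h
      simp only [valStep, Option.bind_some, Option.map_eq_some_iff, Prod.mk.injEq] at hs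
      obtain ⟨⟨v, w₂⟩, hv, -, rfl⟩ := hs
      obtain ⟨hv', rfl⟩ := readVal_eq_some.1 hv
      refine ⟨Function.update F e v, ?_, ?_⟩
      · intro e' he'
        rcases List.mem_cons.1 he' with rfl | he'
        · simpa using hv'
        · have hne : e' ≠ e := fun h => he (h ▸ he')
          rw [Function.update_of_ne hne]
          exact hF e' he'
      · rw [List.flatMap_cons, Function.update_self, List.append_assoc]
        congr 2
        refine List.flatMap_congr fun e' he' => ?_
        have hne : e' ≠ e := fun h => he (h ▸ he')
        rw [Function.update_of_ne hne]

section Complexity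

variable [Fintype τ.Symbols] {X : Type} [Enc X]

@[fun_prop]
theorem PT.keys (l : ℕ) {n : X → ℕ} (hn : PT n) : PT fun x => keys l (n x) := by
  suffices h : PT fun n : ℕ => QuerySynth.keys l n from h.comp hn
  induction l with
  | zero => exact PT.const _
  | succ l ih =>
    unfold QuerySynth.keys
    exact PT.flatMap ih (by fun_prop)

@[fun_prop]
theorem PT.keysLE (j : ℕ) {r n : X → ℕ} (hr : PT r) (hn : PT n) :
    PT fun x => keysLE j (r x) (n x) := by
  induction j with
  | zero => exact PT.const _
  | succ j ih => exact PT.cond (by fun_prop) (by fun_prop) ih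

@[fun_prop]
theorem PT.allKeys {r n : X → ℕ} (hr : PT r) (hn : PT n) :
    PT fun x => (allKeys k (r x) (n x) : List (Entry τ)) := by
  unfold QuerySynth.allKeys
  have h : PT fun z : X × τ.Symbols => QuerySynth.keys (symAr z.2) (n z.1) :=
    PT.finite_cases' (F := fun s z => QuerySynth.keys (symAr s) (n z.1))
      (fun s => by fun_prop) PT.snd'
  exact PT.append (PT.flatMap (by fun_prop) (PT.map h (by fun_prop))) (by fun_prop)

@[fun_prop]
theorem PT.isFn {s : X → Option τ.Symbols} (hs : PT s) : PT fun x => isFn (s x) := by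
  have : PT fun x => (s x).elim false fun s => QuerySynth.isFn (some s) :=
    PT.option_elim hs (by fun_prop) (PT.of_finite (fun s => QuerySynth.isFn (some s)) (by fun_prop))
  exact this.congr_enc fun x => by cases s x <;> rfl

@[fun_prop]
theorem PT.readVal {n : X → ℕ} {b : X → Bool} {w : X → Word τ k} (hn : PT n) (hb : PT b)
    (hw : PT w) : PT fun x => readVal (n x) (b x) (w x) := by
  unfold QuerySynth.readVal
  fun_prop

theorem sz_readVal {n v : ℕ} {b : Bool} {w r : Word τ k} (h : readVal n b w = some (v, r)) :
    2 * v + sz r ≤ sz w := by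
  obtain ⟨hv, rfl⟩ := readVal_eq_some.1 h
  cases b with
  | true =>
    have := sz_encNat_ge v r
    simp [encVal]
    omega
  | false =>
    simp [ValOK] at hv
    have := sz_pos (Letter.bit (decide (v = 1)) : Letter τ k)
    simp [encVal]
    omega

@[fun_prop]
theorem PT.readVals {n : X → ℕ} {ks : X → List (Entry τ)} {w : X → Word τ k} (hn : PT n)
    (hks : PT ks) (hw : PT w) : PT fun x => readVals (n x) (ks x) (w x) := by
  unfold QuerySynth.readVals
  obtain ⟨c, hc⟩ := hks.size_le
  refine PT.foldl_add (C := fun n => (n + 2) ^ c + 10) hks (by fun_prop)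
    (by unfold valStep; fun_prop) ((PB.add_two_pow c).add (PB.const 10)) ?_
  rintro x (_ | ⟨T, u⟩) e he
  · simp [valStep]
  · have h1 := (sz_le_of_mem he).trans (hc x)
    cases h : QuerySynth.readVal (n x) (QuerySynth.isFn e.1) u with
    | none => simp [valStep, h]; omega
    | some v =>
      have h2 := sz_readVal (v := v.1) (r := v.2) h
      have h3 := sz_append T [(e, v.1)]
      simp [valStep, h] at h3 ⊢
      omega

end Complexity

/-! ### Reading examples -/

/-- A point `(i, n, γ)`: the index `i` of an example, its size `n`, and an assignment `γ`. -/
abbrev Point : Type := ℕ × ℕ × List ℕ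

/-- The assignments for the `i`-th example, of size `n`. -/
def points (k i n : ℕ) : List Point := (keys k n).map fun γ => (i, n, γ)

/-- The tables of all examples: the name of an entry is preceded by the index of the example. -/
abbrev Tables (τ : FirstOrder.Language.{0, 0}) : Type := List ((ℕ × Entry τ) × ℕ)

theorem readNat_suffix {w r : Word τ k} {n : ℕ} (h : readNat w = some (n, r)) : r <:+ w := by
  rw [readNat_eq_some.1 h]
  exact List.suffix_append _ _

theorem foldl_valStep_suffix {n : ℕ} {ks : List (Entry τ)} {T : List (Entry τ × ℕ)} {u : Word τ k}
    {s : List (Entry τ × ℕ) × Word τ k} (h : ks.foldl (valStep n) (some (T, u)) = some s) :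
    s.2 <:+ u := by
  induction ks generalizing T u with
  | nil =>
    simp at h
    rw [← h]
  | cons e ks ih =>
    rw [List.foldl_cons] at h
    cases hs : valStep n (some (T, u)) e with
    | none => simp [hs, foldl_valStep_none] at h
    | some s' =>
      rw [hs] at h
      refine (ih h).trans ?_
      simp only [valStep, Option.bind_some, Option.map_eq_some_iff] at hs
      obtain ⟨v, hv, rfl⟩ := hs
      rw [(readVal_eq_some.1 hv).2]
      exact List.suffix_append _ _

section Examples

variable [Fintype τ.Symbols]

/-- Read the `i`-th example: its points, its tables, and the rest of the word. -/
noncomputable def readExample (r i : ℕ) (w : Word τ k) :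
    Option (List Point × Tables τ × Word τ k) :=
  (readNat w).bind fun e => bif decide (e.1 = 0) then none else
    (readVals e.1 (allKeys k r e.1) e.2).map fun v =>
      (points k i e.1, v.1.map fun x => ((i, x.1), x.2), v.2)

/-- Read one further example, if there is one. -/
noncomputable def exStep (r : ℕ) (s : ℕ × List Point × Tables τ × Word τ k) :
    Option (ℕ × List Point × Tables τ × Word τ k) :=
  bif decide (s.2.2.2.head? = some .tick) then
    (readExample r s.1 s.2.2.2.tail).map fun e =>
      (s.1 + 1, s.2.1 ++ e.1, s.2.2.1 ++ e.2.1, e.2.2)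
  else some s

/-- The state after as many steps as the word has letters: the number of examples, their points and
tables, and the rest of the word. -/
noncomputable def exState (r : ℕ) (w : Word τ k) :
    Option (ℕ × List Point × Tables τ × Word τ k) :=
  (fun s : Option (ℕ × List Point × Tables τ × Word τ k) => s.bind (exStep r))^[w.length]
    (some (0, [], [], w))

variable {r : ℕ}

/-- The tables of the `i`-th example. -/
noncomputable def Example.tables (k i : ℕ) (E : Example τ r) : Tables τ :=
  (allKeys k r E.size).map fun e => ((i, e), E.table e)

/-- The points of a list of examples, numbered from `i` on. -/
def pointsFrom (k : ℕ) : ℕ → List (Example τ r) → List Point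
  | _, [] => []
  | i, E :: Es => points k i E.size ++ pointsFrom k (i + 1) Es

/-- The tables of a list of examples, numbered from `i` on. -/
noncomputable def tablesFrom (k : ℕ) : ℕ → List (Example τ r) → Tables τ
  | _, [] => []
  | i, E :: Es => E.tables k i ++ tablesFrom k (i + 1) Es

/-- The encoding of a list of examples without the end mark. -/
noncomputable def encExamples (Es : List (Example τ r)) : Word τ k :=
  Es.flatMap fun E => .tick :: encExample E

theorem readExample_encExample (hr : r ≤ k) (E : Example τ r) (i : ℕ) (w : Word τ k) :
    readExample r i (encExample E ++ w) = some (points k i E.size, E.tables k i, w) := by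
  rw [readExample, encExample_eq E hr, List.append_assoc, readNat_encNat]
  have h := readVals_of_table (k := k) E.size E.table (E.valOK_table rfl) (allKeys k r E.size) w
  simp [h, E.size_pos.ne', Example.tables]

/-- Admissible tables are the tables of an example. -/
theorem exists_example (hr : r ≤ k) {n : ℕ} (hn : 0 < n) (F : Entry τ → ℕ)
    (hF : ∀ e ∈ allKeys k r n, ValOK (isFn e.1) n (F e)) :
    ∃ E : Example τ r, (encExample E : Word τ k) =
      encNat n ++ (allKeys k r n).flatMap fun e => encVal (isFn e.1) (F e) := by
  let E : Example τ r :=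
    { size := n
      size_pos := hn
      str :=
        { funMap := fun {l} f a => ⟨F (some (.inl ⟨l, f⟩), ofNats a), by
            have := hF _ (some_mem_allKeys (s := .inl ⟨l, f⟩) (ofNats_mem_keys a))
            simpa [isFn, ValOK] using this⟩
          RelMap := fun {l} R a => F (some (.inr ⟨l, R⟩), ofNats a) = 1 }
      ans := {a | F (none, ofNats a) = 1} }
  refine ⟨E, ?_⟩
  rw [encExample_eq E hr]
  refine congrArg _ (List.flatMap_congr fun e he => congrArg _ ?_)
  rw [allKeys, keysLE_eq hr] at he
  simp only [List.mem_append, List.mem_flatMap, List.mem_map] at he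
  rcases he with ⟨(⟨l, f⟩ | ⟨l, R⟩), -, t, ht, rfl⟩ | ⟨t, ht, rfl⟩
  · obtain ⟨a, rfl⟩ := exists_ofNats (l := l) ht
    exact E.table_fn f a
  · obtain ⟨a, rfl⟩ := exists_ofNats (l := l) ht
    have h1 := hF _ (some_mem_allKeys (s := .inr ⟨l, R⟩) (ofNats_mem_keys a))
    refine (E.table_rel R a).trans ?_
    simp only [ValOK, isFn, Bool.false_eq_true, if_false] at h1
    by_cases h : F (some (.inr ⟨l, R⟩), ofNats a) = 1
    · exact (if_pos h).trans h.symm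
    · exact (if_neg h).trans (by omega)
  · obtain ⟨a, rfl⟩ := exists_ofNats ht
    have h1 := hF _ (none_mem_allKeys hr (ofNats_mem_keys a))
    refine (E.table_ans a).trans ?_
    simp only [ValOK, isFn, Bool.false_eq_true, if_false] at h1
    by_cases h : F (none, ofNats a) = 1
    · exact (if_pos h).trans h.symm
    · exact (if_neg h).trans (by omega)

theorem readExample_sound (hr : r ≤ k) {i : ℕ} {w : Word τ k}
    {e : List Point × Tables τ × Word τ k} (h : readExample r i w = some e) :
    ∃ E : Example τ r, w = encExample E ++ e.2.2 := by
  obtain ⟨⟨n, u⟩, h1, h2⟩ := Option.bind_eq_some_iff.1 h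
  by_cases hn : n = 0
  · simp [hn] at h2
  · simp only [hn, decide_false, cond_false, Option.map_eq_some_iff] at h2
    obtain ⟨⟨T, v⟩, h2, rfl⟩ := h2
    obtain ⟨F, hF, rfl⟩ := exists_table_of_foldl _ _ (nodup_allKeys hr) _ _ _ _ h2
    obtain ⟨E, hE⟩ := exists_example hr (Nat.pos_of_ne_zero hn) F hF
    exact ⟨E, by rw [hE, readNat_eq_some.1 h1, List.append_assoc]⟩

theorem exState_complete (hr : r ≤ k) (Es : List (Example τ r)) (w : Word τ k) :
    exState r (encExamples Es ++ .mark :: w) =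
      some (Es.length, pointsFrom k 0 Es, tablesFrom k 0 Es, .mark :: w) := by
  have key : ∀ (Es : List (Example τ r)) (m i : ℕ) (P : List Point) (T : Tables τ), Es.length ≤ m →
      (fun s : Option (ℕ × List Point × Tables τ × Word τ k) => s.bind (exStep r))^[m]
        (some (i, P, T, encExamples Es ++ .mark :: w)) =
      some (i + Es.length, P ++ pointsFrom k i Es, T ++ tablesFrom k i Es, .mark :: w) := by
    intro Es m
    induction m generalizing Es with
    | zero =>
      intro i P T h
      obtain rfl : Es = [] := List.eq_nil_of_length_eq_zero (by omega)
      simp [encExamples, pointsFrom, tablesFrom]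
    | succ m ih =>
      intro i P T h
      rw [Function.iterate_succ_apply, Option.bind_some]
      cases Es with
      | nil =>
        have : exStep r (i, P, T, encExamples ([] : List (Example τ r)) ++ Letter.mark :: w) =
            some (i, P, T, encExamples ([] : List (Example τ r)) ++ Letter.mark :: w) := by
          simp [exStep, encExamples]
        rw [this]
        exact ih [] i P T (by simp)
      | cons E Es =>
        have : exStep r (i, P, T, encExamples (E :: Es) ++ Letter.mark :: w) =
            some (i + 1, P ++ points k i E.size, T ++ E.tables k i,
              encExamples Es ++ Letter.mark :: w) := by
          simp only [exStep, encExamples, List.flatMap_cons, List.cons_append, List.head?_cons,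
            decide_true, cond_true, List.tail_cons, List.append_assoc]
          rw [readExample_encExample hr]
          rfl
        simp only [List.length_cons] at h
        rw [this, ih Es _ _ _ (by omega)]
        simp [pointsFrom, tablesFrom]
        omega
  have hlen : ∀ Es : List (Example τ r), Es.length ≤ (encExamples Es : Word τ k).length := by
    intro Es
    induction Es with
    | nil => simp
    | cons E Es ih => simp [encExamples] at ih ⊢; omega
  rw [exState, key Es _ 0 [] [] (by have := hlen Es; simp; omega)]
  simp

theorem exState_sound (hr : r ≤ k) {w : Word τ k} {s : ℕ × List Point × Tables τ × Word τ k}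
    (h : exState r w = some s) : ∃ Es : List (Example τ r), w = encExamples Es ++ s.2.2.2 := by
  have key : ∀ (m : ℕ) (s₀ : ℕ × List Point × Tables τ × Word τ k),
      (fun s : Option (ℕ × List Point × Tables τ × Word τ k) => s.bind (exStep r))^[m]
        (some s₀) = some s →
      ∃ Es : List (Example τ r), s₀.2.2.2 = encExamples Es ++ s.2.2.2 := by
    intro m
    induction m with
    | zero =>
      intro s₀ h
      simp at h
      exact ⟨[], by simp [encExamples, h]⟩
    | succ m ih =>
      intro s₀ h
      rw [Function.iterate_succ_apply, Option.bind_some] at h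
      cases hs : exStep r s₀ with
      | none => rw [hs, bind_iterate_none] at h; simp at h
      | some s₁ =>
        rw [hs] at h
        obtain ⟨Es, hEs⟩ := ih _ h
        obtain ⟨i, P, T, w⟩ := s₀
        by_cases hw : w.head? = some .tick
        · obtain ⟨w, rfl⟩ : ∃ w', w = .tick :: w' := by
            cases w with
            | nil => simp at hw
            | cons a w => exact ⟨w, by simpa using hw⟩
          simp only [exStep, List.head?_cons, decide_true, cond_true, List.tail_cons,
            Option.map_eq_some_iff] at hs
          obtain ⟨e, he, rfl⟩ := hs
          obtain ⟨E, rfl⟩ := readExample_sound hr he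
          refine ⟨E :: Es, ?_⟩
          simp only at hEs
          simp only [hEs]
          simp [encExamples]
        · simp [exStep, hw] at hs
          subst hs
          exact ⟨Es, hEs⟩
  exact key _ _ h

section Complexity

variable {X : Type} [Enc X]

@[fun_prop]
theorem PT.points {i n : X → ℕ} (hi : PT i) (hn : PT n) : PT fun x => points k (i x) (n x) := by
  unfold QuerySynth.points
  fun_prop

@[fun_prop]
theorem PT.readExample {r i : X → ℕ} {w : X → Word τ k} (hr : PT r) (hi : PT i) (hw : PT w) :
    PT fun x => readExample (r x) (i x) (w x) := by
  suffices h : PT fun z : ℕ × ℕ × Word τ k => QuerySynth.readExample z.1 z.2.1 z.2.2 from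
    PT.comp (f := fun x => (r x, i x, w x)) h (by fun_prop)
  have h1 : PT fun z : (ℕ × ℕ × Word τ k) × (ℕ × Word τ k) =>
      (QuerySynth.readVals z.2.1 (QuerySynth.allKeys k z.1.1 z.2.1) z.2.2).map fun v =>
        (QuerySynth.points k z.1.2.1 z.2.1, v.1.map fun x => ((z.1.2.1, x.1), x.2), v.2) := by
    fun_prop
  unfold QuerySynth.readExample
  exact PT.option_bind (by fun_prop) (PT.cond (by fun_prop) (by fun_prop) h1)

theorem readExample_suffix {i : ℕ} {w : Word τ k} {e : List Point × Tables τ × Word τ k}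
    (h : readExample r i w = some e) : e.2.2 <:+ w := by
  obtain ⟨⟨n, u⟩, h1, h2⟩ := Option.bind_eq_some_iff.1 h
  by_cases hn : n = 0
  · simp [hn] at h2
  · simp only [hn, decide_false, cond_false, Option.map_eq_some_iff] at h2
    obtain ⟨⟨T, v⟩, h2, rfl⟩ := h2
    refine List.IsSuffix.trans ?_ (readNat_suffix h1)
    exact foldl_valStep_suffix h2

@[fun_prop]
theorem PT.exState {r : X → ℕ} {w : X → Word τ k} (hr : PT r) (hw : PT w) :
    PT fun x => exState (r x) (w x) := by
  suffices h : PT fun z : ℕ × Word τ k => QuerySynth.exState z.1 z.2 from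
    PT.comp (f := fun x => (r x, w x)) h (by fun_prop)
  unfold QuerySynth.exState
  have h1 : PT fun z : ℕ × ℕ × Word τ k => QuerySynth.readExample z.1 z.2.1 z.2.2 := by fun_prop
  obtain ⟨c, hc⟩ := h1.size_le
  have h2 : PT fun z : (ℕ × Word τ k) × (ℕ × List Point × Tables τ × Word τ k) =>
      exStep z.1.1 z.2 := by
    unfold exStep
    fun_prop
  refine PT.iterate_add
    (f := fun (z : ℕ × Word τ k) (s : Option (ℕ × List Point × Tables τ × Word τ k)) =>
      s.bind (exStep z.1))
    (fun z o => ∀ s, o = some s → s.2.2.2 <:+ z.2 ∧ s.1 + s.2.2.2.length ≤ z.2.length)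
    (C := fun n => (n + (2 * n + 1) + n + 4) ^ c + 2) (by fun_prop) (by fun_prop) ?_
    (PB.add (PB.pow ((((PB.id.add (((PB.const 2).mul PB.id).add (PB.const 1))).add PB.id).add
      (PB.const 4))) c) (PB.const 2)) (by simp) ?_ ?_
  · refine PT.option_bind (by fun_prop) ?_
    exact h2.comp (f := fun z : ((ℕ × Word τ k) × Option (ℕ × List Point × Tables τ × Word τ k)) ×
      (ℕ × List Point × Tables τ × Word τ k) => (z.1.1, z.2)) (by fun_prop)
  · rintro ⟨r, w₀⟩ (_ | ⟨i, P, T, w⟩) h s hs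
    · simp at hs
    · obtain ⟨h1, h2⟩ := h _ rfl
      simp only [Option.bind_some, exStep] at hs h1 h2 ⊢
      by_cases hw : w.head? = some .tick
      · simp only [hw, decide_true, cond_true, Option.map_eq_some_iff] at hs
        obtain ⟨e, he, rfl⟩ := hs
        have h3 := readExample_suffix he
        refine ⟨h3.trans ((List.tail_suffix w).trans h1), ?_⟩
        have h4 := h3.length_le
        cases w with
        | nil => simp at hw
        | cons a w => simp at h2 h4 ⊢; omega
      · simp only [hw, decide_false, cond_false, Option.some.injEq] at hs
        subst hs
        exact ⟨h1, h2⟩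
  · rintro ⟨r, w₀⟩ (_ | ⟨i, P, T, w⟩) h
    · simp
    · obtain ⟨h1, h2⟩ := h _ rfl
      simp only [Option.bind_some, exStep] at h1 h2 ⊢
      by_cases hw : w.head? = some .tick
      · cases he : QuerySynth.readExample r i w.tail with
        | none => simp [hw]; omega
        | some e =>
          obtain ⟨P', T', w'⟩ := e
          have h3 := hc (r, i, w.tail)
          simp only [he, sz_some, sz_pair, sz_nat] at h3
          have h4 := (PT.sz_tail_le w).trans (sz_suffix_le h1)
          have h5 := length_le_sz w₀
          have h6 : (2 * r + 1 + (2 * i + 1 + sz w.tail + 1) + 1 + 2) ^ c ≤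
              (sz (r, w₀) + (2 * sz (r, w₀) + 1) + sz (r, w₀) + 4) ^ c := by
            refine Nat.pow_le_pow_left ?_ c
            simp
            omega
          have h7 := sz_append P P'
          have h8 := sz_append T T'
          have h9 := sz_pos w
          have h10 := sz_pos P
          simp only [hw, decide_true, cond_true, Option.map_some, sz_some, sz_pair, sz_nat]
            at h3 h6 ⊢
          omega
      · simp [hw]

end Complexity

end Examples

/-! ### Reading grammars and inputs -/

theorem readTrees_suffix {q : ℕ} {w r : Word τ k} (h : readTrees q 1 w = some r) : r <:+ w := by
  obtain ⟨t, rfl⟩ := readTrees_sound h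
  exact List.suffix_append _ _

/-- Read one further rule, if there is one. The right-hand side of a rule is represented by the
suffix of the input at which it starts. -/
noncomputable def ruleStep (q : ℕ) (s : List (ℕ × Word τ k) × Word τ k) :
    Option (List (ℕ × Word τ k) × Word τ k) :=
  bif decide (s.2.head? = some .tick) then
    (readNat s.2.tail).bind fun e => bif decide (e.1 < q) then
      (readTrees q 1 e.2).map fun r => (s.1 ++ [(e.1, e.2)], r) else none
  else some s

/-- The state after as many steps as the word has letters: the rules and the rest of the word. -/
noncomputable def ruleState (q : ℕ) (w : Word τ k) : Option (List (ℕ × Word τ k) × Word τ k) :=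
  (fun s : Option (List (ℕ × Word τ k) × Word τ k) => s.bind (ruleStep q))^[w.length]
    (some ([], w))

/-- The rules as they occur in an encoded grammar, which is followed by the word `r`. -/
def rulesOf {q : ℕ} (r : Word τ k) : List (Fin q × Tree τ k (Fin q)) → List (ℕ × Word τ k)
  | [] => []
  | p :: ps => ((p.1 : ℕ), encTree p.2 ++
      (ps.flatMap (fun p => .tick :: (encNat p.1 ++ encTree p.2)) ++ r)) :: rulesOf r ps

theorem mem_rulesOf {q : ℕ} {r : Word τ k} {ps : List (Fin q × Tree τ k (Fin q))} {B : ℕ}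
    {w : Word τ k} (h : (B, w) ∈ rulesOf r ps) : ∃ p ∈ ps, B = p.1 ∧ ∃ u, w = encTree p.2 ++ u := by
  induction ps with
  | nil => simp [rulesOf] at h
  | cons p ps ih =>
    rcases List.mem_cons.1 h with h | h
    · simp only [Prod.mk.injEq] at h
      exact ⟨p, by simp, h.1, _, h.2⟩
    · obtain ⟨p', hp, h⟩ := ih h
      exact ⟨p', by simp [hp], h⟩

theorem exists_mem_rulesOf {q : ℕ} {r : Word τ k} {ps : List (Fin q × Tree τ k (Fin q))}
    {p : Fin q × Tree τ k (Fin q)} (h : p ∈ ps) :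
    ∃ u, ((p.1 : ℕ), encTree p.2 ++ u) ∈ rulesOf r ps := by
  induction ps with
  | nil => simp at h
  | cons p' ps ih =>
    rcases List.mem_cons.1 h with rfl | h
    · exact ⟨_, List.mem_cons_self⟩
    · obtain ⟨u, hu⟩ := ih h
      exact ⟨u, List.mem_cons_of_mem _ hu⟩

theorem suffix_of_mem_rulesOf {q : ℕ} {r : Word τ k} {ps : List (Fin q × Tree τ k (Fin q))}
    {p : ℕ × Word τ k} (h : p ∈ rulesOf r ps) :
    p.2 <:+ ps.flatMap (fun p => .tick :: (encNat p.1 ++ encTree p.2)) ++ r := by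
  induction ps with
  | nil => simp [rulesOf] at h
  | cons p' ps ih =>
    rcases List.mem_cons.1 h with rfl | h
    · exact ⟨.tick :: encNat p'.1, by simp⟩
    · refine (ih h).trans ⟨.tick :: (encNat p'.1 ++ encTree p'.2), by simp⟩

theorem ruleState_complete {q : ℕ} (ps : List (Fin q × Tree τ k (Fin q))) (w : Word τ k) :
    ruleState q (ps.flatMap (fun p => .tick :: (encNat p.1 ++ encTree p.2)) ++ .mark :: w) =
      some (rulesOf (.mark :: w) ps, .mark :: w) := by
  have key : ∀ (m : ℕ) (ps : List (Fin q × Tree τ k (Fin q))) (R : List (ℕ × Word τ k)),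
      ps.length ≤ m →
      (fun s : Option (List (ℕ × Word τ k) × Word τ k) => s.bind (ruleStep q))^[m]
        (some (R, ps.flatMap (fun p => .tick :: (encNat p.1 ++ encTree p.2)) ++ .mark :: w)) =
      some (R ++ rulesOf (.mark :: w) ps, .mark :: w) := by
    intro m
    induction m with
    | zero =>
      intro ps R h
      obtain rfl : ps = [] := List.eq_nil_of_length_eq_zero (by omega)
      simp [rulesOf]
    | succ m ih =>
      intro ps R h
      rw [Function.iterate_succ_apply, Option.bind_some]
      cases ps with
      | nil =>
        have : ruleStep q (R, Letter.mark :: w) = some (R, Letter.mark :: w) := by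
          simp [ruleStep]
        simp only [List.flatMap_nil, List.nil_append, this]
        exact ih [] R (by simp)
      | cons p ps =>
        have : ruleStep q (R, (p :: ps).flatMap (fun p => Letter.tick ::
            (encNat p.1 ++ encTree p.2)) ++ .mark :: w) =
            some (R ++ [((p.1 : ℕ), encTree p.2 ++ (ps.flatMap (fun p => Letter.tick ::
            (encNat p.1 ++ encTree p.2)) ++ .mark :: w))], ps.flatMap (fun p => Letter.tick ::
            (encNat p.1 ++ encTree p.2)) ++ .mark :: w) := by
          simp [ruleStep, readNat_encNat, readTrees_encTree]
        simp only [List.length_cons] at h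
        rw [this, ih ps _ (by omega)]
        simp [rulesOf]
  rw [ruleState, key _ ps [] ?_]
  · simp
  · rw [List.length_append]
    refine Nat.le_add_right_of_le ?_
    clear key
    induction ps with
    | nil => simp
    | cons p ps ih => simp at ih ⊢; omega

theorem ruleState_sound {q : ℕ} {w : Word τ k} {s : List (ℕ × Word τ k) × Word τ k}
    (h : ruleState q w = some s) : ∃ ps : List (Fin q × Tree τ k (Fin q)),
      w = ps.flatMap (fun p => .tick :: (encNat p.1 ++ encTree p.2)) ++ s.2 := by
  have key : ∀ (m : ℕ) (s₀ : List (ℕ × Word τ k) × Word τ k),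
      (fun s : Option (List (ℕ × Word τ k) × Word τ k) => s.bind (ruleStep q))^[m]
        (some s₀) = some s →
      ∃ ps : List (Fin q × Tree τ k (Fin q)),
        s₀.2 = ps.flatMap (fun p => .tick :: (encNat p.1 ++ encTree p.2)) ++ s.2 := by
    intro m
    induction m with
    | zero =>
      intro s₀ h
      simp at h
      exact ⟨[], by simp [h]⟩
    | succ m ih =>
      intro s₀ h
      rw [Function.iterate_succ_apply, Option.bind_some] at h
      cases hs : ruleStep q s₀ with
      | none => rw [hs, bind_iterate_none] at h; simp at h
      | some s₁ =>
        rw [hs] at h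
        obtain ⟨ps, hps⟩ := ih _ h
        obtain ⟨R, w⟩ := s₀
        by_cases hw : w.head? = some .tick
        · obtain ⟨w, rfl⟩ : ∃ w', w = .tick :: w' := by
            cases w with
            | nil => simp at hw
            | cons a w => exact ⟨w, by simpa using hw⟩
          simp only [ruleStep, List.head?_cons, decide_true, cond_true, List.tail_cons,
            Option.bind_eq_some_iff] at hs
          obtain ⟨⟨B, u⟩, he, hs⟩ := hs
          by_cases hB : B < q
          · simp only [hB, decide_true, cond_true, Option.map_eq_some_iff] at hs
            obtain ⟨r, hr, rfl⟩ := hs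
            obtain ⟨t, rfl⟩ := readTrees_sound hr
            refine ⟨(⟨B, hB⟩, t) :: ps, ?_⟩
            simp only at hps
            simp [readNat_eq_some.1 he, hps]
          · simp [hB] at hs
        · simp [ruleStep, hw] at hs
          subst hs
          exact ⟨ps, hps⟩
  exact key _ _ h

/-- The data extracted from an input: the answer arity, the points and the tables of the examples,
the number of nonterminals, the axiom followed by the encoded rules, and the rules. -/
structure Env (τ : FirstOrder.Language.{0, 0}) (k : ℕ) : Type where
  r : ℕ
  pts : List Point
  tbl : Tables τ
  q : ℕ
  start : Word τ k
  rules : List (ℕ × Word τ k)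

section Parse

variable [Fintype τ.Symbols]

/-- The data extracted from a given input. -/
noncomputable def envOf (I : Input τ k) : Env τ k where
  r := I.r
  pts := pointsFrom k 0 I.examples
  tbl := tablesFrom k 0 I.examples
  q := I.grammar.numNT
  start := encNat I.grammar.start ++
    encList (fun p => encNat p.1 ++ encTree p.2) I.grammar.rules
  rules := rulesOf [.mark] I.grammar.rules

/-- Read a grammar, given the answer arity, the points and the tables. -/
noncomputable def parseGrammar (r : ℕ) (P : List Point) (T : Tables τ) (w : Word τ k) :
    Option (Env τ k) :=
  (readNat w).bind fun q => (readNat q.2).bind fun s => bif decide (s.1 < q.1) then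
    (ruleState q.1 s.2).bind fun R => bif decide (R.2 = [.mark]) then
      some ⟨r, P, T, q.1, q.2, R.1⟩ else none else none

/-- Read an input. -/
noncomputable def parse (w : Word τ k) : Option (Env τ k) :=
  (readNat w).bind fun r => bif decide (r.1 < k + 1) then
    (exState r.1 r.2).bind fun e => bif decide (e.2.2.2.head? = some .mark) then
      parseGrammar r.1 e.2.1 e.2.2.1 e.2.2.2.tail else none else none

theorem encList_encExample {r : ℕ} (Es : List (Example τ r)) :
    (encList encExample Es : Word τ k) = encExamples Es ++ [.mark] := rfl

theorem parse_encInput (I : Input τ k) : parse (encInput I) = some (envOf I) := by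
  have h1 := exState_complete I.r_le I.examples (encGrammar I.grammar)
  have h2 := ruleState_complete (k := k) I.grammar.rules []
  rw [parse, encInput, List.append_assoc, readNat_encNat, encList_encExample, List.append_assoc,
    List.singleton_append]
  simp only [Option.bind_some, Nat.lt_succ_of_le I.r_le, decide_true, cond_true, h1,
    List.head?_cons, List.tail_cons]
  rw [parseGrammar, encGrammar, List.append_assoc, readNat_encNat]
  simp only [Option.bind_some, readNat_encNat, I.grammar.start.2, decide_true, cond_true]
  rw [encList, h2]
  simp [envOf, encList]

theorem parse_sound {w : Word τ k} {env : Env τ k} (h : parse w = some env) :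
    ∃ I : Input τ k, encInput I = w := by
  obtain ⟨⟨r, u⟩, h1, h⟩ := Option.bind_eq_some_iff.1 h
  by_cases hr : r < k + 1
  swap
  · simp [hr] at h
  simp only [hr, decide_true, cond_true] at h
  obtain ⟨⟨i, P, T, v⟩, h2, h⟩ := Option.bind_eq_some_iff.1 h
  have hr := Nat.le_of_lt_succ hr
  obtain ⟨Es, hEs⟩ := exState_sound hr h2
  by_cases hv : v.head? = some .mark
  swap
  · simp [hv] at h
  obtain ⟨v, rfl⟩ : ∃ v', v = .mark :: v' := by
    cases v with
    | nil => simp at hv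
    | cons a v => exact ⟨v, by simpa using hv⟩
  simp only [List.head?_cons, decide_true, cond_true, List.tail_cons] at h
  obtain ⟨⟨q, x⟩, h3, h⟩ := Option.bind_eq_some_iff.1 h
  obtain ⟨⟨s, y⟩, h4, h⟩ := Option.bind_eq_some_iff.1 h
  by_cases hs : s < q
  swap
  · simp [hs] at h
  simp only [hs, decide_true, cond_true] at h
  obtain ⟨⟨R, z⟩, h5, h⟩ := Option.bind_eq_some_iff.1 h
  by_cases hz : z = [.mark]
  swap
  · simp [hz] at h
  subst hz
  obtain ⟨ps, rfl⟩ := ruleState_sound h5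
  refine ⟨⟨r, hr, Es, ⟨q, ⟨s, hs⟩, ps⟩⟩, ?_⟩
  simp only [readNat_eq_some] at h1 h3 h4
  simp [encInput, h1, hEs, h3, h4, encExamples, encGrammar, encList]

end Parse

section Complexity

variable [Fintype τ.Symbols] {X : Type} [Enc X]

noncomputable instance : Enc (Env τ k) where
  enc e := enc (e.r, e.pts, e.tbl, e.q, e.start, e.rules)
  inj := by
    rintro ⟨_, _, _, _, _, _⟩ ⟨_, _, _, _, _, _⟩ h
    have := Enc.inj h
    simp only [Prod.mk.injEq] at this
    simp [this]

theorem sz_env (e : Env τ k) : sz e = sz (e.r, e.pts, e.tbl, e.q, e.start, e.rules) := rfl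

theorem PT.env_tuple {e : X → Env τ k} (he : PT e) :
    PT fun x => ((e x).r, (e x).pts, (e x).tbl, (e x).q, (e x).start, (e x).rules) :=
  he.congr_enc fun _ => rfl

@[fun_prop]
theorem PT.env_r {e : X → Env τ k} (he : PT e) : PT fun x => (e x).r := he.env_tuple.fst

@[fun_prop]
theorem PT.env_pts {e : X → Env τ k} (he : PT e) : PT fun x => (e x).pts := he.env_tuple.snd.fst

@[fun_prop]
theorem PT.env_tbl {e : X → Env τ k} (he : PT e) : PT fun x => (e x).tbl :=
  he.env_tuple.snd.snd.fst

@[fun_prop]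
theorem PT.env_q {e : X → Env τ k} (he : PT e) : PT fun x => (e x).q :=
  he.env_tuple.snd.snd.snd.fst

@[fun_prop]
theorem PT.env_start {e : X → Env τ k} (he : PT e) : PT fun x => (e x).start :=
  he.env_tuple.snd.snd.snd.snd.fst

@[fun_prop]
theorem PT.env_rules {e : X → Env τ k} (he : PT e) : PT fun x => (e x).rules :=
  he.env_tuple.snd.snd.snd.snd.snd

@[fun_prop]
theorem PT.env_mk {r q : X → ℕ} {P : X → List Point} {T : X → Tables τ} {s : X → Word τ k}
    {R : X → List (ℕ × Word τ k)} (hr : PT r) (hP : PT P) (hT : PT T) (hq : PT q) (hs : PT s)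
    (hR : PT R) : PT fun x => (⟨r x, P x, T x, q x, s x, R x⟩ : Env τ k) :=
  (hr.pair (hP.pair (hT.pair (hq.pair (hs.pair hR))))).congr_enc fun _ => rfl

@[fun_prop]
theorem PT.ruleState {q : X → ℕ} {w : X → Word τ k} (hq : PT q) (hw : PT w) :
    PT fun x => ruleState (q x) (w x) := by
  suffices h : PT fun z : ℕ × Word τ k => QuerySynth.ruleState z.1 z.2 from
    PT.comp (f := fun x => (q x, w x)) h (by fun_prop)
  unfold QuerySynth.ruleState
  have h2 : PT fun z : (ℕ × Word τ k) × (List (ℕ × Word τ k) × Word τ k) =>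
      ruleStep z.1.1 z.2 := by
    have h3 : PT fun z : ((ℕ × Word τ k) × (List (ℕ × Word τ k) × Word τ k)) × (ℕ × Word τ k) =>
        (QuerySynth.readTrees z.1.1.1 1 z.2.2).map fun r => (z.1.2.1 ++ [(z.2.1, z.2.2)], r) := by
      fun_prop
    have h4 : PT fun z : (ℕ × Word τ k) × (List (ℕ × Word τ k) × Word τ k) =>
        (QuerySynth.readNat z.2.2.tail).bind fun e => bif decide (e.1 < z.1.1) then
          (QuerySynth.readTrees z.1.1 1 e.2).map fun r => (z.2.1 ++ [(e.1, e.2)], r) else none :=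
      PT.option_bind (by fun_prop) (PT.cond (by fun_prop) h3 (by fun_prop))
    unfold ruleStep
    exact PT.cond (by fun_prop) h4 (by fun_prop)
  refine PT.iterate_add
    (f := fun (z : ℕ × Word τ k) (s : Option (List (ℕ × Word τ k) × Word τ k)) =>
      s.bind (ruleStep z.1))
    (fun z o => ∀ s, o = some s → s.2 <:+ z.2)
    (C := fun n => 3 * n + 4) (by fun_prop) (by fun_prop) ?_
    (((PB.const 3).mul PB.id).add (PB.const 4)) (by simp) ?_ ?_
  · refine PT.option_bind (by fun_prop) ?_
    exact h2.comp (f := fun z : ((ℕ × Word τ k) × Option (List (ℕ × Word τ k) × Word τ k)) ×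
      (List (ℕ × Word τ k) × Word τ k) => (z.1.1, z.2)) (by fun_prop)
  · rintro ⟨q, w₀⟩ (_ | ⟨R, w⟩) h s hs
    · simp at hs
    · have h1 := h _ rfl
      simp only [Option.bind_some, ruleStep] at hs h1 ⊢
      by_cases hw : w.head? = some .tick
      · simp only [hw, decide_true, cond_true, Option.bind_eq_some_iff] at hs
        obtain ⟨⟨B, u⟩, he, hs⟩ := hs
        by_cases hB : B < q
        · simp only [hB, decide_true, cond_true, Option.map_eq_some_iff] at hs
          obtain ⟨r, hr, rfl⟩ := hs
          exact (readTrees_suffix hr).trans ((readNat_suffix he).trans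
            ((List.tail_suffix w).trans h1))
        · simp [hB] at hs
      · simp only [hw, decide_false, cond_false, Option.some.injEq] at hs
        subst hs
        exact h1
  · rintro ⟨q, w₀⟩ (_ | ⟨R, w⟩) h
    · simp
    · have h1 := h _ rfl
      simp only [Option.bind_some, ruleStep] at h1 ⊢
      have hp := sz_pos w
      have hp' := sz_pos R
      by_cases hw : w.head? = some .tick
      · cases he : QuerySynth.readNat w.tail with
        | none => simp [hw]; omega
        | some e =>
          obtain ⟨B, u⟩ := e
          by_cases hB : B < q
          · cases hr : QuerySynth.readTrees q 1 u with
            | none => simp [hw, hB, hr]; omega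
            | some r =>
              have h2 := sz_encNat_ge B u
              rw [← readNat_eq_some.1 he] at h2
              have h3 := sz_suffix_le (readTrees_suffix hr)
              have h4 := (PT.sz_tail_le w).trans (sz_suffix_le h1)
              have h5 := sz_append R [(B, u)]
              simp [hw, hB, hr] at h5 ⊢
              omega
          · simp [hw, hB]; omega
      · simp [hw]

theorem PT.parseGrammar {r : X → ℕ} {P : X → List Point} {T : X → Tables τ} {w : X → Word τ k}
    (hr : PT r) (hP : PT P) (hT : PT T) (hw : PT w) :
    PT fun x => parseGrammar (r x) (P x) (T x) (w x) := by
  have h1 : PT fun z : ((X × (ℕ × Word τ k)) × (ℕ × Word τ k)) × (List (ℕ × Word τ k) × Word τ k) =>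
      (bif decide (z.2.2 = [.mark]) then
        some ⟨r z.1.1.1, P z.1.1.1, T z.1.1.1, z.1.1.2.1, z.1.1.2.2, z.2.1⟩ else none :
        Option (Env τ k)) := by
    fun_prop
  unfold QuerySynth.parseGrammar
  exact PT.option_bind (by fun_prop) (PT.option_bind (by fun_prop)
    (PT.cond (by fun_prop) (PT.option_bind (by fun_prop) h1) (by fun_prop)))

attribute [fun_prop] PT.parseGrammar

@[fun_prop]
theorem PT.parse {w : X → Word τ k} (hw : PT w) : PT fun x => parse (w x) := by
  unfold QuerySynth.parse
  refine PT.option_bind (by fun_prop) (PT.cond (by fun_prop) (PT.option_bind (by fun_prop)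
    (PT.cond (by fun_prop) ?_ (by fun_prop))) (by fun_prop))
  fun_prop

end Complexity

/-! ### The behaviour of a compound expression -/

/-- What the algorithm knows about an expression: whether it is a formula, its free variables, and
its value at each point (the truth values are the numbers `1` and `0`). -/
structure Beh (k : ℕ) : Type where
  form : Bool
  fv : Finset (Fin k)
  val : List (Point × ℕ)

/-- The sorts of the arguments of a symbol; `true` is the sort of formulas. -/
def Sym.argForm : Sym τ k → List Bool
  | @Sym.rel _ _ l _ => List.replicate l false
  | @Sym.fn _ _ l _ => List.replicate l false
  | .ite => [true, false, false]
  | .and => [true, true]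
  | .or => [true, true]
  | .not => [true]
  | .all _ => [true]
  | .ex _ => [true]
  | .var _ => []

/-- The sort of the expressions with a given root symbol. -/
def Sym.isForm : Sym τ k → Bool
  | .fn _ => false
  | .ite => false
  | .var _ => false
  | _ => true

/-- The free variables of an expression, as a function of those of its immediate
subexpressions. -/
def Sym.opFv : Sym τ k → Finset (Fin k) → Finset (Fin k)
  | .all x, s => s.erase x
  | .ex x, s => s.erase x
  | .var x, _ => {x}
  | _, s => s

/-- A truth value as a number. -/
def ofB (b : Bool) : ℕ := bif b then 1 else 0

/-- The value of an expression at a point, as a function of the values of its immediate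
subexpressions at all points. -/
noncomputable def Sym.opVal (T : Tables τ) :
    Sym τ k → List (List (Point × ℕ)) → Point → ℕ
  | @Sym.rel _ _ l R, vs, p => look T ((p.1, some (.inr ⟨l, R⟩), vs.map fun v => look v p))
  | @Sym.fn _ _ l f, vs, p => look T ((p.1, some (.inl ⟨l, f⟩), vs.map fun v => look v p))
  | .ite, vs, p => bif decide (look (vs.getD 0 []) p = 1) then look (vs.getD 1 []) p
      else look (vs.getD 2 []) p
  | .and, vs, p =>
      ofB (decide (look (vs.getD 0 []) p = 1) && decide (look (vs.getD 1 []) p = 1))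
  | .or, vs, p =>
      ofB (decide (look (vs.getD 0 []) p = 1) || decide (look (vs.getD 1 []) p = 1))
  | .not, vs, p => ofB (!decide (look (vs.getD 0 []) p = 1))
  | .all x, vs, p => ofB ((List.range p.2.1).all fun a =>
      decide (look (vs.getD 0 []) (p.1, p.2.1, p.2.2.set x a) = 1))
  | .ex x, vs, p => ofB ((List.range p.2.1).any fun a =>
      decide (look (vs.getD 0 []) (p.1, p.2.1, p.2.2.set x a) = 1))
  | .var x, _, p => p.2.2.getD x 0

/-- The behaviour of an expression, as a function of the behaviours of its immediate
subexpressions; there is none if the sorts do not match. -/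
noncomputable def opBeh (P : List Point) (T : Tables τ) (a : Sym τ k) (bs : List (Beh k)) :
    Option (Beh k) :=
  bif decide (bs.map Beh.form = a.argForm) then
    some ⟨a.isForm, a.opFv (bs.foldl (fun s b => s ∪ b.fv) ∅),
      P.map fun p => (p, a.opVal T (bs.map Beh.val) p)⟩
  else none

/-! ### Facts and inference -/

/-- A fact states that a tree with a given behaviour can be derived from a state. The states are
the suffixes of the encoded grammar, so that a state denotes the tree that it starts with. A fact
carries its own index in the list of all facts, the root symbol of the tree, and the indices of
the facts for its immediate subtrees. -/
structure Fact (τ : FirstOrder.Language.{0, 0}) (k : ℕ) : Type where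
  idx : ℕ
  state : Word τ k
  beh : Beh k
  sym : Sym τ k
  refs : List ℕ

/-- What is determined by a fact apart from its index and its provenance. -/
def Fact.key (f : Fact τ k) : Word τ k × Beh k := (f.state, f.beh)

section Algorithm

variable [Fintype τ.Symbols]

noncomputable instance : Enc (Beh k) where
  enc b :=
    let _ : Enc (Finset (Fin k)) := Enc.ofFinite _
    enc (b.form, b.fv, b.val)
  inj := by
    let _ : Enc (Finset (Fin k)) := Enc.ofFinite _
    rintro ⟨_, _, _⟩ ⟨_, _, _⟩ h
    have := Enc.inj h
    simp only [Prod.mk.injEq] at this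
    simp [this]

noncomputable instance : Enc (Fact τ k) where
  enc f := enc (f.idx, f.state, f.beh, f.sym, f.refs)
  inj := by
    rintro ⟨_, _, _, _, _⟩ ⟨_, _, _, _, _⟩ h
    have := Enc.inj h
    simp only [Prod.mk.injEq] at this
    simp [this]

noncomputable instance : DecidableEq (Beh k) := Classical.decEq _

/-- All suffixes of the encoded grammar. -/
def Env.states (e : Env τ k) : List (Word τ k) :=
  (List.range (e.start.length + 1)).map fun i => e.start.drop i

/-- Check that the states of the facts in a list are those of the first trees in a sequence of
trees. -/
noncomputable def chain (q : ℕ) (w : Word τ k) (fs : List (Fact τ k)) : Option (Word τ k) :=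
  fs.foldl (fun o f => o.bind fun u => bif decide (f.state = u) then readTrees q 1 u else none)
    (some w)

/-- The symbol which a letter stands for. -/
def letterSym : Letter τ k → Option (Sym τ k)
  | .sym a => some a
  | _ => none

/-- The conclusion drawn for the state `w` from the facts in the list `fs`. For a state starting
with a symbol, these are facts about the children; for a nonterminal, it is one fact about the
right-hand side of a rule. -/
noncomputable def infer (e : Env τ k) (w : Word τ k) (fs : List (Fact τ k)) :
    Option (Beh k × Sym τ k × List ℕ) :=
  (w.head?.bind letterSym).elim
    ((readNat w).bind fun B => fs.head?.bind fun f =>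
      bif (e.rules.any fun p => decide (p = (B.1, f.state))) then some (f.beh, f.sym, f.refs)
      else none)
    fun a => bif decide (fs.length = a.arity) && (chain e.q w.tail fs).isSome then
      (opBeh e.pts e.tbl a (fs.map Fact.beh)).map fun b => (b, a, fs.map Fact.idx) else none

/-- A number which exceeds all arities and is positive. -/
noncomputable def maxArity (τ : FirstOrder.Language.{0, 0}) [Fintype τ.Symbols] : ℕ :=
  (Finset.univ : Finset τ.Symbols).sup symAr + 3

theorem arity_le_maxArity (a : Sym τ k) : a.arity ≤ maxArity τ := by
  have h : ∀ s : τ.Symbols, symAr s ≤ (Finset.univ : Finset τ.Symbols).sup symAr :=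
    fun s => Finset.le_sup (Finset.mem_univ s)
  unfold maxArity
  cases a with
  | rel R => exact (h (.inr ⟨_, R⟩)).trans (by omega)
  | fn f => exact (h (.inl ⟨_, f⟩)).trans (by omega)
  | _ => simp only [Sym.arity]; omega

/-- A fact which follows from the given facts and has a new key. -/
noncomputable def newFact (e : Env τ k) (F : List (Fact τ k)) : Option (Fact τ k) :=
  e.states.findSome? fun w => (tuplesLE (maxArity τ) F).findSome? fun fs =>
    (infer e w fs).bind fun x => bif (F.any fun f => decide (f.key = (w, x.1))) then none
      else some ⟨F.length, w, x.1, x.2.1, x.2.2⟩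

/-- Add a new fact, if there is one; the flag tells whether there was one. -/
noncomputable def satStep (z : Bool × Env τ k × List (Fact τ k)) :
    Bool × Env τ k × List (Fact τ k) :=
  (newFact z.2.1 z.2.2).elim (false, z.2.1, z.2.2) fun f => (true, z.2.1, z.2.2 ++ [f])

/-- Whether a fact describes a solution. -/
noncomputable def Fact.isSolution (e : Env τ k) (f : Fact τ k) : Bool :=
  f.beh.form && decide (f.state = e.start) &&
    ((List.finRange k).all fun x => decide (decide (x ∈ f.beh.fv) = decide ((x : ℕ) < e.r))) &&
    e.pts.all fun p => decide (decide (look f.beh.val p = 1) =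
      decide (look e.tbl (p.1, none, p.2.2.take e.r) = 1))

/-- The output, as a word. -/
noncomputable def outWord (e : Env τ k) (F : List (Fact τ k)) : Word τ k :=
  (F.find? (Fact.isSolution e)).elim [.bit false] fun f =>
    .bit true :: (F.flatMap fun g => .tick :: .sym g.sym :: g.refs.flatMap encNat) ++
      (.mark :: encNat f.idx)

/-! ### The complexity of inference -/

variable {X : Type} [Enc X]

theorem sz_beh (b : Beh k) : sz b = sz b.form + (sz b.fv + sz b.val + 1) + 1 := by
  let _ : Enc (Finset (Fin k)) := Enc.ofFinite _
  exact rfl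

theorem sz_fact (f : Fact τ k) : sz f = sz (f.idx, f.state, f.beh, f.sym, f.refs) := rfl

theorem PT.beh_tuple {b : X → Beh k} (hb : PT b) :
    PT fun x => ((b x).form, (b x).fv, (b x).val) := hb.congr_enc fun _ => rfl

@[fun_prop]
theorem PT.beh_form {b : X → Beh k} (hb : PT b) : PT fun x => (b x).form := hb.beh_tuple.fst

@[fun_prop]
theorem PT.beh_fv {b : X → Beh k} (hb : PT b) : PT fun x => (b x).fv := hb.beh_tuple.snd.fst

@[fun_prop]
theorem PT.beh_val {b : X → Beh k} (hb : PT b) : PT fun x => (b x).val := hb.beh_tuple.snd.snd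

@[fun_prop]
theorem PT.beh_mk {s : X → Bool} {fv : X → Finset (Fin k)} {v : X → List (Point × ℕ)}
    (hs : PT s) (hfv : PT fv) (hv : PT v) : PT fun x => (⟨s x, fv x, v x⟩ : Beh k) :=
  (hs.pair (hfv.pair hv)).congr_enc fun _ => rfl

theorem PT.fact_tuple {f : X → Fact τ k} (hf : PT f) :
    PT fun x => ((f x).idx, (f x).state, (f x).beh, (f x).sym, (f x).refs) :=
  hf.congr_enc fun _ => rfl

@[fun_prop]
theorem PT.fact_idx {f : X → Fact τ k} (hf : PT f) : PT fun x => (f x).idx := hf.fact_tuple.fst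

@[fun_prop]
theorem PT.fact_state {f : X → Fact τ k} (hf : PT f) : PT fun x => (f x).state :=
  hf.fact_tuple.snd.fst

@[fun_prop]
theorem PT.fact_beh {f : X → Fact τ k} (hf : PT f) : PT fun x => (f x).beh :=
  hf.fact_tuple.snd.snd.fst

@[fun_prop]
theorem PT.fact_sym {f : X → Fact τ k} (hf : PT f) : PT fun x => (f x).sym :=
  hf.fact_tuple.snd.snd.snd.fst

@[fun_prop]
theorem PT.fact_refs {f : X → Fact τ k} (hf : PT f) : PT fun x => (f x).refs :=
  hf.fact_tuple.snd.snd.snd.snd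

@[fun_prop]
theorem PT.fact_key {f : X → Fact τ k} (hf : PT f) : PT fun x => (f x).key :=
  hf.fact_state.pair hf.fact_beh

@[fun_prop]
theorem PT.fact_mk {i : X → ℕ} {w : X → Word τ k} {b : X → Beh k} {a : X → Sym τ k}
    {r : X → List ℕ} (hi : PT i) (hw : PT w) (hb : PT b) (ha : PT a) (hr : PT r) :
    PT fun x => (⟨i x, w x, b x, a x, r x⟩ : Fact τ k) :=
  (hi.pair (hw.pair (hb.pair (ha.pair hr)))).congr_enc fun _ => rfl

@[fun_prop]
theorem PT.set {α : Type} [Enc α] (n : ℕ) {l : X → List α} {a : X → α} (hl : PT l) (ha : PT a) :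
    PT fun x => (l x).set n (a x) := by
  suffices h : PT fun z : List α × α => z.1.set n z.2 from
    PT.comp (f := fun x => (l x, a x)) h (by fun_prop)
  clear hl ha l a
  induction n with
  | zero =>
    refine (PT.list_cases (l := fun z : List α × α => z.1) (by fun_prop) (PT.const [])
      (g := fun z _ t => z.2 :: t) (by fun_prop)).congr_enc fun z => congrArg enc ?_
    obtain ⟨_ | ⟨b, t⟩, a⟩ := z <;> rfl
  | succ n ih =>
    have h : PT fun z : (List α × α) × α × List α => z.2.1 :: z.2.2.set n z.1.2 :=
      PT.list_cons (by fun_prop)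
        (ih.comp (f := fun z : (List α × α) × α × List α => (z.2.2, z.1.2)) (by fun_prop))
    refine (PT.list_cases (l := fun z : List α × α => z.1) (by fun_prop) (PT.const [])
      (g := fun z b t => b :: t.set n z.2) h).congr_enc fun z => congrArg enc ?_
    obtain ⟨_ | ⟨b, t⟩, a⟩ := z <;> rfl

@[fun_prop]
theorem PT.take {α : Type} [Enc α] {n : X → ℕ} {l : X → List α} (hn : PT n) (hl : PT l) :
    PT fun x => (l x).take (n x) := by
  have : PT fun x => (List.range (n x)).flatMap fun i => ((l x).drop i).head?.toList := by
    fun_prop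
  refine this.congr_enc fun x => congrArg enc ?_
  generalize l x = l
  induction n x with
  | zero => simp
  | succ n ih => rw [List.range_succ, List.flatMap_append, ← ih, List.take_add_one]; simp

@[fun_prop]
theorem PT.ofB {b : X → Bool} (hb : PT b) : PT fun x => ofB (b x) :=
  PT.of_finite QuerySynth.ofB hb

@[fun_prop]
theorem PT.opVal {T : X → Tables τ} {a : X → Sym τ k} {vs : X → List (List (Point × ℕ))}
    {p : X → Point} (hT : PT T) (ha : PT a) (hvs : PT vs) (hp : PT p) :
    PT fun x => (a x).opVal (T x) (vs x) (p x) := by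
  refine PT.finite_cases' (F := fun a x => a.opVal (T x) (vs x) (p x)) (fun a => ?_) ha
  cases a <;> simp only [Sym.opVal] <;> fun_prop

@[fun_prop]
theorem PT.opBeh {P : X → List Point} {T : X → Tables τ} {a : X → Sym τ k}
    {bs : X → List (Beh k)} (hP : PT P) (hT : PT T) (ha : PT a) (hbs : PT bs) :
    PT fun x => opBeh (P x) (T x) (a x) (bs x) := by
  have h1 : PT fun x => (a x).argForm := PT.of_finite Sym.argForm ha
  have h2 : PT fun x => (a x).isForm := PT.of_finite Sym.isForm ha
  obtain ⟨C, hC⟩ := PT.sz_bounded_of_finite (Finset (Fin k))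
  have h3 : PT fun z : Finset (Fin k) × Finset (Fin k) => z.1 ∪ z.2 :=
    PT.finite_cases (F := fun s t => s ∪ t) fun s => PT.of_finite (fun t => s ∪ t) .id
  have h4 : PT fun x => (bs x).foldl (fun s b => s ∪ b.fv) ∅ := by
    refine PT.foldl_add (f := fun _ s (b : Beh k) => s ∪ b.fv) (C := fun _ => C) hbs
      (PT.const _) ?_ (PB.const _) fun _ _ _ _ => (hC _).trans (by omega)
    exact h3.comp (f := fun z : X × Finset (Fin k) × Beh k => (z.2.1, z.2.2.fv)) (by fun_prop)
  have h5 : PT fun z : Sym τ k × Finset (Fin k) => z.1.opFv z.2 :=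
    PT.finite_cases (F := fun a s => Sym.opFv a s) fun a => PT.of_finite (Sym.opFv a) .id
  have h6 := h5.comp (ha.pair h4)
  unfold QuerySynth.opBeh
  refine PT.cond (PT.decide_eq (by fun_prop) h1) (PT.option_some (PT.beh_mk h2 h6 ?_)) (by fun_prop)
  refine PT.map hP (PT.pair (by fun_prop) ?_)
  fun_prop

@[fun_prop]
theorem PT.chain {q : X → ℕ} {w : X → Word τ k} {fs : X → List (Fact τ k)} (hq : PT q)
    (hw : PT w) (hfs : PT fs) : PT fun x => chain (q x) (w x) (fs x) := by
  unfold QuerySynth.chain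
  refine PT.foldl_add (C := fun _ => 0) hfs (by fun_prop) ?_ (PB.const 0) ?_
  · refine PT.option_bind (by fun_prop) (PT.cond (by fun_prop) (by fun_prop) (by fun_prop))
  · rintro x (_ | u) f hf
    · simp
    · by_cases h : f.state = u
      · cases hr : QuerySynth.readTrees (q x) 1 u with
        | none => simp [h, hr]
        | some r => have := sz_suffix_le (readTrees_suffix hr); simpa [h, hr] using this
      · simp [h]

theorem PT.infer {e : X → Env τ k} {w : X → Word τ k} {fs : X → List (Fact τ k)} (he : PT e)
    (hw : PT w) (hfs : PT fs) : PT fun x => infer (e x) (w x) (fs x) := by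
  have h1 : PT fun z : X × Letter τ k => letterSym z.2 := PT.of_finite letterSym PT.snd'
  have h2 : PT fun z : X × Sym τ k => z.2.arity := PT.of_finite Sym.arity PT.snd'
  unfold QuerySynth.infer
  refine PT.option_elim (PT.option_bind (by fun_prop) h1) ?_ ?_
  · refine PT.option_bind (by fun_prop) (PT.option_bind (by fun_prop) ?_)
    fun_prop
  · refine PT.cond (PT.and (PT.decide_eq (by fun_prop) h2) (by fun_prop))
      (PT.option_map (by fun_prop) (by fun_prop)) (by fun_prop)

attribute [fun_prop] PT.infer

theorem PT.newFact {e : X → Env τ k} {F : X → List (Fact τ k)} (he : PT e) (hF : PT F) :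
    PT fun x => newFact (e x) (F x) := by
  unfold QuerySynth.newFact Env.states
  refine PT.findSome? (by fun_prop) (PT.findSome? (by fun_prop) (PT.option_bind (by fun_prop) ?_))
  fun_prop

theorem PT.satStep : PT (satStep : Bool × Env τ k × List (Fact τ k) → _) := by
  unfold QuerySynth.satStep
  exact PT.option_elim (PT.newFact (by fun_prop) (by fun_prop)) (by fun_prop) (by fun_prop)

@[fun_prop]
theorem PT.encNat {n : X → ℕ} (hn : PT n) : PT fun x => (encNat (n x) : Word τ k) := by
  unfold QuerySynth.encNat
  fun_prop

@[fun_prop]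
theorem PT.isSolution {e : X → Env τ k} {f : X → Fact τ k} (he : PT e) (hf : PT f) :
    PT fun x => (f x).isSolution (e x) := by
  let _ : Enc (Fin k) := Enc.ofFinite _
  have h1 : PT fun z : X × Fin k => decide (z.2 ∈ (f z.1).beh.fv) :=
    (PT.finite_cases (F := fun (x : Fin k) (s : Finset (Fin k)) => decide (x ∈ s))
      fun x => PT.of_finite (fun s => decide (x ∈ s)) .id).comp
      (f := fun z : X × Fin k => (z.2, (f z.1).beh.fv)) (by fun_prop)
  have h2 : PT fun z : X × Fin k => (z.2 : ℕ) := PT.of_finite (fun x : Fin k => (x : ℕ)) PT.snd'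
  have h3 : PT fun x => (List.finRange k).all fun y =>
      decide (decide (y ∈ (f x).beh.fv) = decide ((y : ℕ) < (e x).r)) :=
    PT.all (PT.const _) (PT.decide_eq h1 (PT.decide_lt h2 (by fun_prop)))
  unfold Fact.isSolution
  exact PT.and (PT.and (by fun_prop) h3) (by fun_prop)

@[fun_prop]
theorem PT.outWord {e : X → Env τ k} {F : X → List (Fact τ k)} (he : PT e) (hF : PT F) :
    PT fun x => outWord (e x) (F x) := by
  have h : ∀ {Y : Type} [Enc Y] {g : Y → Sym τ k}, PT g → PT fun y => Letter.sym (g y) :=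
    fun hg => PT.of_finite Letter.sym hg
  have h1 : PT fun z : (X × Fact τ k) × Fact τ k => (Letter.tick :: .sym z.2.sym ::
      z.2.refs.flatMap QuerySynth.encNat : Word τ k) :=
    PT.list_cons (by fun_prop) (PT.list_cons (h (by fun_prop)) (by fun_prop))
  unfold QuerySynth.outWord
  exact PT.option_elim (by fun_prop) (by fun_prop)
    (PT.append (PT.list_cons (by fun_prop) (PT.flatMap (by fun_prop) h1)) (by fun_prop))

end Algorithm

/-! ### The behaviour describes the expression -/

/-- The root symbol of an expression. -/
def Expr.sym : {s : Srt} → Expr τ k s → Sym τ k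
  | _, .rel R _ => .rel R
  | _, .or _ _ => .or
  | _, .and _ _ => .and
  | _, .not _ => .not
  | _, .ex x _ => .ex x
  | _, .all x _ => .all x
  | _, .var x => .var x
  | _, .fn f _ => .fn f
  | _, .ite _ _ _ => .ite

/-- Expressions of any sort. -/
abbrev AnyExpr (τ : FirstOrder.Language.{0, 0}) (k : ℕ) : Type := Σ s : Srt, Expr τ k s

/-- The immediate subexpressions of an expression. -/
def Expr.args : {s : Srt} → (e : Expr τ k s) → Fin e.sym.arity → AnyExpr τ k
  | _, .rel _ ts => fun i => ⟨_, ts i⟩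
  | _, .or φ ψ => ![⟨_, φ⟩, ⟨_, ψ⟩]
  | _, .and φ ψ => ![⟨_, φ⟩, ⟨_, ψ⟩]
  | _, .not φ => ![⟨_, φ⟩]
  | _, .ex _ φ => ![⟨_, φ⟩]
  | _, .all _ φ => ![⟨_, φ⟩]
  | _, .var _ => ![]
  | _, .fn _ ts => fun i => ⟨_, ts i⟩
  | _, .ite φ t t' => ![⟨_, φ⟩, ⟨_, t⟩, ⟨_, t'⟩]

theorem Expr.toTree_eq {s : Srt} (e : Expr τ k s) :
    e.toTree = .node e.sym fun i => (e.args i).2.toTree := by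
  cases e <;> simp only [Expr.toTree, Expr.sym] <;> congr 1 <;> funext i
  all_goals first
    | rfl
    | exact i.elim0
    | (revert i; exact Fin.forall_fin_one.2 rfl)
    | (revert i; exact Fin.forall_fin_two.2 ⟨rfl, rfl⟩)
    | (revert i; exact Fin.forall_fin_succ.2 ⟨rfl, Fin.forall_fin_two.2 ⟨rfl, rfl⟩⟩)

/-- Sorts as truth values, as in `Sym.argForm`. -/
def Srt.isForm : Srt → Bool
  | .form => true
  | .term => false

open Classical in
/-- The values of formulas and terms as numbers. -/
noncomputable def num {n : ℕ} : {s : Srt} → s.Val (Fin n) → ℕ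
  | .form, P => if P then 1 else 0
  | .term, x => x.1

theorem num_eq_one {n : ℕ} {P : Prop} : num (n := n) (s := .form) P = 1 ↔ P := by
  simp [num]

theorem ofB_eq_num {n : ℕ} {b : Bool} {P : Prop} (h : b = true ↔ P) :
    ofB b = num (n := n) (s := .form) P := by
  by_cases hP : P
  · simp [ofB, num, hP, h.2 hP]
  · have : b = false := by simpa using mt h.1 hP
    simp [ofB, num, hP, this]

/-- The behaviour `b` describes the expression `e` over the given examples. -/
def Rep {r : ℕ} (Es : List (Example τ r)) (b : Beh k) {s : Srt} (e : Expr τ k s) : Prop :=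
  b.form = s.isForm ∧ (b.fv : Set (Fin k)) = e.freeVars ∧
    ∀ i E, Es[i]? = some E → ∀ g : Fin k → Fin E.size,
      look b.val (i, E.size, ofNats g) = num (e.eval E.str g)

theorem look_eq_of_mem {κ : Type} [DecidableEq κ] {l : List (κ × ℕ)} {a : κ} {v : ℕ}
    (h : (a, v) ∈ l) (h' : ∀ v', (a, v') ∈ l → v' = v) : look l a = v := by
  rw [look]
  cases hf : l.find? fun e => decide (e.1 = a) with
  | none =>
    have := List.find?_eq_none.1 hf _ h
    simp at this
  | some e =>
    have h1 := List.find?_some hf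
    have h2 := List.mem_of_find?_eq_some hf
    obtain ⟨a', v'⟩ := e
    simp only [decide_eq_true_eq] at h1
    subst h1
    simpa using h' _ h2

section Lookup

variable {r : ℕ} {Es : List (Example τ r)}

theorem mem_pointsFrom {j : ℕ} {p : Point} : p ∈ pointsFrom k j Es ↔
    ∃ i E, Es[i]? = some E ∧ ∃ g : Fin k → Fin E.size, p = (j + i, E.size, ofNats g) := by
  induction Es generalizing j with
  | nil => simp [pointsFrom]
  | cons E Es ih =>
    rw [pointsFrom, List.mem_append, ih]
    constructor
    · rintro (h | ⟨i, E', hE, g, rfl⟩)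
      · obtain ⟨γ, hγ, rfl⟩ := List.mem_map.1 h
        obtain ⟨g, rfl⟩ := exists_ofNats (l := k) hγ
        exact ⟨0, E, by simp, g, by simp⟩
      · exact ⟨i + 1, E', by simpa using hE, g, by rw [add_assoc, add_comm 1]⟩
    · rintro ⟨i, E', hE, g, rfl⟩
      cases i with
      | zero =>
        simp only [List.getElem?_cons_zero, Option.some.injEq] at hE
        subst hE
        exact .inl (List.mem_map.2 ⟨_, ofNats_mem_keys g, by simp⟩)
      | succ i => exact .inr ⟨i, E', by simpa using hE, g, by rw [add_assoc, add_comm 1]⟩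

theorem mem_tablesFrom [Fintype τ.Symbols] {j i : ℕ} {en : Entry τ} {v : ℕ} :
    ((i, en), v) ∈ tablesFrom k j Es ↔
      ∃ i' E, Es[i']? = some E ∧ i = j + i' ∧ en ∈ allKeys k r E.size ∧ v = E.table en := by
  induction Es generalizing j with
  | nil => simp [tablesFrom]
  | cons E Es ih =>
    rw [tablesFrom, List.mem_append, ih]
    constructor
    · rintro (h | ⟨i', E', hE, rfl, h⟩)
      · obtain ⟨en', hen, h⟩ := List.mem_map.1 h
        simp only [Prod.mk.injEq] at h
        obtain ⟨⟨rfl, rfl⟩, rfl⟩ := h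
        exact ⟨0, E, by simp, rfl, hen, rfl⟩
      · exact ⟨i' + 1, E', by simpa using hE, by omega, h⟩
    · rintro ⟨i', E', hE, rfl, h, rfl⟩
      cases i' with
      | zero =>
        simp only [List.getElem?_cons_zero, Option.some.injEq] at hE
        subst hE
        exact .inl (List.mem_map.2 ⟨en, h, rfl⟩)
      | succ i' => exact .inr ⟨i', E', by simpa using hE, by omega, h, rfl⟩

theorem look_tablesFrom [Fintype τ.Symbols] {i : ℕ} {E : Example τ r} (hE : Es[i]? = some E)
    {en : Entry τ} (h : en ∈ allKeys k r E.size) :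
    look (tablesFrom k 0 Es) (i, en) = E.table en := by
  refine look_eq_of_mem (mem_tablesFrom.2 ⟨i, E, hE, by simp, h, rfl⟩) fun v' hv' => ?_
  obtain ⟨i', E', hE', hi, -, rfl⟩ := mem_tablesFrom.1 hv'
  obtain rfl : i' = i := by omega
  rw [hE, Option.some.injEq] at hE'
  rw [hE']

theorem ofNats_update {l n : ℕ} (g : Fin l → Fin n) (x : Fin l) (a : Fin n) :
    (ofNats g).set x a = ofNats (Function.update g x a) := by
  refine List.ext_getElem (by simp [ofNats]) fun i h1 h2 => ?_
  have hi : i < l := by simpa [ofNats] using h2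
  simp only [ofNats, List.getElem_set, List.getElem_ofFn]
  by_cases h : (x : ℕ) = i
  · subst h; simp
  · rw [if_neg h, Function.update_of_ne (fun e => h (by rw [← e]))]

theorem ofNats_take {l n : ℕ} (g : Fin k → Fin n) (h : l ≤ k) :
    (ofNats g).take l = ofNats fun i => g (Fin.castLE h i) := by
  refine List.ext_getElem (by simp [ofNats, h]) fun i h1 h2 => ?_
  simp [ofNats]

theorem getD_ofFn {α : Type} {n : ℕ} (f : Fin n → α) (i : Fin n) (d : α) :
    (List.ofFn f).getD i d = f i := by
  simp [List.getD]

theorem mem_foldl_union {ι α : Type} [DecidableEq α] (F : ι → Finset α) (l : List ι)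
    (s : Finset α) (x : α) :
    x ∈ l.foldl (fun s b => s ∪ F b) s ↔ x ∈ s ∨ ∃ b ∈ l, x ∈ F b := by
  induction l generalizing s with
  | nil => simp
  | cons b l ih =>
    rw [List.foldl_cons, ih]
    simp [or_assoc]

theorem Expr.isForm_sym {s : Srt} (e : Expr τ k s) : e.sym.isForm = s.isForm := by
  cases e <;> rfl

theorem Expr.argForm_sym {s : Srt} (e : Expr τ k s) :
    e.sym.argForm = List.ofFn fun i => (e.args i).1.isForm := by
  cases e with
  | @rel l R ts => exact (List.ofFn_const l false).symm
  | @fn l f ts => exact (List.ofFn_const l false).symm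
  | _ => rfl

theorem Expr.freeVars_eq {s : Srt} (e : Expr τ k s) (S : Finset (Fin k))
    (h : ∀ x, x ∈ S ↔ ∃ i, x ∈ (e.args i).2.freeVars) :
    (e.sym.opFv S : Set (Fin k)) = e.freeVars := by
  ext x
  cases e with
  | @rel l R ts => exact (h x).trans Set.mem_iUnion.symm
  | @fn l f ts => exact (h x).trans Set.mem_iUnion.symm
  | or φ ψ => exact (h x).trans Fin.exists_fin_two
  | and φ ψ => exact (h x).trans Fin.exists_fin_two
  | not φ => exact (h x).trans Fin.exists_fin_one
  | ex y φ =>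
    have := (h x).trans Fin.exists_fin_one
    change x ∈ S.erase y ↔ x ∈ φ.freeVars ∧ ¬ x = y
    rw [Finset.mem_erase, this, and_comm]
    rfl
  | all y φ =>
    have := (h x).trans Fin.exists_fin_one
    change x ∈ S.erase y ↔ x ∈ φ.freeVars ∧ ¬ x = y
    rw [Finset.mem_erase, this, and_comm]
    rfl
  | var y =>
    change x ∈ ({y} : Finset (Fin k)) ↔ x = y
    exact Finset.mem_singleton
  | ite φ t t' =>
    refine (h x).trans (Fin.exists_fin_succ.trans ((or_congr_right Fin.exists_fin_two).trans ?_))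
    exact or_assoc.symm

/-- Expressions of the right sorts can be combined to an expression with a given root symbol. -/
theorem exists_expr_of_argForm (a : Sym τ k) (es : Fin a.arity → AnyExpr τ k)
    (h : (List.ofFn fun i => (es i).1.isForm) = a.argForm) :
    ∃ (s : Srt) (e : Expr τ k s) (ha : e.sym = a),
      ∀ i, e.args i = es (Fin.cast (by rw [ha]) i) := by
  have form : ∀ e : AnyExpr τ k, e.1.isForm = true → ∃ φ : Formula τ k, e = ⟨_, φ⟩ := by
    rintro ⟨_ | _, e⟩ h
    · exact ⟨e, rfl⟩
    · cases h
  have term : ∀ e : AnyExpr τ k, e.1.isForm = false → ∃ t : Expr τ k .term, e = ⟨_, t⟩ := by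
    rintro ⟨_ | _, e⟩ h
    · cases h
    · exact ⟨e, rfl⟩
  cases a with
  | @rel l R =>
    have h' : ∀ i : Fin l, ∃ t : Expr τ k .term, es i = ⟨_, t⟩ := fun i =>
      term _ (congrFun (List.ofFn_injective (h.trans (List.ofFn_const l false).symm)) i)
    choose ts hts using h'
    exact ⟨_, .rel R ts, rfl, fun i => (hts i).symm⟩
  | @fn l f =>
    have h' : ∀ i : Fin l, ∃ t : Expr τ k .term, es i = ⟨_, t⟩ := fun i =>
      term _ (congrFun (List.ofFn_injective (h.trans (List.ofFn_const l false).symm)) i)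
    choose ts hts using h'
    exact ⟨_, .fn f ts, rfl, fun i => (hts i).symm⟩
  | or =>
    have h' := List.ofFn_injective (h.trans (show _ = List.ofFn ![true, true] from rfl))
    obtain ⟨φ, hφ⟩ := form _ (congrFun h' (0 : Fin 2))
    obtain ⟨ψ, hψ⟩ := form _ (congrFun h' (1 : Fin 2))
    exact ⟨_, .or φ ψ, rfl, Fin.forall_fin_two.2 ⟨hφ.symm, hψ.symm⟩⟩
  | and =>
    have h' := List.ofFn_injective (h.trans (show _ = List.ofFn ![true, true] from rfl))
    obtain ⟨φ, hφ⟩ := form _ (congrFun h' (0 : Fin 2))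
    obtain ⟨ψ, hψ⟩ := form _ (congrFun h' (1 : Fin 2))
    exact ⟨_, .and φ ψ, rfl, Fin.forall_fin_two.2 ⟨hφ.symm, hψ.symm⟩⟩
  | not =>
    have h' := List.ofFn_injective (h.trans (show _ = List.ofFn ![true] from rfl))
    obtain ⟨φ, hφ⟩ := form _ (congrFun h' (0 : Fin 1))
    exact ⟨_, .not φ, rfl, Fin.forall_fin_one.2 hφ.symm⟩
  | all x =>
    have h' := List.ofFn_injective (h.trans (show _ = List.ofFn ![true] from rfl))
    obtain ⟨φ, hφ⟩ := form _ (congrFun h' (0 : Fin 1))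
    exact ⟨_, .all x φ, rfl, Fin.forall_fin_one.2 hφ.symm⟩
  | ex x =>
    have h' := List.ofFn_injective (h.trans (show _ = List.ofFn ![true] from rfl))
    obtain ⟨φ, hφ⟩ := form _ (congrFun h' (0 : Fin 1))
    exact ⟨_, .ex x φ, rfl, Fin.forall_fin_one.2 hφ.symm⟩
  | var x => exact ⟨_, .var x, rfl, fun i => i.elim0⟩
  | ite =>
    have h' := List.ofFn_injective (h.trans (show _ = List.ofFn ![true, false, false] from rfl))
    obtain ⟨φ, hφ⟩ := form _ (congrFun h' (0 : Fin 3))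
    obtain ⟨t, ht⟩ := term _ (congrFun h' (1 : Fin 3))
    obtain ⟨t', ht'⟩ := term _ (congrFun h' (2 : Fin 3))
    exact ⟨_, .ite φ t t', rfl,
      Fin.forall_fin_succ.2 ⟨hφ.symm, Fin.forall_fin_two.2 ⟨ht.symm, ht'.symm⟩⟩⟩

variable [Fintype τ.Symbols]

/-- `Sym.opVal` computes the semantics: if the values of the immediate subexpressions are given by
`vs`, then it returns the value of the expression. -/
theorem opVal_eq {s : Srt} (e : Expr τ k s) {vs : Fin e.sym.arity → List (Point × ℕ)}
    (h : ∀ j i E, Es[i]? = some E → ∀ g : Fin k → Fin E.size,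
      look (vs j) (i, E.size, ofNats g) = num ((e.args j).2.eval E.str g))
    {i : ℕ} {E : Example τ r} (hE : Es[i]? = some E) (g : Fin k → Fin E.size) :
    e.sym.opVal (tablesFrom k 0 Es) (List.ofFn vs) (i, E.size, ofNats g) =
      num (e.eval E.str g) := by
  have g0 : ∀ {n : ℕ} (f : Fin (n + 1) → List (Point × ℕ)), (List.ofFn f).getD 0 [] = f 0 :=
    fun f => getD_ofFn f 0 []
  have g1 : ∀ {n : ℕ} (f : Fin (n + 2) → List (Point × ℕ)), (List.ofFn f).getD 1 [] = f 1 :=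
    fun f => getD_ofFn f 1 []
  have g2 : ∀ {n : ℕ} (f : Fin (n + 3) → List (Point × ℕ)), (List.ofFn f).getD 2 [] = f 2 :=
    fun f => getD_ofFn f 2 []
  classical
  cases e with
  | @rel l R ts =>
    have key : ∀ vs : Fin l → List (Point × ℕ),
        (∀ j, look (vs j) (i, E.size, ofNats g) = ((ts j).eval E.str g : Fin E.size)) →
        Sym.opVal (tablesFrom k 0 Es) (.rel R : Sym τ k) (List.ofFn vs) (i, E.size, ofNats g) =
          num (s := .form) (n := E.size) (E.str.RelMap R fun j => (ts j).eval E.str g) := by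
      intro vs h
      have h1 : (List.ofFn vs).map (fun v => look v (i, E.size, ofNats g)) =
          ofNats fun j => (ts j).eval E.str g := by
        rw [List.map_ofFn]
        exact congrArg List.ofFn (funext h)
      simp only [Sym.opVal]
      rw [h1]
      exact (look_tablesFrom hE (some_mem_allKeys (s := .inr ⟨l, R⟩) (ofNats_mem_keys _))).trans
        (E.table_rel R _)
    exact key vs fun j => h j i E hE g
  | @fn l f ts =>
    have key : ∀ vs : Fin l → List (Point × ℕ),
        (∀ j, look (vs j) (i, E.size, ofNats g) = ((ts j).eval E.str g : Fin E.size)) →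
        Sym.opVal (tablesFrom k 0 Es) (.fn f : Sym τ k) (List.ofFn vs) (i, E.size, ofNats g) =
          (E.str.funMap f fun j => (ts j).eval E.str g : Fin E.size) := by
      intro vs h
      have h1 : (List.ofFn vs).map (fun v => look v (i, E.size, ofNats g)) =
          ofNats fun j => (ts j).eval E.str g := by
        rw [List.map_ofFn]
        exact congrArg List.ofFn (funext h)
      simp only [Sym.opVal]
      rw [h1]
      exact (look_tablesFrom hE (some_mem_allKeys (s := .inl ⟨l, f⟩) (ofNats_mem_keys _))).trans
        (E.table_fn f _)
    exact key vs fun j => h j i E hE g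
  | or φ ψ =>
    have key : ∀ vs : Fin 2 → List (Point × ℕ),
        look (vs 0) (i, E.size, ofNats g) = num (s := .form) (n := E.size) (φ.eval E.str g) →
        look (vs 1) (i, E.size, ofNats g) = num (s := .form) (n := E.size) (ψ.eval E.str g) →
        Sym.opVal (tablesFrom k 0 Es) (.or : Sym τ k) (List.ofFn vs) (i, E.size, ofNats g) =
          num (s := .form) (n := E.size) (φ.eval E.str g ∨ ψ.eval E.str g) := by
      intro vs h0 h1
      simp only [Sym.opVal, g0, g1, h0, h1]
      exact ofB_eq_num (by simp [num_eq_one])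
    exact key vs (h (0 : Fin 2) i E hE g) (h (1 : Fin 2) i E hE g)
  | and φ ψ =>
    have key : ∀ vs : Fin 2 → List (Point × ℕ),
        look (vs 0) (i, E.size, ofNats g) = num (s := .form) (n := E.size) (φ.eval E.str g) →
        look (vs 1) (i, E.size, ofNats g) = num (s := .form) (n := E.size) (ψ.eval E.str g) →
        Sym.opVal (tablesFrom k 0 Es) (.and : Sym τ k) (List.ofFn vs) (i, E.size, ofNats g) =
          num (s := .form) (n := E.size) (φ.eval E.str g ∧ ψ.eval E.str g) := by
      intro vs h0 h1
      simp only [Sym.opVal, g0, g1, h0, h1]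
      exact ofB_eq_num (by simp [num_eq_one])
    exact key vs (h (0 : Fin 2) i E hE g) (h (1 : Fin 2) i E hE g)
  | not φ =>
    have key : ∀ vs : Fin 1 → List (Point × ℕ),
        look (vs 0) (i, E.size, ofNats g) = num (s := .form) (n := E.size) (φ.eval E.str g) →
        Sym.opVal (tablesFrom k 0 Es) (.not : Sym τ k) (List.ofFn vs) (i, E.size, ofNats g) =
          num (s := .form) (n := E.size) (¬ φ.eval E.str g) := by
      intro vs h0
      simp only [Sym.opVal, g0, h0]
      exact ofB_eq_num (by simp [num_eq_one])
    exact key vs (h (0 : Fin 1) i E hE g)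
  | ex x φ =>
    have key : ∀ vs : Fin 1 → List (Point × ℕ),
        (∀ g : Fin k → Fin E.size, look (vs 0) (i, E.size, ofNats g) =
          num (s := .form) (n := E.size) (φ.eval E.str g)) →
        Sym.opVal (tablesFrom k 0 Es) (.ex x : Sym τ k) (List.ofFn vs) (i, E.size, ofNats g) =
          num (s := .form) (n := E.size) (∃ a, φ.eval E.str (Function.update g x a)) := by
      intro vs h0
      simp only [Sym.opVal, g0]
      refine ofB_eq_num ?_
      simp only [List.any_eq_true, List.mem_range, decide_eq_true_eq]
      constructor
      · rintro ⟨a, ha, h⟩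
        refine ⟨⟨a, ha⟩, num_eq_one.1 ((h0 _).symm.trans ?_)⟩
        rw [← ofNats_update]
        exact h
      · rintro ⟨a, h⟩
        refine ⟨a, a.2, ?_⟩
        rw [ofNats_update, h0]
        exact num_eq_one.2 h
    exact key vs fun g => h (0 : Fin 1) i E hE g
  | all x φ =>
    have key : ∀ vs : Fin 1 → List (Point × ℕ),
        (∀ g : Fin k → Fin E.size, look (vs 0) (i, E.size, ofNats g) =
          num (s := .form) (n := E.size) (φ.eval E.str g)) →
        Sym.opVal (tablesFrom k 0 Es) (.all x : Sym τ k) (List.ofFn vs) (i, E.size, ofNats g) =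
          num (s := .form) (n := E.size) (∀ a, φ.eval E.str (Function.update g x a)) := by
      intro vs h0
      simp only [Sym.opVal, g0]
      refine ofB_eq_num ?_
      simp only [List.all_eq_true, List.mem_range, decide_eq_true_eq]
      constructor
      · intro h a
        refine num_eq_one.1 ((h0 _).symm.trans ?_)
        rw [← ofNats_update]
        exact h a a.2
      · intro h a ha
        have := (h0 _).trans (num_eq_one.2 (h ⟨a, ha⟩))
        rw [← ofNats_update] at this
        exact this
    exact key vs fun g => h (0 : Fin 1) i E hE g
  | var x => simp [Expr.sym, Sym.opVal, num, Expr.eval, ofNats]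
  | ite φ t t' =>
    have key : ∀ vs : Fin 3 → List (Point × ℕ),
        look (vs 0) (i, E.size, ofNats g) = num (s := .form) (n := E.size) (φ.eval E.str g) →
        look (vs 1) (i, E.size, ofNats g) = (t.eval E.str g : Fin E.size) →
        look (vs 2) (i, E.size, ofNats g) = (t'.eval E.str g : Fin E.size) →
        Sym.opVal (tablesFrom k 0 Es) (.ite : Sym τ k) (List.ofFn vs) (i, E.size, ofNats g) =
          ((if φ.eval E.str g then t.eval E.str g else t'.eval E.str g : Fin E.size) : ℕ) := by
      intro vs h0 h1 h2
      simp only [Sym.opVal, g0, g1, g2, h0, h1, h2]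
      by_cases h : φ.eval E.str g
      · simp [h, num]
      · simp [h, num]
    exact key vs (h (0 : Fin 3) i E hE g) (h (1 : Fin 3) i E hE g) (h (2 : Fin 3) i E hE g)

/-- The behaviour of an expression is determined by those of its immediate subexpressions. -/
theorem opBeh_rep {s : Srt} (e : Expr τ k s) {bs : Fin e.sym.arity → Beh k}
    (h : ∀ i, Rep Es (bs i) (e.args i).2) :
    ∃ b, opBeh (pointsFrom k 0 Es) (tablesFrom k 0 Es) e.sym (List.ofFn bs) = some b ∧
      Rep Es b e := by
  have h1 : (List.ofFn bs).map Beh.form = e.sym.argForm := by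
    rw [e.argForm_sym, List.map_ofFn]
    exact congrArg List.ofFn (funext fun i => (h i).1)
  refine ⟨_, by rw [opBeh, decide_eq_true h1, cond_true], e.isForm_sym, ?_, ?_⟩
  · refine e.freeVars_eq _ fun x => ?_
    simp only [mem_foldl_union, Finset.notMem_empty, false_or, List.mem_ofFn]
    constructor
    · rintro ⟨_, ⟨i, rfl⟩, hx⟩
      exact ⟨i, (h i).2.1 ▸ hx⟩
    · rintro ⟨i, hx⟩
      refine ⟨_, ⟨i, rfl⟩, ?_⟩
      have := (h i).2.1
      rw [← this] at hx
      exact hx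
  · intro i E hE g
    rw [look_map _ (fun p => e.sym.opVal (tablesFrom k 0 Es) ((List.ofFn bs).map Beh.val) p)
      (mem_pointsFrom.2 ⟨i, E, hE, g, by simp⟩), List.map_ofFn]
    exact opVal_eq e (fun j i E hE g => (h j).2.2 i E hE g) hE g

/-- Conversely, every behaviour computed by `opBeh` is that of an expression, which is composed of
any expressions with the given behaviours. -/
theorem exists_expr_of_opBeh {a : Sym τ k} {bs : Fin a.arity → Beh k} {b : Beh k}
    (hb : opBeh (pointsFrom k 0 Es) (tablesFrom k 0 Es) a (List.ofFn bs) = some b)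
    (es : Fin a.arity → AnyExpr τ k) (h : ∀ i, Rep Es (bs i) (es i).2) :
    ∃ e : AnyExpr τ k, e.2.toTree = .node a (fun i => (es i).2.toTree) ∧ Rep Es b e.2 := by
  have h1 : (List.ofFn bs).map Beh.form = a.argForm := by
    by_contra h1
    rw [opBeh, decide_eq_false h1, cond_false] at hb
    cases hb
  have h2 : (List.ofFn fun i => (es i).1.isForm) = a.argForm := by
    rw [← h1, List.map_ofFn]
    exact congrArg List.ofFn (funext fun i => (h i).1.symm)
  obtain ⟨s, e, rfl, he⟩ := exists_expr_of_argForm a es h2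
  obtain rfl : e.args = es := funext he
  obtain ⟨b', hb', hr⟩ := opBeh_rep e h
  rw [hb, Option.some.injEq] at hb'
  subst hb'
  exact ⟨⟨s, e⟩, e.toTree_eq, hr⟩

end Lookup

/-- The value of an expression depends on the values of its free variables only. -/
theorem Expr.eval_congr {M : Type} (A : τ.Structure M) {s : Srt} (e : Expr τ k s)
    {g g' : Fin k → M} (h : ∀ x ∈ e.freeVars, g x = g' x) : e.eval A g = e.eval A g' := by
  classical
  induction e generalizing g g' with
  | rel R ts ih =>
    have : (fun i => (ts i).eval A g) = fun i => (ts i).eval A g' :=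
      funext fun i => ih i fun x hx => h x (Set.mem_iUnion.2 ⟨i, hx⟩)
    simp only [Expr.eval, this]
  | fn f ts ih =>
    have : (fun i => (ts i).eval A g) = fun i => (ts i).eval A g' :=
      funext fun i => ih i fun x hx => h x (Set.mem_iUnion.2 ⟨i, hx⟩)
    simp only [Expr.eval, this]
  | or φ ψ h1 h2 =>
    simp only [Expr.eval]
    rw [h1 fun x hx => h x (.inl hx), h2 fun x hx => h x (.inr hx)]
  | and φ ψ h1 h2 =>
    simp only [Expr.eval]
    rw [h1 fun x hx => h x (.inl hx), h2 fun x hx => h x (.inr hx)]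
  | not φ h1 =>
    simp only [Expr.eval]
    rw [h1 fun x hx => h x hx]
  | ex y φ h1 =>
    simp only [Expr.eval]
    refine propext (exists_congr fun a => iff_of_eq (h1 fun x hx => ?_))
    by_cases hxy : x = y
    · simp [hxy]
    · simpa [hxy] using h x ⟨hx, hxy⟩
  | all y φ h1 =>
    simp only [Expr.eval]
    refine propext (forall_congr' fun a => iff_of_eq (h1 fun x hx => ?_))
    by_cases hxy : x = y
    · simp [hxy]
    · simpa [hxy] using h x ⟨hx, hxy⟩
  | var x => exact h x rfl
  | ite φ t t' h1 h2 h3 =>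
    simp only [Expr.eval]
    rw [h1 fun x hx => h x (.inl (.inl hx)), h2 fun x hx => h x (.inl (.inr hx)),
      h3 fun x hx => h x (.inr hx)]

/-- The answer set of a query is compared with `S` at all assignments of the `k` variables, instead
of the tuples of length `r`. -/
theorem answerSet_eq_iff {r : ℕ} (hr : r ≤ k) {n : ℕ} (hn : 0 < n) (A : τ.Structure (Fin n))
    {φ : Formula τ k} (hφ : IsQuery hr φ) (S : Set (Fin r → Fin n)) :
    answerSet hr A φ = S ↔
      ∀ g : Fin k → Fin n, φ.eval A g ↔ (fun i => g (Fin.castLE hr i)) ∈ S := by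
  constructor
  · rintro rfl g
    refine ⟨fun h g' hg' => ?_, fun h => h g fun _ => rfl⟩
    have : φ.eval A g' = φ.eval A g := φ.eval_congr A fun x hx => by
      rw [hφ] at hx
      obtain ⟨i, rfl⟩ := hx
      exact hg' i
    rw [this]
    exact h
  · intro h
    ext a
    constructor
    · intro ha
      let g : Fin k → Fin n := fun x => if hx : (x : ℕ) < r then a ⟨x, hx⟩ else ⟨0, hn⟩
      have hg : (fun i => g (Fin.castLE hr i)) = a := by funext i; simp [g]
      rw [← hg]
      exact (h g).1 (ha g fun i => congrFun hg i)
    · intro ha g hg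
      refine (h g).2 ?_
      rwa [show (fun i => g (Fin.castLE hr i)) = a from funext hg]

/-! ### Derivations -/

/-- `G.Derives t s`: the tree `s` without nonterminals is derivable from `t`. In contrast to a
sequence of steps, the definition follows the structure of `t`; see `Grammar.mem_language_iff`. -/
inductive Grammar.Derives (G : Grammar τ k) : Tree τ k (Fin G.numNT) → Tree τ k Empty → Prop
  | node {a : Sym τ k} {ts : Fin a.arity → Tree τ k (Fin G.numNT)}
      {ss : Fin a.arity → Tree τ k Empty} (h : ∀ i, Grammar.Derives G (ts i) (ss i)) :
      Grammar.Derives G (.node a ts) (.node a ss)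
  | leaf {B : Fin G.numNT} {t : Tree τ k (Fin G.numNT)} {s : Tree τ k Empty}
      (hB : (B, t) ∈ G.rules) (h : Grammar.Derives G t s) : Grammar.Derives G (.leaf B) s

theorem Grammar.derives_embed (G : Grammar τ k) (s : Tree τ k Empty) : G.Derives s.embed s := by
  induction s with
  | leaf B => exact B.elim
  | node a ts ih => exact .node ih

theorem Grammar.Step.derives {G : Grammar τ k} {t t' : Tree τ k (Fin G.numNT)} (h : G.Step t t') :
    ∀ {s : Tree τ k Empty}, G.Derives t' s → G.Derives t s := by
  induction h with
  | rule hB => exact fun h => .leaf hB h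
  | @child a ts i t h ih =>
    intro s hs
    cases hs with
    | node hs =>
      refine .node fun j => ?_
      have hj := hs j
      by_cases hji : j = i
      · subst hji
        rw [Function.update_self] at hj
        exact ih hj
      · rwa [Function.update_of_ne hji] at hj

/-- Steps in different children are independent of each other, and can be made one child at a time.
-/
theorem Grammar.steps_node {G : Grammar τ k} {a : Sym τ k}
    {ts ts' : Fin a.arity → Tree τ k (Fin G.numNT)}
    (h : ∀ i, Relation.ReflTransGen G.Step (ts i) (ts' i)) :
    Relation.ReflTransGen G.Step (.node a ts) (.node a ts') := by
  have one : ∀ (us : Fin a.arity → Tree τ k (Fin G.numNT)) (i : Fin a.arity) (t : _),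
      Relation.ReflTransGen G.Step (us i) t →
      Relation.ReflTransGen G.Step (.node a us) (.node a (Function.update us i t)) := by
    intro us i t h
    induction h with
    | refl => rw [Function.update_eq_self]
    | @tail b c _ hbc ih =>
      refine ih.tail ?_
      have := Step.child (G := G) (Function.update us i b) i (t := c) (by simpa using hbc)
      rwa [Function.update_idem] at this
  have key : ∀ S : Finset (Fin a.arity), Relation.ReflTransGen G.Step (.node a ts)
      (.node a fun i => if i ∈ S then ts' i else ts i) := by
    intro S
    induction S using Finset.induction_on with
    | empty => simpa using Relation.ReflTransGen.refl
    | insert i S hi ih =>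
      refine ih.trans ?_
      have := one (fun j => if j ∈ S then ts' j else ts j) i (ts' i) (by simpa [hi] using h i)
      convert this using 2
      funext j
      by_cases hj : j = i
      · subst hj; simp
      · simp [hj]
  simpa using key Finset.univ

theorem Grammar.mem_language_iff (G : Grammar τ k) (s : Tree τ k Empty) :
    s ∈ G.language ↔ G.Derives (.leaf G.start) s := by
  constructor
  · intro h
    have h : Relation.ReflTransGen G.Step (.leaf G.start) s.embed := h
    generalize Tree.leaf G.start = t at h ⊢
    induction h using Relation.ReflTransGen.head_induction_on with
    | refl => exact G.derives_embed s
    | head h _ ih => exact h.derives ih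
  · intro h
    change Relation.ReflTransGen G.Step (.leaf G.start) s.embed
    generalize Tree.leaf G.start = t at h ⊢
    induction h with
    | node _ ih => exact steps_node ih
    | leaf hB _ ih => exact ih.head (.rule hB)

/-! ### Soundness and completeness of inference -/

section Saturation

/-- The presentation with sharing that is stored in a list of facts. -/
def nodesOf (F : List (Fact τ k)) : List (Σ a : Sym τ k, Fin a.arity → ℕ) :=
  F.map fun f => ⟨f.sym, fun i => f.refs.getD i 0⟩

theorem SharedTree.UnfoldsAt.mono {L L' : List (Σ a : Sym τ k, Fin a.arity → ℕ)} {i j j' : ℕ}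
    {t : Tree τ k Empty} (h : SharedTree.UnfoldsAt ⟨L, j⟩ i t) :
    SharedTree.UnfoldsAt ⟨L ++ L', j'⟩ i t := by
  induction h with
  | node hi _ ih =>
    refine .node ?_ ih
    have h1 := List.getElem?_eq_some_iff.1 hi
    obtain ⟨h1, h2⟩ := h1
    change (L ++ L')[_]? = _
    rw [List.getElem?_append_left h1]
    exact hi

theorem chain_none (q : ℕ) (fs : List (Fact τ k)) :
    fs.foldl (fun o f => o.bind fun u => bif decide (f.state = u) then readTrees q 1 u else none)
      none = none := by
  induction fs with
  | nil => rfl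
  | cons f fs ih => exact ih

theorem chain_cons (q : ℕ) (w : Word τ k) (f : Fact τ k) (fs : List (Fact τ k)) :
    chain q w (f :: fs) =
      bif decide (f.state = w) then (readTrees q 1 w).bind fun r => chain q r fs else none := by
  by_cases h : f.state = w
  · cases hr : readTrees q 1 w with
    | none => simp [chain, h, hr, chain_none]
    | some r => simp [chain, h, hr]
  · simp [chain, h, chain_none]

/-- The facts in the list match the trees in order: the state of the `i`-th fact is the suffix that
starts with the `i`-th tree. -/
theorem chain_isSome_iff {q : ℕ} (ts : List (Tree τ k (Fin q))) (fs : List (Fact τ k))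
    (h : fs.length = ts.length) (r : Word τ k) :
    (chain q (ts.flatMap encTree ++ r) fs).isSome ↔
      ∀ i (hi : i < ts.length), fs[i].state =
        encTree ts[i] ++ ((ts.drop (i + 1)).flatMap encTree ++ r) := by
  induction ts generalizing fs with
  | nil =>
    obtain rfl := List.eq_nil_of_length_eq_zero h
    simp [chain]
  | cons t ts ih =>
    cases fs with
    | nil => simp at h
    | cons f fs =>
      rw [List.flatMap_cons, List.append_assoc, chain_cons, readTrees_encTree]
      simp only [List.length_cons, Nat.add_right_cancel_iff] at h
      by_cases hf : f.state = encTree t ++ (ts.flatMap encTree ++ r)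
      · simp only [hf, decide_true, cond_true, Option.bind_some, ih fs h]
        constructor
        · intro H i hi
          cases i with
          | zero => simpa using hf
          | succ i => exact H i (by simpa using hi)
        · intro H i hi
          exact H (i + 1) (by simpa using hi)
      · simp only [hf, decide_false, cond_false, Option.isSome_none, Bool.false_eq_true, false_iff]
        intro H
        exact hf (H 0 (by simp))

theorem head?_encNat_bind {n : ℕ} {r : Word τ k} :
    (encNat n ++ r).head?.bind letterSym = none := by
  cases n <;> simp [encNat, List.replicate_succ, letterSym]

theorem infer_leaf {e : Env τ k} {B : ℕ} {r : Word τ k} {fs : List (Fact τ k)} :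
    infer e (encNat B ++ r) fs = fs.head?.bind fun f =>
      bif (e.rules.any fun p => decide (p = (B, f.state))) then some (f.beh, f.sym, f.refs)
      else none := by
  rw [infer, head?_encNat_bind, readNat_encNat]
  rfl

theorem infer_node {e : Env τ k} {a : Sym τ k} {w : Word τ k} {fs : List (Fact τ k)} :
    infer e (.sym a :: w) fs = bif decide (fs.length = a.arity) && (chain e.q w fs).isSome then
      (opBeh e.pts e.tbl a (fs.map Fact.beh)).map fun b => (b, a, fs.map Fact.idx) else none := rfl

theorem mem_states {e : Env τ k} {w : Word τ k} : w ∈ e.states ↔ w <:+ e.start := by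
  simp only [Env.states, List.mem_map, List.mem_range]
  constructor
  · rintro ⟨i, -, rfl⟩
    exact List.drop_suffix _ _
  · intro h
    exact ⟨e.start.length - w.length, by omega, (List.suffix_iff_eq_drop.1 h).symm⟩

variable (I : Input τ k)

/-- What a fact states: every tree that its state starts with derives an expression which has the
given behaviour and is stored in the list `F` of all facts at the given place. -/
def Fact.Sound (F : List (Fact τ k)) (f : Fact τ k) : Prop :=
  f.refs.length = f.sym.arity ∧ ∃ e : AnyExpr τ k, Rep I.examples f.beh e.2 ∧
    (∃ ss : Fin f.sym.arity → Tree τ k Empty, e.2.toTree = .node f.sym ss ∧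
      ∀ i : Fin f.sym.arity, SharedTree.UnfoldsAt ⟨nodesOf F, 0⟩ (f.refs.getD i 0) (ss i)) ∧
    ∀ t r, f.state = encTree t ++ r → I.grammar.Derives t e.2.toTree

theorem Fact.Sound.mono {F : List (Fact τ k)} {f : Fact τ k} (h : f.Sound I F)
    (f' : Fact τ k) : f.Sound I (F ++ [f']) := by
  obtain ⟨h1, e, h2, ⟨ss, h3, h4⟩, h5⟩ := h
  refine ⟨h1, e, h2, ⟨ss, h3, fun i => ?_⟩, h5⟩
  rw [nodesOf, List.map_append]
  exact (h4 i).mono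

/-- The invariant of the saturation procedure. -/
structure FactsOK (F : List (Fact τ k)) : Prop where
  idx : ∀ i (hi : i < F.length), F[i].idx = i
  sound : ∀ f ∈ F, f.Sound I F

/-- The index of a fact refers to a node which unfolds to an expression as stated by the fact. -/
theorem FactsOK.unfolds {F : List (Fact τ k)} (h : FactsOK I F) {f : Fact τ k} (hf : f ∈ F) :
    ∃ e : AnyExpr τ k, Rep I.examples f.beh e.2 ∧
      SharedTree.UnfoldsAt ⟨nodesOf F, 0⟩ f.idx e.2.toTree ∧
      ∀ t r, f.state = encTree t ++ r → I.grammar.Derives t e.2.toTree := by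
  obtain ⟨-, e, h2, ⟨ss, h3, h4⟩, h5⟩ := h.sound f hf
  refine ⟨e, h2, ?_, h5⟩
  obtain ⟨i, hi, rfl⟩ := List.getElem_of_mem hf
  rw [h3, h.idx i hi]
  refine .node ?_ h4
  change (nodesOf F)[i]? = _
  rw [nodesOf, List.getElem?_map, List.getElem?_eq_getElem hi]
  rfl

variable [Fintype τ.Symbols] {I}

/-- Inference preserves soundness. The index `j` of the new fact does not matter. -/
theorem infer_sound {F fs : List (Fact τ k)} (hF : FactsOK I F) (hfs : ∀ f ∈ fs, f ∈ F)
    {w : Word τ k} {x : Beh k × Sym τ k × List ℕ} (hx : infer (envOf I) w fs = some x) (j : ℕ) :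
    Fact.Sound I F ⟨j, w, x.1, x.2.1, x.2.2⟩ := by
  by_cases hw : ∃ a u, w = .sym a :: u
  · obtain ⟨a, u, rfl⟩ := hw
    rw [infer_node] at hx
    by_cases hc : fs.length = a.arity ∧ (chain I.grammar.numNT u fs).isSome
    swap
    · have : (decide (fs.length = a.arity) && (chain (envOf I).q u fs).isSome) = false := by
        rw [Bool.eq_false_iff, ne_eq, Bool.and_eq_true, decide_eq_true_eq]
        exact hc
      rw [this] at hx
      cases hx
    have hc' : (decide (fs.length = a.arity) && (chain (envOf I).q u fs).isSome) = true := by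
      rw [Bool.and_eq_true, decide_eq_true_eq]
      exact hc
    rw [hc', cond_true, Option.map_eq_some_iff] at hx
    obtain ⟨b, hb, rfl⟩ := hx
    obtain ⟨hlen, hch⟩ := hc
    have hi : ∀ i : Fin a.arity, (i : ℕ) < fs.length := fun i => by rw [hlen]; exact i.2
    choose es h1 h2 h3 using fun i : Fin a.arity => hF.unfolds I (hfs _ (List.getElem_mem (hi i)))
    have hofFn : fs.map Fact.beh = List.ofFn fun i : Fin a.arity => (fs[i]'(hi i)).beh := by
      refine List.ext_getElem (by simp [hlen]) fun i _ _ => by simp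
    rw [hofFn] at hb
    obtain ⟨e, he, hr⟩ := exists_expr_of_opBeh (Es := I.examples) hb es h1
    refine ⟨by simp [hlen], e, hr, ⟨_, he, fun i => ?_⟩, ?_⟩
    · have := h2 i
      simpa [List.getD, hi i] using this
    · rintro t r hst
      rw [he]
      cases t with
      | leaf B =>
        have := congrArg (fun w : Word τ k => w.head?.bind letterSym) hst
        simp only [encTree, head?_encNat_bind] at this
        simp [letterSym] at this
      | node a' ts =>
        rw [encTree_node] at hst
        simp only [List.cons_append, List.cons.injEq, Letter.sym.injEq] at hst
        obtain ⟨rfl, rfl⟩ := hst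
        refine .node fun i => h3 i (ts i) (((List.ofFn ts).drop (i + 1)).flatMap encTree ++ r) ?_
        have := (chain_isSome_iff (List.ofFn ts) fs (by simp [hlen]) r).1 hch i (by simp)
        simpa using this
  · have hn : w.head?.bind letterSym = none := by
      cases w with
      | nil => rfl
      | cons l w => cases l <;> simp [letterSym] at hw ⊢
    rw [infer, hn] at hx
    obtain ⟨⟨B, r⟩, hB, hx⟩ := Option.bind_eq_some_iff.1 hx
    rw [readNat_eq_some] at hB
    obtain ⟨f, hf, hx⟩ := Option.bind_eq_some_iff.1 hx
    have hf : f ∈ F := hfs f (List.mem_of_head? hf)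
    cases hr : (envOf I).rules.any fun p => decide (p = (B, f.state)) with
    | false => simp [hr] at hx
    | true =>
      simp only [hr, cond_true, Option.some.injEq] at hx
      subst hx
      simp only [List.any_eq_true, decide_eq_true_eq, exists_eq_right] at hr
      obtain ⟨h1, e, h2, h3, h4⟩ := hF.sound f hf
      refine ⟨h1, e, h2, h3, fun t r' hst => ?_⟩
      obtain ⟨p, hp, rfl, u, hu⟩ := mem_rulesOf hr
      simp only at hst
      cases t with
      | node a ts =>
        rw [encTree_node] at hst
        exact absurd ⟨a, _, hst⟩ hw
      | leaf B' =>
        have h5 := readNat_encNat (p.1 : ℕ) r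
        rw [← hB, hst, encTree, readNat_encNat] at h5
        simp only [Option.some.injEq, Prod.mk.injEq] at h5
        obtain rfl : B' = p.1 := Fin.ext h5.1
        exact .leaf (t := p.2) hp (h4 _ _ hu)

theorem newFact_eq_some {e : Env τ k} {F : List (Fact τ k)} {f : Fact τ k}
    (h : newFact e F = some f) : ∃ fs, (∀ g ∈ fs, g ∈ F) ∧ fs.length ≤ maxArity τ ∧
      f.state ∈ e.states ∧ infer e f.state fs = some (f.beh, f.sym, f.refs) ∧ f.idx = F.length ∧
      f.key ∉ F.map Fact.key := by
  obtain ⟨w, hw, h⟩ := List.exists_of_findSome?_eq_some h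
  obtain ⟨fs, hfs, h⟩ := List.exists_of_findSome?_eq_some h
  obtain ⟨x, hx, h⟩ := Option.bind_eq_some_iff.1 h
  cases hk : F.any fun f => decide (f.key = (w, x.1)) with
  | true => simp [hk] at h
  | false =>
    simp only [hk, cond_false, Option.some.injEq] at h
    subst h
    rw [mem_tuplesLE] at hfs
    refine ⟨fs, hfs.2, hfs.1, hw, hx, rfl, fun hm => ?_⟩
    obtain ⟨g, hg, hgk⟩ := List.mem_map.1 hm
    rw [List.any_eq_false] at hk
    exact hk g hg (decide_eq_true hgk)

theorem newFact_eq_none {e : Env τ k} {F : List (Fact τ k)} (h : newFact e F = none)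
    {w : Word τ k} (hw : w ∈ e.states) {fs : List (Fact τ k)} (hfs : ∀ g ∈ fs, g ∈ F)
    (hlen : fs.length ≤ maxArity τ) {x : Beh k × Sym τ k × List ℕ} (hx : infer e w fs = some x) :
    ∃ f ∈ F, f.state = w ∧ f.beh = x.1 := by
  have h1 := List.findSome?_eq_none_iff.1 h w hw
  have h2 := List.findSome?_eq_none_iff.1 h1 fs (mem_tuplesLE.2 ⟨hlen, hfs⟩)
  rw [hx, Option.bind_some] at h2
  cases hk : F.any fun f => decide (f.key = (w, x.1)) with
  | false => simp [hk] at h2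
  | true =>
    obtain ⟨f, hf, hfk⟩ := List.any_eq_true.1 hk
    have := of_decide_eq_true hfk
    exact ⟨f, hf, congrArg Prod.fst this, congrArg Prod.snd this⟩

theorem FactsOK.append {F : List (Fact τ k)} (hF : FactsOK I F) {f : Fact τ k}
    (h : newFact (envOf I) F = some f) : FactsOK I (F ++ [f]) := by
  obtain ⟨fs, hfs, -, -, hx, hidx, -⟩ := newFact_eq_some h
  constructor
  · intro i hi
    rw [List.getElem_append]
    split_ifs with h'
    · exact hF.idx i h'
    · simp only [List.length_append, List.length_singleton] at hi
      simp only [List.getElem_singleton, hidx]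
      omega
  · intro g hg
    rcases List.mem_append.1 hg with hg | hg
    · exact (hF.sound g hg).mono I f
    · obtain rfl := List.mem_singleton.1 hg
      exact Fact.Sound.mono I (infer_sound hF hfs hx g.idx) g

/-- In a saturated list of facts, there is a fact about each derivation. -/
theorem exists_fact {F : List (Fact τ k)} (hF : newFact (envOf I) F = none)
    {t : Tree τ k (Fin I.grammar.numNT)} {s : Tree τ k Empty} (h : I.grammar.Derives t s) :
    ∀ r, encTree t ++ r <:+ (envOf I).start → ∀ e : AnyExpr τ k, e.2.toTree = s →
      ∃ f ∈ F, f.state = encTree t ++ r ∧ Rep I.examples f.beh e.2 := by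
  induction h with
  | @node a ts ss h ih =>
    rintro r hr ⟨srt, e⟩ he
    simp only at he ⊢
    rw [e.toTree_eq, Tree.node.injEq] at he
    obtain ⟨rfl, he⟩ := he
    have he := eq_of_heq he
    rw [encTree_node, List.cons_append] at hr ⊢
    have hsuf : ∀ i : Fin e.sym.arity, encTree (ts i) ++
        (((List.ofFn ts).drop (i + 1)).flatMap encTree ++ r) <:+ (envOf I).start := by
      intro i
      refine List.IsSuffix.trans ?_ hr
      refine (List.IsSuffix.trans ?_ (List.suffix_cons _ _))
      refine ⟨((List.ofFn ts).take i).flatMap encTree, ?_⟩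
      have : List.ofFn ts = (List.ofFn ts).take i ++ (ts i :: (List.ofFn ts).drop (i + 1)) := by
        conv_lhs => rw [← List.take_append_drop i (List.ofFn ts)]
        congr 1
        rw [List.drop_eq_getElem_cons (by simp)]
        simp
      conv_rhs => rw [this]
      simp
    choose fs hfsF hst hrep using fun i => ih i _ (hsuf i) (e.args i) (congrFun he i)
    obtain ⟨b, hb, hrb⟩ := opBeh_rep e hrep
    have hch := (chain_isSome_iff (List.ofFn ts) (List.ofFn fs) (by simp) r).2 fun i hi => by
      simpa using hst ⟨i, by simpa using hi⟩
    have hx : infer (envOf I) (.sym e.sym :: ((List.ofFn ts).flatMap encTree ++ r))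
        (List.ofFn fs) = some (b, e.sym, (List.ofFn fs).map Fact.idx) := by
      have h1 : (decide ((List.ofFn fs).length = e.sym.arity) && (chain (envOf I).q
          ((List.ofFn ts).flatMap encTree ++ r) (List.ofFn fs)).isSome) = true := by
        rw [Bool.and_eq_true]
        exact ⟨by simp, hch⟩
      have h2 : opBeh (envOf I).pts (envOf I).tbl e.sym ((List.ofFn fs).map Fact.beh) = some b := by
        rw [List.map_ofFn]
        exact hb
      rw [infer_node, h1, cond_true, h2, Option.map_some]
    obtain ⟨f, hf, h1, h2⟩ := newFact_eq_none hF (mem_states.2 hr)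
      (fun g hg => by obtain ⟨i, rfl⟩ := List.mem_ofFn.1 hg; exact hfsF i)
      (by simpa using arity_le_maxArity e.sym) hx
    exact ⟨f, hf, h1, by rw [h2]; exact hrb⟩
  | @leaf B t s hB h ih =>
    intro r hr e he
    obtain ⟨u, hu⟩ := exists_mem_rulesOf (r := [Letter.mark]) hB
    obtain ⟨f, hf, hst, hrep⟩ := ih u ((suffix_of_mem_rulesOf hu).trans ⟨encNat I.grammar.start, by
      simp [envOf, encList]⟩) e he
    have hx : infer (envOf I) (encTree (.leaf B) ++ r) [f] = some (f.beh, f.sym, f.refs) := by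
      have h1 : ((envOf I).rules.any fun p => decide (p = ((B : ℕ), f.state))) = true := by
        simp only [List.any_eq_true, decide_eq_true_eq, exists_eq_right, hst]
        exact hu
      rw [encTree, infer_leaf, List.head?_cons, Option.bind_some, h1, cond_true]
    obtain ⟨f', hf', h1, h2⟩ := newFact_eq_none hF (mem_states.2 hr)
      (fun g hg => by rw [List.mem_singleton.1 hg]; exact hf) (by simp [maxArity]) hx
    exact ⟨f', hf', h1, by rw [h2]; exact hrep⟩

/-- The test of a fact is correct. It compares the values at all points with the table of the answer
set, at the first `r` entries of the assignment. -/
theorem isSolution_iff {f : Fact τ k} {φ : Formula τ k} (h : Rep I.examples f.beh φ) :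
    f.isSolution (envOf I) = true ↔ f.state = (envOf I).start ∧ IsQuery I.r_le φ ∧
      ∀ E ∈ I.examples, answerSet I.r_le E.str φ = E.ans := by
  have h1 : f.beh.form = true := h.1
  have h2 : ((List.finRange k).all fun x =>
      decide (decide (x ∈ f.beh.fv) = decide ((x : ℕ) < I.r))) = true ↔ IsQuery I.r_le φ := by
    rw [IsQuery, ← h.2.1, Set.ext_iff]
    simp only [List.all_eq_true, List.mem_finRange, true_imp_iff, decide_eq_true_eq,
      decide_eq_decide, Finset.mem_coe]
    refine forall_congr' fun x => iff_congr Iff.rfl ⟨fun hx => ⟨⟨x, hx⟩, rfl⟩, ?_⟩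
    rintro ⟨i, rfl⟩
    exact i.2
  have h3 : ((envOf I).pts.all fun p => decide (decide (look f.beh.val p = 1) =
      decide (look (envOf I).tbl (p.1, none, p.2.2.take I.r) = 1))) = true ↔
      ∀ E ∈ I.examples, ∀ g : Fin k → Fin E.size,
        φ.eval E.str g ↔ (fun i => g (Fin.castLE I.r_le i)) ∈ E.ans := by
    have h4 : ∀ i E, I.examples[i]? = some E → ∀ g : Fin k → Fin E.size,
        ((look f.beh.val (i, E.size, ofNats g) = 1 ↔
          look (envOf I).tbl (i, none, (ofNats g).take I.r) = 1) ↔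
        (φ.eval E.str g ↔ (fun i => g (Fin.castLE I.r_le i)) ∈ E.ans)) := by
      intro i E hE g
      rw [h.2.2 i E hE g, num_eq_one, ofNats_take g I.r_le, envOf,
        look_tablesFrom hE (none_mem_allKeys I.r_le (ofNats_mem_keys _)), E.table_ans]
      simp
    simp only [List.all_eq_true, decide_eq_true_eq, decide_eq_decide]
    constructor
    · intro H E hE g
      obtain ⟨i, hi⟩ := List.mem_iff_getElem?.1 hE
      exact (h4 i E hi g).1 (H _ (mem_pointsFrom.2 ⟨i, E, hi, g, by rw [zero_add]⟩))
    · intro H p hp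
      obtain ⟨i, E, hi, g, rfl⟩ := mem_pointsFrom.1 hp
      rw [zero_add]
      exact (h4 i E hi g).2 (H E (List.mem_of_getElem? hi) g)
  rw [Fact.isSolution, Bool.and_eq_true, Bool.and_eq_true, Bool.and_eq_true, decide_eq_true_eq]
  refine ((and_congr (and_congr (and_congr (iff_of_true h1 trivial) Iff.rfl) h2) h3).trans ?_)
  rw [true_and, and_assoc]
  refine and_congr Iff.rfl (and_congr_right fun hφ => forall₂_congr fun E hE => ?_)
  exact (answerSet_eq_iff I.r_le E.size_pos E.str hφ E.ans).symm

end Saturation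

/-! ### Exponential bounds -/

/-- `EB g`: the function `g` is bounded by `2 ^ p` for a polynomial `p`. -/
def EB (g : ℕ → ℕ) : Prop := ∃ k, ∀ n, g n ≤ 2 ^ (n + 2) ^ k

theorem EB.mono {g h : ℕ → ℕ} (hg : EB g) (hle : ∀ n, h n ≤ g n) : EB h := by
  obtain ⟨k, hk⟩ := hg
  exact ⟨k, fun n => (hle n).trans (hk n)⟩

theorem PB.two_pow {g : ℕ → ℕ} (hg : PB g) : EB fun n => 2 ^ g n := by
  obtain ⟨k, hk⟩ := hg
  exact ⟨k, fun n => Nat.pow_le_pow_right (by omega) (hk n)⟩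

theorem PB.eb {g : ℕ → ℕ} (hg : PB g) : EB g := hg.two_pow.mono fun _ => Nat.lt_two_pow_self.le

theorem EB.const (c : ℕ) : EB fun _ => c := (PB.const c).eb

theorem EB.mul {g h : ℕ → ℕ} (hg : EB g) (hh : EB h) : EB fun n => g n * h n := by
  obtain ⟨k, hk⟩ := hg
  obtain ⟨l, hl⟩ := hh
  refine ((PB.add_two_pow k).add (PB.add_two_pow l)).two_pow.mono fun n => ?_
  rw [pow_add]
  exact Nat.mul_le_mul (hk n) (hl n)

theorem EB.add {g h : ℕ → ℕ} (hg : EB g) (hh : EB h) : EB fun n => g n + h n := by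
  obtain ⟨k, hk⟩ := hg
  obtain ⟨l, hl⟩ := hh
  refine ((EB.const 2).mul (((PB.add_two_pow k).add (PB.add_two_pow l)).two_pow)).mono fun n => ?_
  have h1 := (hk n).trans (Nat.pow_le_pow_right (n := 2) (by omega)
    (Nat.le_add_right ((n + 2) ^ k) ((n + 2) ^ l)))
  have h2 := (hl n).trans (Nat.pow_le_pow_right (n := 2) (by omega)
    (Nat.le_add_left ((n + 2) ^ l) ((n + 2) ^ k)))
  omega

theorem EB.pow {g : ℕ → ℕ} (hg : EB g) (k : ℕ) : EB fun n => g n ^ k := by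
  induction k with
  | zero => simpa using EB.const 1
  | succ k ih => simpa [pow_succ] using ih.mul hg

/-- There are at most `4 ^ S` objects with encodings of size at most `S`: the prefix notation, of
length at most `S`, has three letters, and the fourth value marks the positions beyond its end. -/
theorem length_le_of_nodup {α : Type} [Enc α] {l : List α} (hl : l.Nodup) {S : ℕ}
    (h : ∀ x ∈ l, sz x ≤ S) : l.length ≤ 4 ^ S := by
  let code : α → (Fin S → Option (Option Bool)) := fun x i => (enc x).ser[(i : ℕ)]?
  have hnd : (l.map code).Nodup := by
    refine hl.map_on fun x hx y hy hxy => Enc.inj (D.ser_injective ?_)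
    refine List.ext_getElem? fun i => ?_
    by_cases hi : i < S
    · exact congrFun hxy ⟨i, hi⟩
    · have h1 := h x hx
      have h2 := h y hy
      unfold sz at h1 h2
      rw [List.getElem?_eq_none (by rw [D.length_ser]; omega),
        List.getElem?_eq_none (by rw [D.length_ser]; omega)]
  have := hnd.length_le_card
  simpa using this

/-! ### The saturation procedure -/

section Saturation

variable [Fintype τ.Symbols]

/-- The facts found in the first `n` rounds. -/
noncomputable def facts (e : Env τ k) : ℕ → List (Fact τ k)
  | 0 => []
  | n + 1 => facts e n ++ (newFact e (facts e n)).toList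

/-- The flag of the state after `n + 1` rounds tells whether the last round has found a new fact. -/
theorem satStep_iterate (e : Env τ k) (n : ℕ) :
    satStep^[n + 1] (true, e, []) = ((newFact e (facts e n)).isSome, e, facts e (n + 1)) := by
  have step : ∀ (b : Bool) (n : ℕ), satStep (b, e, facts e n) =
      ((newFact e (facts e n)).isSome, e, facts e (n + 1)) := by
    intro b n
    rw [satStep, facts]
    cases newFact e (facts e n) <;> simp
  induction n with
  | zero => exact step true 0
  | succ n ih => rw [Function.iterate_succ_apply', ih, step]

/-- Bounds on the behaviours which occur in facts. -/
structure Beh.Small (e : Env τ k) (b : Beh k) : Prop where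
  pts : b.val.map Prod.fst = e.pts
  val : ∀ x ∈ b.val, x.2 ≤ sz e

theorem sz_pts_le (e : Env τ k) : sz e.pts ≤ sz e := by rw [sz_env]; simp; omega

theorem sz_tbl_le (e : Env τ k) : sz e.tbl ≤ sz e := by rw [sz_env]; simp; omega

theorem sz_start_le (e : Env τ k) : sz e.start ≤ sz e := by rw [sz_env]; simp; omega

theorem look_le {κ : Type} [DecidableEq κ] {l : List (κ × ℕ)} {C : ℕ} (h : ∀ x ∈ l, x.2 ≤ C)
    (a : κ) : look l a ≤ C := by
  rw [look]
  cases hf : l.find? fun e => decide (e.1 = a) with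
  | none => simp
  | some e => simpa using h e (List.mem_of_find?_eq_some hf)

theorem Sym.opVal_le (e : Env τ k) (a : Sym τ k) {vs : List (List (Point × ℕ))}
    (hvs : ∀ v ∈ vs, ∀ x ∈ v, x.2 ≤ sz e) {p : Point} (hp : p ∈ e.pts) :
    a.opVal e.tbl vs p ≤ sz e := by
  have h1 : ∀ i q, look (vs.getD i []) q ≤ sz e := by
    intro i q
    refine look_le (fun x hx => ?_) q
    by_cases hi : i < vs.length
    · rw [List.getD_eq_getElem _ _ hi] at hx
      exact hvs _ (List.getElem_mem hi) x hx
    · rw [List.getD_eq_default _ _ (by omega)] at hx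
      simp at hx
  have h2 : ∀ q, look e.tbl q ≤ sz e := by
    intro q
    refine look_le (fun x hx => ?_) q
    have := (sz_snd_le x).trans ((sz_le_of_mem hx).trans (sz_tbl_le e))
    rw [sz_nat] at this
    omega
  have h3 : ∀ b, ofB b ≤ sz e := by
    intro b
    have := sz_pos e
    cases b <;> simp [ofB]
    omega
  cases a with
  | rel R => exact h2 _
  | fn f => exact h2 _
  | ite =>
    simp only [Sym.opVal]
    cases decide (look (vs.getD 0 []) p = 1)
    · exact h1 _ _
    · exact h1 _ _
  | var x =>
    simp only [Sym.opVal]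
    by_cases hx : (x : ℕ) < p.2.2.length
    · rw [List.getD_eq_getElem _ _ hx]
      have h5 := (sz_le_of_mem (List.getElem_mem hx)).trans ((sz_snd_le p.2).trans
        ((sz_snd_le p).trans ((sz_le_of_mem hp).trans (sz_pts_le e))))
      rw [sz_nat] at h5
      omega
    · rw [List.getD_eq_default _ _ (by omega)]
      exact Nat.zero_le _
  | _ => exact h3 _

/-- The values never exceed the size of the input: they are entries of tables or of assignments, or
truth values. -/
theorem opBeh_small {e : Env τ k} {a : Sym τ k} {bs : List (Beh k)} {b : Beh k}
    (hbs : ∀ c ∈ bs, c.Small e) (h : opBeh e.pts e.tbl a bs = some b) : b.Small e := by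
  cases hc : decide (bs.map Beh.form = a.argForm) with
  | false => simp [opBeh, hc] at h
  | true =>
    rw [opBeh, hc, cond_true, Option.some.injEq] at h
    subst h
    refine ⟨by simp [Function.comp_def], fun x hx => ?_⟩
    obtain ⟨p, hp, rfl⟩ := List.mem_map.1 hx
    refine Sym.opVal_le e a (fun v hv => ?_) hp
    obtain ⟨c, hc, rfl⟩ := List.mem_map.1 hv
    exact (hbs c hc).val

/-- The invariant which bounds the size of the list of facts. -/
structure FactsSmall (e : Env τ k) (F : List (Fact τ k)) : Prop where
  nodup : (F.map Fact.key).Nodup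
  state : ∀ f ∈ F, f.state ∈ e.states
  beh : ∀ f ∈ F, f.beh.Small e
  idx : ∀ f ∈ F, f.idx < F.length
  refs : ∀ f ∈ F, f.refs.length ≤ maxArity τ ∧ ∀ i ∈ f.refs, i < F.length

theorem factsSmall_facts (e : Env τ k) (n : ℕ) : FactsSmall e (facts e n) := by
  induction n with
  | zero => constructor <;> simp [facts]
  | succ n ih =>
    rw [facts]
    generalize facts e n = F at ih ⊢
    cases hf : newFact e F with
    | none => simpa using ih
    | some f =>
      obtain ⟨fs, hfs, hlen, hst, hx, hidx, hk⟩ := newFact_eq_some hf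
      have h1 : f.beh.Small e ∧ f.refs.length ≤ maxArity τ ∧ ∀ i ∈ f.refs, i < F.length := by
        rw [infer] at hx
        cases ha : f.state.head?.bind letterSym with
        | none =>
          rw [ha] at hx
          obtain ⟨B, -, hx⟩ := Option.bind_eq_some_iff.1 hx
          obtain ⟨g, hg, hx⟩ := Option.bind_eq_some_iff.1 hx
          have hg := hfs g (List.mem_of_head? hg)
          cases hr : e.rules.any fun p => decide (p = (B.1, g.state)) with
          | false => simp [hr] at hx
          | true =>
            simp only [hr, cond_true, Option.some.injEq, Prod.mk.injEq] at hx
            rw [← hx.1, ← hx.2.2]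
            exact ⟨ih.beh g hg, ih.refs g hg⟩
        | some a =>
          rw [ha] at hx
          simp only [Option.elim_some] at hx
          cases hc : decide (fs.length = a.arity) && (chain e.q f.state.tail fs).isSome with
          | false => simp [hc] at hx
          | true =>
            rw [hc, cond_true] at hx
            obtain ⟨b, hb, hx⟩ := Option.map_eq_some_iff.1 hx
            simp only [Prod.mk.injEq] at hx
            rw [← hx.1, ← hx.2.2]
            refine ⟨opBeh_small (fun c hc => ?_) hb, by simpa using hlen, fun i hi => ?_⟩
            · obtain ⟨g, hg, rfl⟩ := List.mem_map.1 hc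
              exact ih.beh g (hfs g hg)
            · obtain ⟨g, hg, rfl⟩ := List.mem_map.1 hi
              exact ih.idx g (hfs g hg)
      constructor
      · simp only [Option.toList_some, List.map_append, List.map_cons, List.map_nil]
        rw [List.nodup_append]
        refine ⟨ih.nodup, by simp, fun a ha b hb => ?_⟩
        rintro rfl
        rw [List.mem_singleton.1 hb] at ha
        exact hk ha
      all_goals
        intro g hg
        rcases List.mem_append.1 hg with hg | hg
        rotate_left
        · obtain rfl : g = f := by simpa using hg
          first
            | exact hst
            | exact h1.1
            | (simp [hidx]; done)
            | exact ⟨h1.2.1, fun i hi => by have := h1.2.2 i hi; simp; omega⟩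
        · first
            | exact ih.state g hg
            | exact ih.beh g hg
            | (have := ih.idx g hg; simp; omega)
            | exact ⟨(ih.refs g hg).1, fun i hi => by have := (ih.refs g hg).2 i hi; simp; omega⟩

variable (τ k) in
/-- The number of facts, and the size of the list of facts, are at most exponential in the size of
the input. -/
theorem exists_facts_bound : ∃ L S : ℕ → ℕ, EB L ∧ EB S ∧
    ∀ (e : Env τ k) n, (facts e n).length ≤ L (sz e) ∧ sz (facts e n) ≤ S (sz e) := by
  obtain ⟨C, hC⟩ := PT.sz_bounded_of_finite (Finset (Fin k))
  obtain ⟨C', hC'⟩ := PT.sz_bounded_of_finite (Sym τ k)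
  -- bounds on the size of the key of a fact, and on the number of keys
  let K : ℕ → ℕ := fun n => n + C + n * (3 * n + 3) + 7
  let L : ℕ → ℕ := fun n => 2 ^ (2 * K n)
  have hK : PB K := ((PB.id.add (PB.const C)).add (PB.id.mul (((PB.const 3).mul PB.id).add
    (PB.const 3)))).add (PB.const 7)
  have hL : EB L := ((PB.const 2).mul hK).two_pow
  refine ⟨L, fun n => L n * (2 * L n + K n + C' + maxArity τ * (2 * L n + 2) + 10) + 1, hL,
    (hL.mul ((((((EB.const 2).mul hL).add hK.eb).add (EB.const C')).add ((EB.const (maxArity τ)).mul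
      (((EB.const 2).mul hL).add (EB.const 2)))).add (EB.const 10))).add (EB.const 1),
    fun e n => ?_⟩
  have h := factsSmall_facts e n
  generalize facts e n = F at h ⊢
  have hkey : ∀ f ∈ F, sz f.key ≤ K (sz e) := by
    intro f hf
    have h1 : sz f.state ≤ sz e :=
      (sz_suffix_le (mem_states.1 (h.state f hf))).trans (sz_start_le e)
    have h2 := sz_bool_le f.beh.form
    have h3 := hC f.beh.fv
    have h4 : ∀ x ∈ f.beh.val, sz x ≤ 3 * sz e + 2 := by
      intro x hx
      have h5 := (h.beh f hf).val x hx
      have h6 : x.1 ∈ e.pts := by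
        rw [← (h.beh f hf).pts]
        exact List.mem_map_of_mem hx
      have h7 := (sz_le_of_mem h6).trans (sz_pts_le e)
      obtain ⟨p, v⟩ := x
      simp only [sz_pair, sz_nat] at h5 h7 ⊢
      omega
    have h5 := sz_le_length_mul _ _ h4
    have h6 : f.beh.val.length ≤ sz e := by
      rw [← List.length_map (f := Prod.fst), (h.beh f hf).pts]
      exact (length_le_sz _).trans (sz_pts_le e)
    have h7 : f.beh.val.length * (3 * sz e + 2 + 1) ≤ sz e * (3 * sz e + 3) :=
      Nat.mul_le_mul_right (3 * sz e + 3) h6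
    rw [Fact.key, sz_pair, sz_beh]
    simp only [K]
    omega
  have hlen : F.length ≤ L (sz e) := by
    have := length_le_of_nodup h.nodup (S := K (sz e)) fun x hx => by
      obtain ⟨f, hf, rfl⟩ := List.mem_map.1 hx
      exact hkey f hf
    rw [List.length_map] at this
    simp only [L]
    rw [pow_mul]
    exact this
  refine ⟨hlen, (sz_le_length_mul F _ fun f hf => ?_).trans
    (Nat.add_le_add_right (Nat.mul_le_mul_right _ hlen) 1)⟩
  have h1 := hkey f hf
  have h2 := h.idx f hf
  have h3 := h.refs f hf
  have h4 := hC' f.sym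
  have h5 : sz f.refs ≤ maxArity τ * (2 * L (sz e) + 2) + 1 := by
    refine (sz_le_length_mul f.refs (2 * L (sz e) + 1) fun i hi => ?_).trans
      (Nat.add_le_add_right (Nat.mul_le_mul_right _ h3.1) 1)
    have := h3.2 i hi
    rw [sz_nat]
    omega
  rw [Fact.key, sz_pair] at h1
  rw [sz_fact]
  simp only [sz_pair, sz_nat]
  omega

theorem exists_newFact_eq_none (e : Env τ k) : ∃ n, newFact e (facts e n) = none := by
  by_contra! H
  have key : ∀ n, (facts e n).length = n := by
    intro n
    induction n with
    | zero => rfl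
    | succ n ih =>
      obtain ⟨f, hf⟩ := Option.ne_none_iff_exists'.1 (H n)
      simp [facts, hf, ih]
  obtain ⟨L, _, _, _, h⟩ := exists_facts_bound τ k
  have := (h e (L (sz e) + 1)).1
  rw [key] at this
  omega

open Classical in
/-- The number of rounds after which no new facts are found. -/
noncomputable def rounds (e : Env τ k) : ℕ := Nat.find (exists_newFact_eq_none e)

theorem newFact_rounds (e : Env τ k) : newFact e (facts e (rounds e)) = none := by
  classical
  exact Nat.find_spec (exists_newFact_eq_none e)

theorem newFact_ne_none {e : Env τ k} {n : ℕ} (h : n < rounds e) :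
    newFact e (facts e n) ≠ none := by
  classical
  exact Nat.find_min (exists_newFact_eq_none e) h

theorem length_facts {e : Env τ k} {n : ℕ} (h : n ≤ rounds e) : (facts e n).length = n := by
  induction n with
  | zero => rfl
  | succ n ih =>
    obtain ⟨f, hf⟩ := Option.ne_none_iff_exists'.1 (newFact_ne_none (show n < rounds e by omega))
    simp [facts, hf, ih (by omega)]

/-- The list of facts at the end of the saturation. -/
noncomputable def saturate (e : Env τ k) : List (Fact τ k) := facts e (rounds e)

theorem facts_rounds_succ (e : Env τ k) : facts e (rounds e + 1) = saturate e := by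
  rw [facts, newFact_rounds, saturate]
  simp

theorem factsOK_facts (I : Input τ k) (n : ℕ) : FactsOK I (facts (envOf I) n) := by
  induction n with
  | zero => constructor <;> simp [facts]
  | succ n ih =>
    rw [facts]
    cases hf : newFact (envOf I) (facts (envOf I) n) with
    | none => simpa using ih
    | some f => simpa using ih.append hf

/-- The solution of the query synthesis problem. -/
noncomputable def synth (I : Input τ k) : Option (SharedTree τ k) :=
  ((saturate (envOf I)).find? (Fact.isSolution (envOf I))).map fun f =>
    ⟨nodesOf (saturate (envOf I)), f.idx⟩

theorem encOutput_synth (I : Input τ k) :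
    encOutput (synth I) = outWord (envOf I) (saturate (envOf I)) := by
  have hF : ∀ f ∈ saturate (envOf I), f.refs.length = f.sym.arity := fun f hf =>
    ((factsOK_facts I _).sound f hf).1
  rw [synth, outWord]
  generalize saturate (envOf I) = F at hF
  cases F.find? (Fact.isSolution (envOf I)) with
  | none => rfl
  | some f =>
    have h1 : ∀ g ∈ F, (List.finRange g.sym.arity).flatMap
        (fun i : Fin g.sym.arity => encNat (g.refs.getD i 0)) =
        (g.refs.flatMap encNat : Word τ k) := by
      intro g hg
      have : g.refs = (List.finRange g.sym.arity).map
          fun i : Fin g.sym.arity => g.refs.getD i 0 := by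
        refine List.ext_getElem (by simp [hF g hg]) fun i h1 h2 => ?_
        simp [h1]
      conv_rhs => rw [this, List.flatMap_map]
    simp only [Option.map_some, Option.elim_some, encOutput, encList, nodesOf, List.flatMap_map,
      List.cons_append, List.append_assoc, List.nil_append]
    congr 2
    exact List.flatMap_congr fun g hg => by rw [h1 g hg]

theorem isSynthesizer_synth : IsSynthesizer (synth : Input τ k → _) := by
  intro I
  have hok := factsOK_facts I (rounds (envOf I))
  have hsat := newFact_rounds (envOf I)
  change FactsOK I (saturate (envOf I)) at hok
  change newFact (envOf I) (saturate (envOf I)) = none at hsat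
  rw [synth]
  generalize saturate (envOf I) = F at hok hsat
  have hstart : (envOf I).start = encTree (.leaf I.grammar.start) ++
      encList (fun p => encNat p.1 ++ encTree p.2) I.grammar.rules := rfl
  constructor
  · intro D hD
    obtain ⟨f, hf, rfl⟩ := Option.map_eq_some_iff.1 hD
    have hmem := List.mem_of_find?_eq_some hf
    have hsol := List.find?_some hf
    obtain ⟨⟨s, e⟩, hrep, hunf, hder⟩ := hok.unfolds I hmem
    have hs : s.isForm = true := by
      rw [← hrep.1]
      simp only [Fact.isSolution, Bool.and_eq_true] at hsol
      exact hsol.1.1.1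
    cases s with
    | term => cases hs
    | form =>
      obtain ⟨h1, h2, h3⟩ := (isSolution_iff hrep).1 hsol
      refine ⟨e, ⟨(I.grammar.mem_language_iff _).2 (hder _ _ (h1.trans hstart)), h2, h3⟩, ?_⟩
      have := hunf.mono (L' := []) (j' := f.idx)
      rwa [List.append_nil] at this
  · rintro hnone ⟨φ, hφ1, hφ2, hφ3⟩
    rw [Option.map_eq_none_iff, List.find?_eq_none] at hnone
    obtain ⟨f, hf, hst, hrep⟩ := exists_fact hsat ((I.grammar.mem_language_iff _).1 hφ1) _
      (by rw [← hstart]) ⟨_, φ⟩ rfl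
    exact hnone f hf ((isSolution_iff hrep).2 ⟨hst.trans hstart.symm, hφ2, hφ3⟩)

end Saturation

end QuerySynthesis

/-! ### Programs for input and output -/

namespace Prog

variable {p q : ℕ}

/-- Push the encoding of the number in the counter `i`. -/
def pushNum : Prog p q :=
  .seq pushNil <| .loop (fun v => decide ((v.i : ℕ) ≠ 0)) <|
    .seq pushNil <| .seq pushCons <|
      .load fun v => { v with i := ⟨v.i - 1, by have := v.i.2; omega⟩ }

theorem runs_pushNum {v : Reg p q} {ip o m a b c Q}
    (h : ∀ v', Q (v', stk ip o ((enc (v.i : ℕ)).ser ++ m) a b c)) :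
    Runs pushNum (v, stk ip o m a b c) (4 * v.i + 2) Q := by
  have key : ∀ (n l : ℕ) (v : Reg p q), (v.i : ℕ) = n →
      (∀ v', Q (v', stk ip o ((enc (n + l)).ser ++ m) a b c)) →
      Runs (.loop (fun v => decide ((v.i : ℕ) ≠ 0)) <| .seq pushNil <| .seq pushCons <|
        .load fun v => { v with i := ⟨v.i - 1, by have := v.i.2; omega⟩ })
        (v, stk ip o ((enc l).ser ++ m) a b c) (4 * n + 1) Q := by
    intro n
    induction n with
    | zero =>
      intro l v hv h
      refine Runs.loop_false (by simp [hv]) ?_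
      have := h v
      rwa [zero_add] at this
    | succ n ih =>
      intro l v hv h
      refine Runs.mono (T := 3 + (4 * n + 1) + 1) ?_ (by omega) fun _ h => h
      refine Runs.loop_true (by simp [hv]) (Runs.seq_push (Runs.seq_push (Runs.load ?_)))
      simp only [stk_m, update_m]
      have e : (some true :: some false :: ((enc l).ser ++ m) : List (Option Bool)) =
          (enc (l + 1)).ser ++ m := by simp [D.ser]
      rw [e]
      refine ih (l + 1) _ (by simp [hv]) fun v' => ?_
      have := h v'
      rwa [show n + 1 + l = n + (l + 1) by ring] at this
  refine Runs.mono (T := 4 * v.i + 1 + 1) ?_ (by omega) fun _ h => h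
  refine Runs.seq_push ?_
  simp only [stk_m, update_m]
  exact key v.i 0 v rfl h

/-- Pop a letter from the input stack into the counter `i`; the flag tells whether there was one. -/
def popInp : Prog p q := .pop .inp fun v s => { v with f := s.isSome, i := s.getD 0 }

/-- Read the input stack. The word on it is reversed in the process. -/
def readInput : Prog p q :=
  .seq pushNil <| .seq popInp <| .loop (fun v => v.f) (.seq pushNum (.seq pushCons popInp))

theorem runs_readInput {v : Reg p q} {ip : List (Fin (p + 1))} {o m a b c Q}
    (h : ∀ v', Q (v', stk [] o ((enc (ip.map Fin.val).reverse).ser ++ m) a b c)) :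
    Runs readInput (v, stk ip o m a b c) ((ip.length + 1) * (4 * p + 5)) Q := by
  have key : ∀ (ip : List (Fin (p + 1))) (l : List ℕ) (v : Reg p q),
      v.f = ip.head?.isSome → v.i = ip.head?.getD 0 →
      (∀ v', Q (v', stk [] o ((enc ((ip.map Fin.val).reverse ++ l)).ser ++ m) a b c)) →
      Runs (.loop (fun v => v.f) (.seq pushNum (.seq pushCons popInp)))
        (v, stk ip.tail o ((enc l).ser ++ m) a b c) (ip.length * (4 * p + 5) + 1) Q := by
    intro ip
    induction ip with
    | nil =>
      intro l v hf hi h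
      refine Runs.mono (T := 1) (Runs.loop_false (by simpa using hf) ?_) (by simp) fun _ h => h
      simpa using h v
    | cons x ip ih =>
      intro l v hf hi h
      have hx : (v.i : ℕ) = x := by rw [hi]; rfl
      have hxp : (x : ℕ) ≤ p := Nat.le_of_lt_succ x.2
      refine Runs.mono (T := (4 * v.i + 2 + 2) + (ip.length * (4 * p + 5) + 1) + 1) ?_
        (by rw [List.length_cons]; linarith) fun _ h => h
      refine Runs.loop_true hf (Runs.seq (runs_pushNum fun v' => Runs.seq_push (Runs.pop ?_)))
      simp only [stk_m, update_m, stk_inp, update_inp, List.tail_cons, hx]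
      have e : (some true :: ((enc (x : ℕ)).ser ++ ((enc l).ser ++ m)) : List (Option Bool)) =
          (enc ((x : ℕ) :: l)).ser ++ m := by simp [D.ser]
      rw [e]
      refine ih _ _ rfl rfl fun v'' => ?_
      simpa using h v''
  refine Runs.mono (T := ip.length * (4 * p + 5) + 1 + 1 + 1) ?_ (by linarith) fun _ h => h
  refine Runs.seq_push (Runs.seq_pop ?_)
  simp only [stk_m, update_m, stk_inp, update_inp]
  refine key ip [] _ rfl rfl fun v' => ?_
  simpa using h v'

/-- Remove the encoding of a number, except for its first symbol which is already in the register,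
from the main stack, and count in `j`. -/
def popNum : Prog p q :=
  .loop (fun v => v.x == some true) <| .seq popX <| .seq popX <|
    .load fun v => { v with j := ⟨min (v.j + 1) q, by omega⟩ }

/-- The condition `hu` says that the symbol in the register `x` and the main stack together start
with the encoding of `n`. -/
theorem runs_popNum (n : ℕ) {v : Reg p q} {ip o m a b c Q} {u : List (Option Bool)}
    (hu : v.x.elim u (fun s => some s :: u) = (enc n).ser ++ m) (hx : v.x.isSome)
    (hn : v.j + n ≤ q)
    (h : ∀ v' : Reg p q, (v'.j : ℕ) = v.j + n → Q (v', stk ip o m a b c)) :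
    Runs popNum (v, stk ip o u a b c) (4 * n + 1) Q := by
  induction n generalizing v u with
  | zero =>
    obtain ⟨_ | x, y, f, i, j⟩ := v
    · simp at hx
    · simp [D.ser] at hu
      obtain ⟨rfl, rfl⟩ := hu
      exact Runs.loop_false rfl (h _ rfl)
  | succ n ih =>
    obtain ⟨_ | x, y, f, i, j⟩ := v
    · simp at hx
    · simp [D.ser] at hu
      obtain ⟨rfl, rfl⟩ := hu
      refine Runs.mono (T := 3 + (4 * n + 1) + 1) ?_ (by omega) fun _ h => h
      refine Runs.loop_true rfl (Runs.seq_pop (Runs.seq_pop (Runs.load ?_)))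
      simp only [stk_m, update_m, List.tail_cons]
      have hser : ∃ s w, (enc n).ser ++ m = some s :: w := by
        cases n with
        | zero => exact ⟨_, _, rfl⟩
        | succ n => exact ⟨true, _, by rw [enc_succ, D.ser]; rfl⟩
      obtain ⟨s, w, hw⟩ := hser
      simp only [hw, List.head?_cons, List.tail_cons, Option.getD_some]
      simp only at hn h
      refine ih (by simpa using hw.symm) rfl ?_ fun v' hv' => h v' ?_
      · simp only; omega
      · simp only at hv'; omega

/-- Move a list of numbers to the output stack. The list is reversed in the process. -/
def writeOut : Prog p q :=
  .seq popX <| .loop (fun v => v.x == some true) <|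
    .seq (.load fun v => { v with j := 0 }) <| .seq popX <| .seq popNum <|
      .seq (.push .out fun v => v.j) popX

theorem runs_writeOut {v : Reg p q} (l : List (Fin (q + 1))) {ip o m a b c Q}
    (h : ∀ v', Q (v', stk ip (l.reverse ++ o) m a b c)) :
    Runs writeOut (v, stk ip o ((enc (l.map Fin.val)).ser ++ m) a b c)
      ((l.length + 1) * (4 * q + 6)) Q := by
  have key : ∀ (l : List (Fin (q + 1))) (v : Reg p q) (o : List (Fin (q + 1)))
      (u : List (Option Bool)),
      v.x.isSome = true →
      v.x.elim u (fun s => some s :: u) = (enc (l.map Fin.val)).ser ++ m →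
      (∀ v', Q (v', stk ip (l.reverse ++ o) m a b c)) →
      Runs (.loop (fun v => v.x == some true) <|
        .seq (.load fun v => { v with j := 0 }) <| .seq popX <| .seq popNum <|
          .seq (.push .out fun v => v.j) popX) (v, stk ip o u a b c)
        (l.length * (4 * q + 6) + 1) Q := by
    intro l
    induction l with
    | nil =>
      rintro ⟨_ | x, y, f, i, j⟩ o u hx hu h
      · simp at hx
      · simp [D.ser] at hu
        obtain ⟨rfl, rfl⟩ := hu
        refine Runs.mono (T := 1) (Runs.loop_false (by rfl) ?_) (by simp) fun _ h => h
        simpa using h _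
    | cons n l ih =>
      rintro ⟨_ | x, y, f, i, j⟩ o u hx hu h
      · simp at hx
      · simp [D.ser] at hu
        obtain ⟨rfl, rfl⟩ := hu
        have hnq : (n : ℕ) ≤ q := Nat.le_of_lt_succ n.2
        refine Runs.mono (T := ((4 * n + 1) + 2) + 1 + 1 + (l.length * (4 * q + 6) + 1) + 1) ?_
          (by rw [List.length_cons]; linarith) fun _ h => h
        refine Runs.loop_true rfl (Runs.seq_load (Runs.seq_pop ?_))
        have hser : ∀ (x : D) (r : List (Option Bool)), ∃ s w, x.ser ++ r = some s :: w := by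
          rintro (_ | ⟨x, y⟩) r
          · exact ⟨_, _, rfl⟩
          · exact ⟨_, _, rfl⟩
        obtain ⟨s, w, hw⟩ := hser (enc (n : ℕ)) ((enc (l.map Fin.val)).ser ++ m)
        simp only [stk_m, update_m, hw, List.head?_cons, List.tail_cons, Option.getD_some]
        suffices H : ∀ v₁ : Reg p q, v₁.x = some s → (v₁.j : ℕ) = 0 →
            Runs (.seq popNum (.seq (.push .out fun v => v.j) popX)) (v₁, stk ip o w a b c)
              ((4 * n + 1) + 2) fun s' => Runs (.loop (fun v => v.x == some true) <|
                .seq (.load fun v => { v with j := 0 }) <| .seq popX <| .seq popNum <|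
                  .seq (.push .out fun v => v.j) popX) s' (l.length * (4 * q + 6) + 1) Q from
          H _ rfl rfl
        intro v₁ hv₁ hj₁
        refine Runs.seq (runs_popNum n (m := (enc (l.map Fin.val)).ser ++ m)
          (by simpa [hv₁] using hw.symm) (by simp [hv₁]) (by omega)
          fun v' hv' => Runs.seq_push (Runs.pop ?_))
        obtain ⟨s', w', hw'⟩ := hser (enc (l.map Fin.val)) m
        simp only [stk_m, update_m, stk_out, update_out, hw', List.head?_cons, List.tail_cons,
          Option.getD_some]
        have hj : v'.j = n := Fin.ext (by omega)
        rw [hj]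
        refine ih _ (n :: o) w' rfl (by simpa using hw'.symm) fun v'' => ?_
        simpa using h v''
  have hser : ∃ s w, (enc (l.map Fin.val)).ser ++ m = some s :: w := by
    cases enc (l.map Fin.val) with
    | nil => exact ⟨_, _, rfl⟩
    | cons x y => exact ⟨_, _, rfl⟩
  obtain ⟨s, w, hw⟩ := hser
  refine Runs.mono (T := l.length * (4 * q + 6) + 1 + 1) ?_ (by linarith) fun _ h => h
  refine Runs.seq_pop ?_
  simp only [stk_m, update_m, hw, List.head?_cons, List.tail_cons, Option.getD_some]
  exact key l _ o w rfl (by simpa using hw.symm) h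

end Prog

/-! ### Turing machines -/

section Machines

variable {p q : ℕ}

/-- The register at the start of a computation and after it. -/
def Reg.init (p q : ℕ) : Reg p q := ⟨none, none, false, 0, 0⟩

/-- Read the input, run the program `c`, and write the output. -/
def Prog.main (c : Prog p q) : Prog p q :=
  .seq readInput <| .seq c <| .seq writeOut <| .load fun _ => Reg.init p q

/-- The Turing machine for a program. -/
noncomputable def Prog.machine (c : Prog p q) : Turing.FinTM2 :=
  let _ : Fintype Stk := Fintype.ofFinite _
  let _ : Fintype c.main.Lab := @Fintype.ofFinite _ c.main.finite_lab
  let _ : Fintype (Reg p q) := Fintype.ofFinite _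
  { K := Stk
    k₀ := .inp
    k₁ := .out
    Γ := Alpha p q
    Λ := c.main.Lab
    main := c.main.entry
    σ := Reg p q
    initialState := Reg.init p q
    Γk₀Fin := inferInstanceAs (Fintype (Fin (p + 1)))
    m := c.main.code id .halt }

/-- The argument and the result of `c` are reversed, because `readInput` and `writeOut` reverse
words. -/
theorem Prog.machine_outputs (c : Prog p q) {T : ℕ} (ip : List (Fin (p + 1)))
    (o : List (Fin (q + 1)))
    (h : Impl c (enc (ip.map Fin.val).reverse) (enc (o.map Fin.val).reverse) T) :
    Nonempty (Turing.TM2OutputsInTime c.machine ip (some o)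
      ((ip.length + 1) * (4 * p + 5) + (T + ((o.length + 1) * (4 * q + 6) + 1)))) := by
  have hrun : Runs c.main (Reg.init p q, stk ip [] [] [] [] [])
      ((ip.length + 1) * (4 * p + 5) + (T + ((o.length + 1) * (4 * q + 6) + 1)))
      fun s => s = (Reg.init p q, stk [] o [] [] [] []) := by
    refine Runs.seq (Prog.runs_readInput fun v₁ => Runs.seq (h v₁ _ _ _ _ _ _ _ fun v₂ => ?_))
    have := Prog.runs_writeOut (p := p) (v := v₂) o.reverse (ip := []) (o := []) (m := []) (a := [])
      (b := []) (c := []) (Q := fun s => Runs (.load fun _ => Reg.init p q) s 1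
        fun s => s = (Reg.init p q, stk [] o [] [] [] [])) fun v₃ => Runs.load (by simp)
    rw [List.length_reverse, List.map_reverse] at this
    exact Runs.seq this
  obtain ⟨t, s', ht, he, rfl⟩ := hrun
  have hsim := he.simulates (c.main.code id .halt) id .halt fun _ => rfl
  have hinit : Turing.initList c.machine ip =
      ⟨some c.main.entry, Reg.init p q, stk ip [] [] [] [] []⟩ := by
    simp only [Turing.initList]
    congr 1
    funext i
    cases i <;> rfl
  have hhalt : Turing.haltList c.machine o = ⟨none, Reg.init p q, stk [] o [] [] [] []⟩ := by
    simp only [Turing.haltList]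
    congr 1
    funext i
    cases i <;> rfl
  refine ⟨⟨⟨t, ?_⟩, ht⟩⟩
  exact (congrArg (fun z => (flip bind c.machine.step)^[t] (some z)) hinit).trans
    (hsim.trans (congrArg some hhalt.symm))

/-- A program with exponential running time yields a Turing machine with exponential running time.
-/
theorem computableInExpTime_of_impl {α β αΓ βΓ : Type} {ea : α → List αΓ} {eb : β → List βΓ}
    {f : α → β} (e₁ : αΓ ≃ Fin (p + 1)) (e₂ : βΓ ≃ Fin (q + 1)) (c : Prog p q) {T : ℕ → ℕ}
    (hT : EB T) (hc : ∀ x, Impl c (enc ((ea x).map fun a => (e₁ a : ℕ)).reverse)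
      (enc ((eb (f x)).map fun a => (e₂ a : ℕ)).reverse) (T (ea x).length))
    (hlen : ∀ x, (eb (f x)).length ≤ T (ea x).length) : ComputableInExpTime ea eb f := by
  have hB : EB fun n => (n + 1) * (4 * p + 5) + (T n + ((T n + 1) * (4 * q + 6) + 1)) :=
    (((PB.id.add (PB.const 1)).mul (PB.const _)).eb).add
      (hT.add (((hT.add (EB.const 1)).mul (EB.const _)).add (EB.const 1)))
  obtain ⟨k, hk⟩ := hB
  have h : ∀ x, Nonempty (Turing.TM2OutputsInTime c.machine ((ea x).map e₁)
      (some ((eb (f x)).map e₂)) (2 ^ ((ea x).length + 2) ^ k)) := by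
    intro x
    obtain ⟨⟨ho, ht⟩⟩ := Prog.machine_outputs c ((ea x).map e₁) ((eb (f x)).map e₂)
      (T := T (ea x).length) (by simpa [Function.comp_def] using hc x)
    refine ⟨⟨ho, ht.trans (le_trans ?_ (hk _))⟩⟩
    simp only [List.length_map]
    have := Nat.mul_le_mul_right (4 * q + 6) (Nat.add_le_add_right (hlen x) 1)
    omega
  exact ⟨{ tm := c.machine
           inputAlphabet := e₁.symm
           outputAlphabet := e₂.symm
           time := fun n => 2 ^ (n + 2) ^ k
           outputsFun := fun x => (h x).some }, (Polynomial.X + 2) ^ k, fun n => by simp⟩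

end Machines

/-! ### The algorithm as a program -/

section Main

variable {τ : FirstOrder.Language.{0, 0}} {k : ℕ} [Fintype τ.Symbols]

/-- An arbitrary value, used if the input word does not encode an input. -/
def Env.empty : Env τ k := ⟨0, [], [], 0, [], []⟩

/-- The state from which the saturation starts. -/
noncomputable def initState (w : Word τ k) : Bool × Env τ k × List (Fact τ k) :=
  (parse w).elim (false, Env.empty, []) fun e => (true, e, [])

/-- The state with which the saturation ends. -/
noncomputable def finalState (w : Word τ k) : Bool × Env τ k × List (Fact τ k) :=
  (parse w).elim (false, Env.empty, []) fun e => (false, e, saturate e)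

variable (τ k) in
/-- The final state is computed in exponential time: there are exponentially many rounds, and a
round takes polynomial time in the size of the state, which is exponential in that of the input. -/
theorem exists_saturation_program : ∃ T, EB T ∧ ∀ p q, ∃ c : Prog p q, ∀ w : Word τ k,
    Impl c (enc w.reverse) (enc (finalState w)) (T w.length) ∧ sz (finalState w) ≤ T w.length := by
  have hinit : PT fun w : Word τ k => initState w.reverse := by
    unfold initState
    fun_prop
  obtain ⟨k₁, h₁⟩ := hinit
  obtain ⟨k₂, h₂⟩ := PT.satStep (τ := τ) (k := k)
  obtain ⟨L, S, ⟨kL, hL⟩, ⟨kS, hS⟩, hLS⟩ := exists_facts_bound τ k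
  obtain ⟨C, hC⟩ := PT.sz_bounded_of_finite (Letter τ k)
  -- the size of the input, of the initial state, the number of facts, and the size of all states
  let n₀ : ℕ → ℕ := fun n => n * (C + 1) + 1
  let n₁ : ℕ → ℕ := fun n => (n₀ n + 2) ^ k₁
  let N : ℕ → ℕ := fun n => 2 ^ (n₁ n + 2) ^ kL
  let M : ℕ → ℕ := fun n => n₁ n + 2 ^ (n₁ n + 2) ^ kS + 10
  have hn₀ : PB n₀ := (PB.id.mul (PB.const _)).add (PB.const 1)
  have hn₁ : PB n₁ := (PB.add_two_pow k₁).comp hn₀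
  have hN : EB N := ((PB.add_two_pow kL).comp hn₁).two_pow
  have hM : EB M := (hn₁.eb.add ((PB.add_two_pow kS).comp hn₁).two_pow).add (EB.const 10)
  refine ⟨fun n => n₁ n + ((N n + 1) * ((M n + 2) ^ k₂ + 9) + 9) + M n,
    (hn₁.eb.add (((hN.add (EB.const 1)).mul (((hM.add (EB.const 2)).pow k₂).add
      (EB.const 9))).add (EB.const 9))).add hM, fun p q => ?_⟩
  obtain ⟨c₁, hc₁⟩ := h₁ p q
  obtain ⟨c₂, hc₂⟩ := h₂ p q
  refine ⟨.seq c₁ (Prog.whileTest c₂), fun w => ?_⟩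
  have hw : sz w ≤ n₀ w.length := sz_le_length_mul w C fun x _ => hC x
  have hinit := hc₁ w.reverse
  simp only [List.reverse_reverse, sz_reverse] at hinit
  beta_reduce
  have hpow : (sz w + 2) ^ k₁ ≤ n₁ w.length := Nat.pow_le_pow_left (by omega) k₁
  rw [initState] at hinit
  rw [finalState]
  cases hp : parse w with
  | none =>
    rw [hp, Option.elim_none] at hinit
    rw [Option.elim_none]
    have hloop : Impl (Prog.whileTest c₂)
        (enc (false, (Env.empty : Env τ k), ([] : List (Fact τ k))))
        (enc (false, (Env.empty : Env τ k), ([] : List (Fact τ k)))) (0 * (0 + 9) + 9) :=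
      Prog.impl_whileTest 0 (fun _ => enc (false, (Env.empty : Env τ k), ([] : List (Fact τ k))))
        (by simp) rfl (by simp)
    exact ⟨(hinit.1.seq hloop).mono (by omega), by omega⟩
  | some e =>
    rw [hp, Option.elim_some] at hinit
    rw [Option.elim_some]
    have he : sz e ≤ n₁ w.length := by
      have h3 := hinit.2.trans hpow
      simp only [sz_pair] at h3
      omega
    have hpe : ∀ j, (sz e + 2) ^ j ≤ (n₁ w.length + 2) ^ j := fun j =>
      Nat.pow_le_pow_left (by omega) j
    have hsize : ∀ (b : Bool) i, sz (b, e, facts e i) ≤ M w.length := by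
      intro b i
      have h3 := ((hLS e i).2.trans (hS _)).trans
        (Nat.pow_le_pow_right (n := 2) (by omega) (hpe kS))
      have h4 := sz_bool_le b
      simp only [sz_pair, M]
      omega
    have hrounds : rounds e + 1 ≤ N w.length + 1 := by
      have h3 := ((hLS e (rounds e)).1.trans (hL _)).trans
        (Nat.pow_le_pow_right (n := 2) (by omega) (hpe kL))
      rw [length_facts le_rfl] at h3
      exact Nat.add_le_add_right h3 1
    have hstate : ∀ i, ∃ b, satStep^[i] (true, e, []) = (b, e, facts e i) := by
      rintro (_ | i)
      · exact ⟨true, rfl⟩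
      · exact ⟨_, satStep_iterate e i⟩
    have hfinal : satStep^[rounds e + 1] (true, e, []) = (false, e, saturate e) := by
      rw [satStep_iterate, newFact_rounds, facts_rounds_succ]
      rfl
    have hloop : Impl (Prog.whileTest c₂) (enc (true, e, ([] : List (Fact τ k))))
        (enc (satStep^[rounds e + 1] (true, e, [])))
        ((rounds e + 1) * ((M w.length + 2) ^ k₂ + 9) + 9) := by
      refine Prog.impl_whileTest (rounds e + 1) (fun i => enc (satStep^[i] (true, e, []))) ?_ ?_ ?_
      · rintro (_ | i) hi
        · rfl
        · rw [satStep_iterate]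
          obtain ⟨f, hf⟩ := Option.ne_none_iff_exists'.1
            (newFact_ne_none (show i < rounds e by omega))
          rw [hf]
          rfl
      · rw [hfinal]
        rfl
      · intro i _
        rw [Function.iterate_succ_apply']
        refine (hc₂ _).1.mono ?_
        obtain ⟨b, hb⟩ := hstate i
        rw [hb]
        exact Nat.pow_le_pow_left (Nat.add_le_add_right (hsize b i) 2) k₂
    rw [hfinal] at hloop
    have h3 := Nat.mul_le_mul_right ((M w.length + 2) ^ k₂ + 9) hrounds
    have h4 : sz (false, e, saturate e) ≤ M w.length := hsize false _
    exact ⟨(hinit.1.seq hloop).mono (by omega), by omega⟩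

/-- The letters are numbered; words and lists of numbers have the same encodings. -/
theorem exists_equiv_letter (τ : FirstOrder.Language.{0, 0}) [Fintype τ.Symbols] (k : ℕ) :
    ∃ (p : ℕ) (e : Letter τ k ≃ Fin (p + 1)), ∀ w : Word τ k,
      enc (w.map fun a => (e a : ℕ)) = enc w := by
  have : Nonempty (Letter τ k) := ⟨.tick⟩
  have h : Nat.card (Letter τ k) = Nat.card (Letter τ k) - 1 + 1 :=
    (Nat.succ_pred_eq_of_pos Nat.card_pos).symm
  refine ⟨_, (Finite.equivFin _).trans (finCongr h), fun w => ?_⟩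
  change D.ofList _ = D.ofList _
  rw [List.map_map]
  rfl

/-- Every function of the final state that is computable in polynomial time yields a function that
is computable in exponential time. -/
theorem computableInExpTime_of_finalState {α β βΓ : Type} [Enc βΓ] {ea : α → Word τ k}
    {eb : β → List βΓ} {f : α → β} {q : ℕ} (e₂ : βΓ ≃ Fin (q + 1))
    (he₂ : ∀ l : List βΓ, enc (l.map fun a => (e₂ a : ℕ)) = enc l)
    {g : Bool × Env τ k × List (Fact τ k) → List βΓ} (hg : PT g)
    (h : ∀ x, eb (f x) = g (finalState (ea x))) : ComputableInExpTime ea eb f := by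
  obtain ⟨p, e₁, he₁⟩ := exists_equiv_letter τ k
  obtain ⟨T, hT, hc⟩ := exists_saturation_program τ k
  obtain ⟨c, hc⟩ := hc p q
  obtain ⟨j, hg⟩ := hg.reverse
  obtain ⟨d, hd⟩ := hg p q
  refine computableInExpTime_of_impl e₁ e₂ (.seq c d) (T := fun n => T n + (T n + 2) ^ j)
    (hT.add ((hT.add (EB.const 2)).pow j)) (fun x => ?_) fun x => ?_
  · have h1 := hc (ea x)
    have h2 := hd (finalState (ea x))
    rw [← List.map_reverse, ← List.map_reverse, he₁, he₂, h]
    refine (h1.1.seq h2.1).mono ?_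
    have := Nat.pow_le_pow_left (Nat.add_le_add_right h1.2 2) j
    omega
  · have h1 := hc (ea x)
    have h2 := (hd (finalState (ea x))).2
    have h3 := Nat.pow_le_pow_left (Nat.add_le_add_right h1.2 2) j
    have h4 := length_le_sz (g (finalState (ea x)))
    rw [sz_reverse] at h2
    rw [h]
    omega

theorem finalState_encInput (I : Input τ k) :
    finalState (encInput I) = (false, envOf I, saturate (envOf I)) := by
  rw [finalState, parse_encInput]
  rfl

/-- A word which does not encode an input leads to an empty list of facts. -/
theorem mem_realizable_iff (w : Word τ k) : w ∈ realizable τ k ↔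
    ((finalState w).2.2.find? (Fact.isSolution (finalState w).2.1)).isSome = true := by
  have key : ∀ I : Input τ k, (∃ φ : Formula τ k, I.IsSolution φ) ↔
      ((saturate (envOf I)).find? (Fact.isSolution (envOf I))).isSome = true := by
    intro I
    have hI := isSynthesizer_synth I
    rw [synth] at hI
    cases hf : (saturate (envOf I)).find? (Fact.isSolution (envOf I)) with
    | none => simpa using hI.2 (by rw [hf]; rfl)
    | some f =>
      obtain ⟨φ, hφ, -⟩ := hI.1 _ (by rw [hf]; rfl)
      exact iff_of_true ⟨φ, hφ⟩ rfl
  constructor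
  · rintro ⟨I, rfl, h⟩
    rw [finalState_encInput]
    exact (key I).1 h
  · intro h
    cases hp : parse w with
    | none =>
      rw [finalState, hp] at h
      cases h
    | some e =>
      obtain ⟨I, rfl⟩ := parse_sound hp
      rw [finalState_encInput] at h
      exact ⟨I, rfl, (key I).2 h⟩

end Main

end QuerySynth

/-- For every fixed finite signature `τ` and every fixed number `k` of variables, query synthesis
for `FO(k)` is decidable in exponential time: the existence of a solution is in EXPTIME, and a
solution is computed in exponential time if there is one. -/
theorem mainTheorem2 (τ : FirstOrder.Language.{0, 0}) [Fintype τ.Symbols] (k : ℕ) :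
    QuerySynth.InEXPTIME (QuerySynth.realizable τ k) ∧
    ∃ f : QuerySynth.Input τ k → Option (QuerySynth.SharedTree τ k),
      QuerySynth.IsSynthesizer f ∧
      QuerySynth.ComputableInExpTime QuerySynth.encInput QuerySynth.encOutput f := by
  classical
  refine ⟨?_, QuerySynth.synth, QuerySynth.isSynthesizer_synth, ?_⟩
  · refine QuerySynth.computableInExpTime_of_finalState finTwoEquiv.symm (fun l => ?_)
      (g := fun z => [(z.2.2.find? (QuerySynth.Fact.isSolution z.2.1)).isSome]) (by fun_prop)
      fun w => ?_
    · change QuerySynth.D.ofList _ = QuerySynth.D.ofList _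
      rw [List.map_map]
      refine congrArg _ (List.map_congr_left fun b _ => ?_)
      cases b <;> rfl
    · refine congrArg (fun b => [b]) ?_
      rw [Bool.eq_iff_iff, decide_eq_true_eq]
      exact QuerySynth.mem_realizable_iff w
  · obtain ⟨q, e₂, he₂⟩ := QuerySynth.exists_equiv_letter τ k
    refine QuerySynth.computableInExpTime_of_finalState e₂ he₂
      (g := fun z => QuerySynth.outWord z.2.1 z.2.2) (by fun_prop) fun I => ?_
    rw [QuerySynth.finalState_encInput, QuerySynth.encOutput_synth]
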